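/- **Theorem.** Let $A\in\mathbb R^{m\times n}$ ($m,n\ge 1$) have at least one nonzero entry in every row and in every column, and let $\epsilon>0$. Put $\mathcal Z=\Delta^n\times\Delta^m$ (probability simplices; $z=(z^{\mathsf x},z^{\mathsf y})$), $r(z)=\sum_k [z]_k\log [z]_k$, $V_z(z')=r(z')-r(z)-\langle\nabla r(z),z'-z\rangle$, $\mathrm{clip}(\delta)=\mathrm{sign}(\delta)\circ\min\{1,|\delta|\}$ (entrywise), $$L=L_{\mathsf{co}}^{1,1}=\max\{\max_i\|A_{i:}\|_2,\ \max_j\|A_{:j}\|_2\},\qquad \mathrm{Gap}(z)=\max_{y'\in\Delta^m}y'^\top A z^{\mathsf x}-\min_{x'\in\Delta^n}(z^{\mathsf y})^\top A x' .$$ For $z\in\mathcal Z$ let $p_{ij}(z)=[z^{\mathsf y}]_i A_{ij}^2/\|A_{i:}\|_2^2$ and $q_{ij}(z)=[z^{\mathsf x}]_jA_{ij}^2/\|A_{:j}\|_2^2$; draw independently $(i^{\mathsf x},j^{\mathsf x})\sim p(z)$ and $(i^{\mathsf y},j^{\mathsf y})\sim q(z)$, and set $$\tilde g(z)=\Big(\tfrac{A_{i^{\mathsf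 x}j^{\mathsf x}}[z^{\mathsf y}]_{i^{\mathsf x}}}{p_{i^{\mathsf x}j^{\mathsf x}}(z)}e_{j^{\mathsf x}},\ -\tfrac{A_{i^{\mathsf y}j^{\mathsf y}}[z^{\mathsf x}]_{j^{\mathsf y}}}{q_{i^{\mathsf y}j^{\mathsf y}}(z)}e_{i^{\mathsf y}}\Big).$$ Stochastic mirror descent with clipping, with $\eta=\epsilon/(18L^2)$ and $T=\lceil 6\log(mn)/(\eta\epsilon)\rceil$, starts at $z_0=\operatorname{argmin}_{\mathcal Z} r$, iterates $$z_t=\operatorname{argmin}_{z\in\mathcal Z}\{\langle\mathrm{clip}(\eta\tilde g(z_{t-1})),z\rangle+V_{z_{t-1}}(z)\}\qquad(1\le t\le T)$$ with fresh samples in each step, and returns $\bar z=\frac1{T+1}\sum_{t=0}^Tz_t$. Consider the following implementation on a randomized real RAM with exact arithmetic, in which each of the following costs one unit of time: an arithmetic operation, comparison, exponential or logarithm; a memory access; a coin flip of given bias; a query of $A_{ij}$, $\|A_{i:}\|_2$ or $\|A_{:j}\|_2$; a draw of $j$ with probability $A_{ij}^2/\|A_{i:}\|_2^2$ for given $i$,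 or of $i$ with probability $A_{ij}^2/\|A_{:j}\|_2^2$ for given $j$. The input is $m,n,\epsilon$ and the above access to $A$; $L,\eta$ and the iteration bound are computed by the program. Each block of the current iterate is kept in the data structure $\mathtt{IterateMaintainer}_1$: the block $x$ is stored as $x=\xi u$ and the running sum of iterates as $s=u'+\sigma u$, together with $\nu=\|x\|_1$ and a balanced binary tree of partial sums of $u$. It supports scaling $x\gets cx$, $s\gets s+x$ and queries of $[x]_j,[s]_j,\|x\|_1$ by $O(1)$ operations, and $[x]_j\gets[x]_j+c$ as well as sampling $j$ with probability $[x]_j/\|x\|_1$ by a walk along one leaf–root path. Each iteration samples $(i^{\mathsf x},j^{\mathsf x})$ and $(i^{\mathsf y},j^{\mathsf y})$ through the data structures and the matrix access, multiplies $[z^{\mathsf x}]_{j^{\mathsf x}}$ and $[z^{\mathsf y}]_{i^{\mathsf y}}$ by $\exp(-c)$, with $c$ the corresponding entry of $\mathrm{clip}(\eta\tilde g(z))$, divides each block by its $\ell_1$ norm, and updates the running sums. Then the output of this implementation has the law of the output $\bar z$ of stochastic mirror descent with clipping described above; $\bar z\in\mathcal Z$; its running time, whatever the random outcomes, is $$O\!\left(\frac{(L_{\mathsf{co}}^{1,1})^2\log^2(mn)}{\epsilon^2}+m+n\right)$$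 with an absolute constant; and $\mathbb E\,\mathrm{Gap}(\bar z)\le\epsilon$. -/

import Mathlib

open scoped BigOperators ENNReal Matrix

namespace MatrixGame

-- ===========================================================================
-- Part 1.  The `ℓ₁-ℓ₁` setup, the gap, and stochastic mirror descent
-- ===========================================================================

/-- A draw from a finite type with probabilities `w`.  (If `w` is not a probability vector, the
value is a fixed point mass; this case never occurs below.) -/
noncomputable def drawFrom {α : Type} [Fintype α] [Nonempty α] (w : α → ℝ) : PMF α :=
  open Classical in
  if h : ∑ a, ENNReal.ofReal (w a) = 1 then
    PMF.ofFintype (fun a => ENNReal.ofReal (w a)) h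
  else PMF.pure (Classical.arbitrary α)

/-- Points `z = (zˣ, zʸ)` of `ℝⁿ × ℝᵐ`. -/
abbrev Pt (m n : ℕ) : Type := (Fin n → ℝ) × (Fin m → ℝ)

section Setup

variable {m n : ℕ}

/-- The domain `Δⁿ × Δᵐ`. -/
def dom (m n : ℕ) : Set (Pt m n) := stdSimplex ℝ (Fin n) ×ˢ stdSimplex ℝ (Fin m)

/-- The objective `f(x, y) = yᵀ A x`. -/
def obj (A : Matrix (Fin m) (Fin n) ℝ) (x : Fin n → ℝ) (y : Fin m → ℝ) : ℝ := y ⬝ᵥ (A *ᵥ x)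

/-- The duality gap `max_{y'} f(zˣ, y') - min_{x'} f(x', zʸ)`. -/
noncomputable def gap (A : Matrix (Fin m) (Fin n) ℝ) (z : Pt m n) : ℝ :=
  (⨆ y' : stdSimplex ℝ (Fin m), obj A z.1 y') - ⨅ x' : stdSimplex ℝ (Fin n), obj A x' z.2

/-- The Euclidean norm of row `i`. -/
noncomputable def rowNorm (A : Matrix (Fin m) (Fin n) ℝ) (i : Fin m) : ℝ :=
  √(∑ j, A i j ^ 2)

/-- The Euclidean norm of column `j`. -/
noncomputable def colNorm (A : Matrix (Fin m) (Fin n) ℝ) (j : Fin n) : ℝ :=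
  √(∑ i, A i j ^ 2)

/-- `L_co^{1,1}`: the largest Euclidean norm of a row or a column. -/
noncomputable def Lco (A : Matrix (Fin m) (Fin n) ℝ) : ℝ :=
  max (⨆ i, rowNorm A i) (⨆ j, colNorm A j)

/-- The distance generating function: the negative entropy `∑ₖ zₖ log zₖ`. -/
noncomputable def negEntropy (z : Pt m n) : ℝ :=
  ∑ j, z.1 j * Real.log (z.1 j) + ∑ i, z.2 i * Real.log (z.2 i)

/-- The Bregman divergence `V_z(z') = r(z') - r(z) - ⟨∇r(z), z' - z⟩`. -/
noncomputable def bregman (z z' : Pt m n) : ℝ :=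
  negEntropy z' - negEntropy z - fderiv ℝ negEntropy z (z' - z)

/-- The pairing `⟨γ, z⟩`. -/
def pairing (γ z : Pt m n) : ℝ := γ.1 ⬝ᵥ z.1 + γ.2 ⬝ᵥ z.2

/-- Entrywise clipping `sign(δ) ∘ min{1, |δ|}`. -/
noncomputable def clip (δ : Pt m n) : Pt m n :=
  (fun j => Real.sign (δ.1 j) * min 1 |δ.1 j|, fun i => Real.sign (δ.2 i) * min 1 |δ.2 i|)

/-- A minimizer of `F` over the domain. -/
noncomputable def argminDom (F : Pt m n → ℝ) : Pt m n :=
  Classical.epsilon fun z => z ∈ dom m n ∧ ∀ u ∈ dom m n, F z ≤ F u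

/-- `p_ij(z) = [zʸ]_i A_ij² / ‖A_i:‖₂²`. -/
noncomputable def probX (A : Matrix (Fin m) (Fin n) ℝ) (z : Pt m n) (ij : Fin m × Fin n) : ℝ :=
  z.2 ij.1 * (A ij.1 ij.2 ^ 2 / rowNorm A ij.1 ^ 2)

/-- `q_ij(z) = [zˣ]_j A_ij² / ‖A_:j‖₂²`. -/
noncomputable def probY (A : Matrix (Fin m) (Fin n) ℝ) (z : Pt m n) (ij : Fin m × Fin n) : ℝ :=
  z.1 ij.2 * (A ij.1 ij.2 ^ 2 / colNorm A ij.2 ^ 2)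

/-- The coordinate gradient estimator
`( A_{iˣjˣ} [zʸ]_{iˣ} / p_{iˣjˣ}(z) e_{jˣ}, - A_{iʸjʸ} [zˣ]_{jʸ} / q_{iʸjʸ}(z) e_{iʸ} )`,
where `(iˣ, jˣ) ∼ p(z)` and `(iʸ, jʸ) ∼ q(z)`. -/
noncomputable def gradEst [NeZero m] [NeZero n] (A : Matrix (Fin m) (Fin n) ℝ) (z : Pt m n) :
    PMF (Pt m n) :=
  (drawFrom (probX A z)).bind fun ijx =>
    (drawFrom (probY A z)).bind fun ijy =>
      PMF.pure
        (Pi.single ijx.2 (A ijx.1 ijx.2 * z.2 ijx.1 / probX A z ijx),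
         Pi.single ijy.1 (-A ijy.1 ijy.2 * z.1 ijy.2 / probY A z ijy))

/-- Stochastic mirror descent with clipping and step size `η`: the joint law, after `t` steps, of
the iterate `z_t` and of the sum `z_0 + ⋯ + z_t`. -/
noncomputable def smd [NeZero m] [NeZero n] (A : Matrix (Fin m) (Fin n) ℝ) (η : ℝ) :
    ℕ → PMF (Pt m n × Pt m n)
  | 0 => PMF.pure (argminDom negEntropy, argminDom negEntropy)
  | t + 1 => (smd A η t).bind fun zs =>
      (gradEst A zs.1).bind fun g =>
        let z' := argminDom fun z => pairing (clip (η • g)) z + bregman zs.1 z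
        PMF.pure (z', zs.2 + z')

/-- The law of the output `(z_0 + ⋯ + z_T) / (T + 1)` of stochastic mirror descent. -/
noncomputable def smdOutput [NeZero m] [NeZero n] (A : Matrix (Fin m) (Fin n) ℝ) (η : ℝ) (T : ℕ) :
    PMF (Pt m n) :=
  (smd A η T).map fun zs => ((T : ℝ) + 1)⁻¹ • zs.2

end Setup

-- ===========================================================================
-- Part 2.  A randomized real RAM with matrix access and a step count
-- ===========================================================================

/-- The two blocks of variables. -/
inductive Blk where
  | x | y
  deriving DecidableEq

/-- Registers that hold natural numbers.  `dim .x = n` and `dim .y = m` are inputs. -/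
inductive NReg where
  | dim (b : Blk) | cap (b : Blk) | depth (b : Blk)
  | row (b : Blk) | col (b : Blk)
  | node | bit | k | l
  deriving DecidableEq

/-- Registers that hold real numbers.  `eps` is an input. -/
inductive RReg where
  | eps | lco | eta | count | arg | val | prob | w₁ | w₂
  | xi (b : Blk) | sigma (b : Blk) | nu (b : Blk) | step (b : Blk)
  deriving DecidableEq

/-- Arrays of real numbers. -/
inductive Arr where
  | u (b : Blk) | u' (b : Blk) | tree (b : Blk) | out (b : Blk)
  deriving DecidableEq

/-- Machine states; `steps` counts the elementary operations executed so far. -/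
structure State where
  nat : NReg → ℕ
  real : RReg → ℝ
  mem : Arr → ℕ → ℝ
  steps : ℕ

/-- Index arithmetic. -/
inductive NExpr where
  | lit (k : ℕ)
  | reg (v : NReg)
  | add (a b : NExpr)
  | sub (a b : NExpr)
  | half (a : NExpr)

/-- Real arithmetic, array reads, and the matrix queries `A_ij`, `‖A_i:‖₂`, `‖A_:j‖₂`. -/
inductive RExpr where
  | reg (v : RReg)
  | ofNat (a : NExpr)
  | read (t : Arr) (a : NExpr)
  | entry (i j : NExpr)
  | rowNorm (i : NExpr)
  | colNorm (j : NExpr)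
  | add (a b : RExpr)
  | sub (a b : RExpr)
  | mul (a b : RExpr)
  | div (a b : RExpr)
  | exp (a : RExpr)
  | log (a : RExpr)

/-- Comparisons. -/
inductive BExpr where
  | ltN (a b : NExpr)
  | ltR (a b : RExpr)

/-- Programs.  `forN v a c` runs `c` for `v = 0, 1, …, a - 1`; `forR a c` runs `c` once for each
value `t = 0, 1, 2, …` of a hidden real counter while `t < a`; in both cases the bound is
evaluated once, on entry.  `flip v a` sets `v` to `1` with probability `a`, else to `0`.
`drawCol v i` sets `v` to `j` with probability `A_ij² / ‖A_i:‖₂²`, and `drawRow v j` sets `v` to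
`i` with probability `A_ij² / ‖A_:j‖₂²`. -/
inductive Cmd where
  | skip
  | setN (v : NReg) (a : NExpr)
  | setR (v : RReg) (a : RExpr)
  | store (t : Arr) (a : NExpr) (c : RExpr)
  | flip (v : NReg) (a : RExpr)
  | drawCol (v : NReg) (i : NExpr)
  | drawRow (v : NReg) (j : NExpr)
  | seq (c d : Cmd)
  | ite (b : BExpr) (c d : Cmd)
  | forN (v : NReg) (a : NExpr) (c : Cmd)
  | forR (a : RExpr) (c : Cmd)

instance : Coe NReg NExpr := ⟨NExpr.reg⟩
instance (k : ℕ) : OfNat NExpr k := ⟨NExpr.lit k⟩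
instance : Add NExpr := ⟨NExpr.add⟩
instance : Sub NExpr := ⟨NExpr.sub⟩
instance : Coe RReg RExpr := ⟨RExpr.reg⟩
instance (k : ℕ) : OfNat RExpr k := ⟨RExpr.ofNat (NExpr.lit k)⟩
instance : Add RExpr := ⟨RExpr.add⟩
instance : Sub RExpr := ⟨RExpr.sub⟩
instance : Mul RExpr := ⟨RExpr.mul⟩
instance : Div RExpr := ⟨RExpr.div⟩

def NExpr.eval (s : State) : NExpr → ℕ
  | .lit k => k
  | .reg v => s.nat v
  | .add a b => a.eval s + b.eval s
  | .sub a b => a.eval s - b.eval s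
  | .half a => a.eval s / 2

/-- Every constant, register access and operation costs one step. -/
def NExpr.cost : NExpr → ℕ
  | .lit _ => 1
  | .reg _ => 1
  | .add a b => a.cost + b.cost + 1
  | .sub a b => a.cost + b.cost + 1
  | .half a => a.cost + 1

/-- Every constant, register or memory access, operation and matrix query costs one step. -/
def RExpr.cost : RExpr → ℕ
  | .reg _ => 1
  | .ofNat a => a.cost + 1
  | .read _ a => a.cost + 1
  | .entry i j => i.cost + j.cost + 1
  | .rowNorm i => i.cost + 1
  | .colNorm j => j.cost + 1
  | .add a b => a.cost + b.cost + 1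
  | .sub a b => a.cost + b.cost + 1
  | .mul a b => a.cost + b.cost + 1
  | .div a b => a.cost + b.cost + 1
  | .exp a => a.cost + 1
  | .log a => a.cost + 1

def BExpr.cost : BExpr → ℕ
  | .ltN a b => a.cost + b.cost + 1
  | .ltR a b => a.cost + b.cost + 1

/-- Consecutive execution of a list of programs. -/
def block : List Cmd → Cmd
  | [] => .skip
  | c :: cs => .seq c (block cs)

def State.tick (s : State) (k : ℕ) : State := { s with steps := s.steps + k }

def State.setN (s : State) (v : NReg) (k : ℕ) : State := { s with nat := Function.update s.nat v k }

def State.setR (s : State) (v : RReg) (a : ℝ) : State :=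
  { s with real := Function.update s.real v a }

def State.store (s : State) (t : Arr) (k : ℕ) (a : ℝ) : State :=
  { s with mem := Function.update s.mem t (Function.update (s.mem t) k a) }

/-- `body 0`, then `body 1`, …, then `body (k - 1)`. -/
noncomputable def iter (body : ℕ → State → PMF State) : ℕ → State → PMF State
  | 0, s => PMF.pure s
  | k + 1, s => (iter body k s).bind (body k)

section Semantics

variable {m n : ℕ} (A : Matrix (Fin m) (Fin n) ℝ)

/-- The value of a real expression; queries outside of the matrix return `0`. -/
noncomputable def RExpr.eval (s : State) : RExpr → ℝ
  | .reg v => s.real v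
  | .ofNat a => (a.eval s : ℝ)
  | .read t a => s.mem t (a.eval s)
  | .entry i j => if h : i.eval s < m ∧ j.eval s < n then A ⟨i.eval s, h.1⟩ ⟨j.eval s, h.2⟩ else 0
  | .rowNorm i => if h : i.eval s < m then MatrixGame.rowNorm A ⟨i.eval s, h⟩ else 0
  | .colNorm j => if h : j.eval s < n then MatrixGame.colNorm A ⟨j.eval s, h⟩ else 0
  | .add a b => a.eval s + b.eval s
  | .sub a b => a.eval s - b.eval s
  | .mul a b => a.eval s * b.eval s
  | .div a b => a.eval s / b.eval s
  | .exp a => Real.exp (a.eval s)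
  | .log a => Real.log (a.eval s)

def BExpr.holds (s : State) : BExpr → Prop
  | .ltN a b => a.eval s < b.eval s
  | .ltR a b => a.eval A s < b.eval A s

/-- The law of the final state of a program.  Each command costs one step more than the
expressions in it, and each pass through a loop costs two steps more than its body, for the
comparison and the increment of the counter (with one more comparison at the end). -/
noncomputable def Cmd.run [NeZero m] [NeZero n] : Cmd → State → PMF State
  | .skip, s => PMF.pure s
  | .setN v a, s => PMF.pure ((s.setN v (a.eval s)).tick (a.cost + 1))
  | .setR v a, s => PMF.pure ((s.setR v (a.eval A s)).tick (a.cost + 1))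
  | .store t a c, s => PMF.pure ((s.store t (a.eval s) (c.eval A s)).tick (a.cost + c.cost + 1))
  | .flip v a, s =>
      (drawFrom fun b : Bool => if b then a.eval A s else 1 - a.eval A s).map fun b =>
        (s.setN v (if b then 1 else 0)).tick (a.cost + 1)
  | .drawCol v i, s =>
      if h : i.eval s < m then
        (drawFrom fun j : Fin n =>
          A ⟨i.eval s, h⟩ j ^ 2 / MatrixGame.rowNorm A ⟨i.eval s, h⟩ ^ 2).map fun j =>
            (s.setN v j).tick (i.cost + 1)
      else PMF.pure (s.tick (i.cost + 1))
  | .drawRow v j, s =>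
      if h : j.eval s < n then
        (drawFrom fun i : Fin m =>
          A i ⟨j.eval s, h⟩ ^ 2 / MatrixGame.colNorm A ⟨j.eval s, h⟩ ^ 2).map fun i =>
            (s.setN v i).tick (j.cost + 1)
      else PMF.pure (s.tick (j.cost + 1))
  | .seq c d, s => (c.run s).bind d.run
  | .ite b c d, s =>
      open Classical in
      if b.holds A s then c.run (s.tick (b.cost + 1)) else d.run (s.tick (b.cost + 1))
  | .forN v a c, s =>
      iter (fun k s' => c.run ((s'.setN v k).tick 2)) (a.eval s) (s.tick (a.cost + 2))
  | .forR a c, s =>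
      iter (fun _ s' => c.run (s'.tick 2)) ⌈a.eval A s⌉₊ (s.tick (a.cost + 2))

end Semantics

-- ===========================================================================
-- Part 3.  The data structure `IterateMaintainer₁`
-- ===========================================================================

-- The instance for block `b` represents an iterate `x` and a running sum `s` of iterates by
-- `x = ξ u` and `s = u' + σ u`, stores `ν = ‖x‖₁`, and holds a complete binary tree in heap order
-- (root `1`, children `2k` and `2k + 1` of node `k`, leaf `cap + j` for coordinate `j`) in which
-- each node stores the sum of the entries `u_j` over the leaves below it.

namespace IM

open NReg RReg Arr Cmd BExpr

/-- `Init(x₀)` for the constant vector `x₀` with entries `c`. -/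
def init (b : Blk) (c : RExpr) : Cmd := block [
  setN (cap b) 1,
  setN (depth b) 0,
  forN k (dim b) (ite (ltN (cap b) (dim b))
    (block [setN (cap b) (cap b + cap b), setN (depth b) (depth b + 1)])
    skip),
  setR (xi b) 1,
  setR (sigma b) 0,
  setR (nu b) 0,
  forN k (dim b) (block [
    store (u b) k c,
    store (u' b) k 0,
    setR (nu b) (nu b + .read (u b) k)]),
  forN k (cap b) (store (tree b) (cap b + k) 0),
  forN k (dim b) (store (tree b) (cap b + k) (.read (u b) k)),
  forN k (cap b - 1) (block [
    setN node (cap b - 1 - k),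
    store (tree b) node (.read (tree b) (node + node) + .read (tree b) (node + node + 1))])]

/-- `Scale(c)`: `x ← c x`. -/
def scale (b : Blk) (c : RExpr) : Cmd := block [
  setR arg c,
  setR (xi b) (xi b * arg),
  setR (nu b) (nu b * arg)]

/-- `AddSparse(j, c)`: `x_j ← x_j + c`. -/
def addSparse (b : Blk) (j : NReg) (c : RExpr) : Cmd := block [
  setR arg c,
  store (u b) j (.read (u b) j + arg / xi b),
  store (u' b) j (.read (u' b) j - arg * sigma b / xi b),
  setR (nu b) (nu b + arg),
  setN node (cap b + j),
  store (tree b) node (.read (u b) j),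
  forN l (depth b) (block [
    setN node (.half node),
    store (tree b) node (.read (tree b) (node + node) + .read (tree b) (node + node + 1))])]

/-- `UpdateSum()`: `s ← s + x`. -/
def updateSum (b : Blk) : Cmd := setR (sigma b) (sigma b + xi b)

/-- `Get(j)`: the entry `x_j`. -/
def get (b : Blk) (j : NReg) : RExpr := xi b * .read (u b) j

/-- `GetSum(j)`: the entry `s_j`. -/
def getSum (b : Blk) (j : NReg) : RExpr := .read (u' b) j + sigma b * .read (u b) j

/-- `GetNorm()`: the norm `‖x‖₁`. -/
def getNorm (b : Blk) : RExpr := nu b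

/-- `Sample()`: sets `v` to `j` with probability `x_j / ‖x‖₁`, walking down from the root. -/
def sample (b : Blk) (v : NReg) : Cmd := block [
  setN node 1,
  forN l (depth b) (block [
    setR w₁ (xi b * .read (tree b) (node + node)),
    setR w₂ (xi b * .read (tree b) (node + node + 1)),
    flip bit (w₂ / (w₁ + w₂)),
    setN node (node + node + bit)]),
  setN v (node - cap b)]

end IM

-- ===========================================================================
-- Part 4.  The implementation of stochastic mirror descent
-- ===========================================================================

section Program

open NReg RReg Arr Cmd BExpr

/-- Computes `L_co^{1,1}` and `η = ε / (18 (L_co^{1,1})²)`. -/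
def setParams : Cmd := block [
  setR lco 0,
  forN k (dim .y) (ite (ltR lco (.rowNorm k)) (setR lco (.rowNorm k)) skip),
  forN k (dim .x) (ite (ltR lco (.colNorm k)) (setR lco (.colNorm k)) skip),
  setR eta (eps / (18 * (lco * lco)))]

/-- Clips the register `v` to `[-1, 1]`. -/
def clipReg (v : RReg) : Cmd := block [
  ite (ltR 1 v) (setR v 1) skip,
  ite (ltR v (0 - 1)) (setR v (0 - 1)) skip]

/-- Draws `(iˣ, jˣ) ∼ p(z)` and computes the nonzero entry, at `jˣ`, of `clip(η g̃(z))ˣ`. -/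
def gradX : Cmd := block [
  IM.sample .y (row .x),
  drawCol (col .x) (row .x),
  setR prob (IM.get .y (row .x) *
    ((.entry (row .x) (col .x) * .entry (row .x) (col .x)) /
      (.rowNorm (row .x) * .rowNorm (row .x)))),
  setR (step .x) (eta * (.entry (row .x) (col .x) * IM.get .y (row .x) / prob)),
  clipReg (step .x)]

/-- Draws `(iʸ, jʸ) ∼ q(z)` and computes the nonzero entry, at `iʸ`, of `clip(η g̃(z))ʸ`. -/
def gradY : Cmd := block [
  IM.sample .x (col .y),
  drawRow (row .y) (col .y),
  setR prob (IM.get .x (col .y) *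
    ((.entry (row .y) (col .y) * .entry (row .y) (col .y)) /
      (.colNorm (col .y) * .colNorm (col .y)))),
  setR (step .y) (eta * ((0 - .entry (row .y) (col .y)) * IM.get .x (col .y) / prob)),
  clipReg (step .y)]

/-- Multiplies coordinate `j` of block `b` by `exp(-c)`, `c` the content of `step b`, divides the
block by its `ℓ₁` norm, and adds it to the running sum. -/
def mirrorStep (b : Blk) (j : NReg) : Cmd := block [
  setR val (IM.get b j),
  IM.addSparse b j ((.exp (0 - step b) - 1) * val),
  IM.scale b (1 / IM.getNorm b),
  IM.updateSum b]

/-- The whole implementation.  The number of passes through the main loop is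
`T = ⌈6 log(mn) / (η ε)⌉`; the register `count` holds the number of summed iterates. -/
def program : Cmd := block [
  setParams,
  IM.init .x (1 / .ofNat (dim .x)),
  IM.init .y (1 / .ofNat (dim .y)),
  IM.updateSum .x,
  IM.updateSum .y,
  setR count 1,
  forR (6 * .log (.ofNat (dim .y) * .ofNat (dim .x)) / (eta * eps)) (block [
    gradX,
    gradY,
    mirrorStep .x (col .x),
    mirrorStep .y (row .y),
    setR count (count + 1)]),
  forN k (dim .x) (store (out .x) k (IM.getSum .x k / count)),
  forN k (dim .y) (store (out .y) k (IM.getSum .y k / count))]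

end Program

section Execution

variable {m n : ℕ}

/-- The initial state: the registers `dim` and `eps` hold the input, all else is `0`. -/
noncomputable def start (m n : ℕ) (ε : ℝ) : State where
  nat
    | .dim .x => n
    | .dim .y => m
    | _ => 0
  real
    | .eps => ε
    | _ => 0
  mem _ _ := 0
  steps := 0

/-- The law of the final state of the implementation. -/
noncomputable def execute [NeZero m] [NeZero n] (A : Matrix (Fin m) (Fin n) ℝ) (ε : ℝ) :
    PMF State :=
  program.run A (start m n ε)

/-- The output `z̄` in a final state. -/
def output (m n : ℕ) (s : State) : Pt m n :=
  (fun j => s.mem (.out .x) j, fun i => s.mem (.out .y) i)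

end Execution

end MatrixGame

/-! Two arguments meet at the law `smdOutput`.

The implementation. For the entropy, the objective of a mirror step equals, on the domain, the
relative entropy to an explicit interior point plus a constant. By the strict Gibbs inequality that
point is the only minimizer (`argminDom_eq`, `argminDom_step`): it is the multiplicative update
`reweight`, and for a loss in one coordinate per block this is one sparse addition, one scaling and
one repaired path of the tree. The program is compared with `smd` through couplings: `Coupled` asks
for a joint law supported on a relation, here `LoopInv`, which says that the machine represents the
iterate and the running sum and has used a bounded number of steps. Couplings compose along
sequencing and loops (`Coupled.bind`, `iter_coupled`), so `execute_spec` yields the equality of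
laws, feasibility and the sure step bound together; `steps_le` converts the count.

The gap. The maximum over comparators stands inside the expectation, so regret bounds against fixed
comparators do not suffice. Instead a potential is followed that dominates all comparators at once:
for each block it is `log ∑ⱼ exp(-gⱼ) / xⱼ`, with `x` the current iterate and `g` equal to `η` times
the sum of the exact gradients at the earlier iterates. As `xⱼ ≤ 1`, it is at least `-⟨u, g⟩` for
every `u` in the simplex, and hence `η` times the gap of the averaged iterates times their number is
at most the potential (`mul_gap_le_pot`). When `x` is reweighted by the clipped estimate `δ` and `g`
grows by the exact `a`, the increment is at most `∑ₖ xₖ (exp(-δₖ) - 1) + wₖ (exp(-(aₖ - δₖ)) - 1)`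
with Gibbs weights `w` (`blockPot_reweight_le`). Since the estimator is unbiased and clipping errs
by at most a quarter of the square, the first-order terms in `w` cancel in expectation and those in
`x` give `-η ⟨x, h⟩`, with `h` the exact gradient. Over both blocks the latter vanish, because the
game is zero-sum. What remains is `11 η² L²` per step, by the second moment bound `L²`. The
potential starts at `2 log(mn)`, and the choice of `η` and `T` gives an expected gap of at most `ε`.
-/

namespace MatrixGame

/-! ### Expectations, finite draws, couplings and point masses. -/

section Pmf

variable {α β γ δ : Type}

/-- The expectation of a nonnegative function. -/
noncomputable def expect (p : PMF α) (f : α → ℝ≥0∞) : ℝ≥0∞ := ∑' a, p a * f a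

theorem expect_pure (a : α) (f : α → ℝ≥0∞) : expect (PMF.pure a) f = f a := by
  classical
  unfold expect
  rw [tsum_eq_single a]
  · simp
  · intro b hb
    simp [PMF.pure_apply, hb]

theorem expect_bind (p : PMF α) (q : α → PMF β) (f : β → ℝ≥0∞) :
    expect (p.bind q) f = expect p fun a => expect (q a) f := by
  unfold expect
  simp_rw [PMF.bind_apply, ← ENNReal.tsum_mul_right, ← ENNReal.tsum_mul_left]
  rw [ENNReal.tsum_comm]
  simp_rw [mul_assoc]

theorem expect_map (p : PMF α) (g : α → β) (f : β → ℝ≥0∞) :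
    expect (p.map g) f = expect p fun a => f (g a) := by
  rw [← PMF.bind_pure_comp, expect_bind]
  simp [expect_pure]

theorem expect_mono {p : PMF α} {f g : α → ℝ≥0∞} (h : ∀ a ∈ p.support, f a ≤ g a) :
    expect p f ≤ expect p g := by
  refine ENNReal.tsum_le_tsum fun a => ?_
  by_cases ha : p a = 0
  · simp [ha]
  · exact mul_le_mul_right (h a ((PMF.mem_support_iff _ _).2 ha)) _

theorem expect_const (p : PMF α) (c : ℝ≥0∞) : expect p (fun _ => c) = c := by
  simp [expect, ENNReal.tsum_mul_right, p.tsum_coe]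

theorem expect_add (p : PMF α) (f g : α → ℝ≥0∞) :
    expect p (fun a => f a + g a) = expect p f + expect p g := by
  simp [expect, mul_add, ENNReal.tsum_add]

theorem expect_const_mul (p : PMF α) (c : ℝ≥0∞) (f : α → ℝ≥0∞) :
    expect p (fun a => c * f a) = c * expect p f := by
  simp only [expect, ← ENNReal.tsum_mul_left]
  exact tsum_congr fun a => by ring

theorem bind_congr_support {p : PMF α} {f g : α → PMF β} (h : ∀ a ∈ p.support, f a = g a) :
    p.bind f = p.bind g := by
  ext b
  simp only [PMF.bind_apply]
  refine tsum_congr fun a => ?_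
  by_cases ha : p a = 0
  · simp [ha]
  · rw [h a ((PMF.mem_support_iff _ _).2 ha)]

theorem map_congr_support {p : PMF α} {f g : α → β} (h : ∀ a ∈ p.support, f a = g a) :
    p.map f = p.map g :=
  bind_congr_support fun a ha => by simp [h a ha]

section Draw

variable [Fintype α] [Nonempty α] {w : α → ℝ}

theorem drawFrom_apply (h0 : ∀ a, 0 ≤ w a) (h1 : ∑ a, w a = 1) (a : α) :
    drawFrom w a = ENNReal.ofReal (w a) := by
  have h : ∑ a, ENNReal.ofReal (w a) = 1 := by
    rw [← ENNReal.ofReal_sum_of_nonneg fun a _ => h0 a, h1, ENNReal.ofReal_one]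
  unfold drawFrom
  rw [dif_pos h, PMF.ofFintype_apply]

theorem expect_drawFrom (h0 : ∀ a, 0 ≤ w a) (h1 : ∑ a, w a = 1) (f : α → ℝ≥0∞) :
    expect (drawFrom w) f = ∑ a, ENNReal.ofReal (w a) * f a := by
  simp [expect, tsum_fintype, drawFrom_apply h0 h1]

theorem expect_drawFrom_ofReal (h0 : ∀ a, 0 ≤ w a) (h1 : ∑ a, w a = 1) {f : α → ℝ}
    (hf : ∀ a, 0 < w a → 0 ≤ f a) :
    expect (drawFrom w) (fun a => ENNReal.ofReal (f a)) = ENNReal.ofReal (∑ a, w a * f a) := by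
  rw [expect_drawFrom h0 h1, ENNReal.ofReal_sum_of_nonneg]
  · exact Finset.sum_congr rfl fun a _ => (ENNReal.ofReal_mul (h0 a)).symm
  · intro a _
    rcases (h0 a).eq_or_lt with h | h
    · simp [← h]
    · exact mul_nonneg h.le (hf a h)

/-- A draw from a product, coordinate by coordinate. -/
theorem drawFrom_eq_bind [Fintype β] [Nonempty β] {v : α → β → ℝ} [Fintype γ] [Nonempty γ]
    (h0 : ∀ a, 0 ≤ w a) (h1 : ∑ a, w a = 1) (g0 : ∀ a b, 0 ≤ v a b) (g1 : ∀ a, ∑ b, v a b = 1)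
    (e : γ ≃ α × β) :
    (drawFrom fun c => w (e c).1 * v (e c).1 (e c).2) =
      (drawFrom w).bind fun a => (drawFrom (v a)).map fun b => e.symm (a, b) := by
  classical
  have hsum : ∑ c, w (e c).1 * v (e c).1 (e c).2 = 1 := by
    rw [e.sum_comp fun p : α × β => w p.1 * v p.1 p.2]
    simp [Fintype.sum_prod_type, ← Finset.mul_sum, g1, h1]
  ext c
  obtain ⟨⟨a, b⟩, rfl⟩ := e.symm.surjective c
  rw [drawFrom_apply (fun p => mul_nonneg (h0 _) (g0 _ _)) hsum, PMF.bind_apply, tsum_eq_single a]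
  · rw [PMF.map_apply, tsum_eq_single b]
    · simp [drawFrom_apply h0 h1, drawFrom_apply (g0 a) (g1 a), ENNReal.ofReal_mul (h0 a)]
    · intro b' hb'
      simp [Ne.symm hb']
  · intro a' ha'
    simp [PMF.map_apply, Ne.symm ha']

end Draw

/-- The laws `μ` and `ν` have a coupling that is supported on the relation `R`. -/
def Coupled (μ : PMF α) (ν : PMF β) (R : α → β → Prop) : Prop :=
  ∃ κ : PMF (α × β), κ.map Prod.fst = μ ∧ κ.map Prod.snd = ν ∧ ∀ p ∈ κ.support, R p.1 p.2

namespace Coupled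

variable {μ : PMF α} {ν : PMF β} {R : α → β → Prop}

theorem pure {a : α} {b : β} (h : R a b) : Coupled (PMF.pure a) (PMF.pure b) R :=
  ⟨PMF.pure (a, b), PMF.pure_map _ _, PMF.pure_map _ _, by
    intro p hp
    rw [PMF.support_pure, Set.mem_singleton_iff] at hp
    rwa [hp]⟩

/-- Couplings of the continuations, one for each related pair, are mixed over the coupling of the
first stage. This is the sequencing rule for running two random processes in lockstep. -/
theorem bind {f : α → PMF γ} {g : β → PMF δ} {Q : γ → δ → Prop} (h : Coupled μ ν R)
    (hf : ∀ a ∈ μ.support, ∀ b, R a b → Coupled (f a) (g b) Q) :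
    Coupled (μ.bind f) (ν.bind g) Q := by
  obtain ⟨κ, rfl, rfl, h3⟩ := h
  have key : ∀ p : α × β, ∃ κ' : PMF (γ × δ), p ∈ κ.support →
      κ'.map Prod.fst = f p.1 ∧ κ'.map Prod.snd = g p.2 ∧ ∀ q ∈ κ'.support, Q q.1 q.2 := by
    intro p
    by_cases hp : p ∈ κ.support
    · obtain ⟨κ', h⟩ := hf p.1 (by rw [PMF.support_map]; exact ⟨p, hp, rfl⟩) p.2 (h3 p hp)
      exact ⟨κ', fun _ => h⟩
    -- Off the support of `κ` nothing is required; the product law serves as a default.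
    · exact ⟨(f p.1).bind fun c => (g p.2).map fun d => (c, d), fun h => absurd h hp⟩
  choose κ' hκ' using key
  refine ⟨κ.bind κ', ?_, ?_, ?_⟩
  · rw [PMF.map_bind, PMF.bind_map]
    exact bind_congr_support fun p hp => (hκ' p hp).1
  · rw [PMF.map_bind, PMF.bind_map]
    exact bind_congr_support fun p hp => (hκ' p hp).2.1
  · intro q hq
    obtain ⟨p, hp, hq⟩ := (PMF.mem_support_bind_iff _ _ _).1 hq
    exact (hκ' p hp).2.2 q hq

theorem map_right {g : β → γ} {Q : α → γ → Prop} (h : Coupled μ ν R)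
    (hg : ∀ a ∈ μ.support, ∀ b, R a b → Q a (g b)) : Coupled μ (ν.map g) Q := by
  have := h.bind (f := PMF.pure) (g := PMF.pure ∘ g) (Q := Q)
    fun a ha b hab => Coupled.pure (hg a ha b hab)
  rwa [PMF.bind_pure] at this

theorem map_left {f : α → γ} {Q : γ → β → Prop} (h : Coupled μ ν R)
    (hf : ∀ a ∈ μ.support, ∀ b, R a b → Q (f a) b) : Coupled (μ.map f) ν Q := by
  have := h.bind (f := PMF.pure ∘ f) (g := PMF.pure) (Q := Q)
    fun a ha b hab => Coupled.pure (hf a ha b hab)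
  rwa [PMF.bind_pure ν] at this

theorem refl (μ : PMF α) : Coupled μ μ fun a b => a = b := by
  refine ⟨μ.map fun a => (a, a), ?_, ?_, ?_⟩
  · rw [PMF.map_comp]
    exact PMF.map_id _
  · rw [PMF.map_comp]
    exact PMF.map_id _
  · intro p hp
    rw [PMF.support_map] at hp
    obtain ⟨a, _, rfl⟩ := hp
    rfl

/-- An injective image carries the same information, so the coupling can be pulled back along a left
inverse. It recovers a coordinate from the leaf at which a tree walk ends. -/
theorem of_map_left [Nonempty γ] {f : γ → α} {μ : PMF γ} (hf : Function.Injective f)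
    (h : Coupled (μ.map f) ν R) : Coupled μ ν fun c b => R (f c) b := by
  have := h.map_left (f := Function.invFun f) (Q := fun c b => R (f c) b) (by
    intro a ha b hab
    rw [PMF.support_map] at ha
    obtain ⟨c, _, rfl⟩ := ha
    rwa [Function.leftInverse_invFun hf c])
  rwa [PMF.map_comp, (Function.leftInverse_invFun hf).comp_eq_id, PMF.map_id] at this

theorem map_eq {f : α → γ} {g : β → γ} (h : Coupled μ ν R) (hR : ∀ a b, R a b → f a = g b) :
    μ.map f = ν.map g := by
  obtain ⟨κ, rfl, rfl, h3⟩ := h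
  rw [PMF.map_comp, PMF.map_comp]
  exact map_congr_support fun p hp => hR _ _ (h3 p hp)

theorem exists_left (h : Coupled μ ν R) {b : β} (hb : b ∈ ν.support) : ∃ a ∈ μ.support, R a b := by
  obtain ⟨κ, rfl, rfl, h3⟩ := h
  rw [PMF.support_map] at hb
  obtain ⟨p, hp, rfl⟩ := hb
  exact ⟨p.1, by rw [PMF.support_map]; exact ⟨p, hp, rfl⟩, h3 p hp⟩

end Coupled

/-- The law `p` is a point mass at a point with the property `Q`. -/
def Det (p : PMF α) (Q : α → Prop) : Prop := ∃ a, p = PMF.pure a ∧ Q a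

namespace Det

theorem pure {a : α} {Q : α → Prop} (h : Q a) : Det (PMF.pure a) Q := ⟨a, rfl, h⟩

theorem mono {p : PMF α} {Q Q' : α → Prop} (h : Det p Q) (hQ : ∀ a, Q a → Q' a) : Det p Q' := by
  obtain ⟨a, ha, h⟩ := h
  exact ⟨a, ha, hQ a h⟩

theorem bind {p : PMF α} {f : α → PMF β} {Q : α → Prop} {Q' : β → Prop} (h : Det p Q)
    (hf : ∀ a, Q a → Det (f a) Q') : Det (p.bind f) Q' := by
  obtain ⟨a, rfl, h⟩ := h
  rw [PMF.pure_bind]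
  exact hf a h

theorem coupled_bind {p : PMF α} {f : α → PMF β} {Q : α → Prop} {μ : PMF γ} {R : γ → β → Prop}
    (h : Det p Q) (hf : ∀ a, Q a → Coupled μ (f a) R) : Coupled μ (p.bind f) R := by
  obtain ⟨a, rfl, h⟩ := h
  rw [PMF.pure_bind]
  exact hf a h

theorem coupled {p : PMF α} {Q : α → Prop} (h : Det p Q) {R : γ → α → Prop} {c : γ}
    (hR : ∀ a, Q a → R c a) : Coupled (PMF.pure c) p R := by
  obtain ⟨a, rfl, h⟩ := h
  exact Coupled.pure (hR a h)

end Det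

theorem Coupled.bind_det {μ : PMF α} {ν : PMF β} {R : α → β → Prop} {g : β → PMF γ}
    {Q : α → γ → Prop} (h : Coupled μ ν R) (hg : ∀ a ∈ μ.support, ∀ b, R a b → Det (g b) (Q a)) :
    Coupled μ (ν.bind g) Q := by
  have := h.bind (f := PMF.pure) (g := g) (Q := Q)
    fun a ha b hab => (hg a ha b hab).coupled fun c hc => hc
  rwa [PMF.bind_pure] at this

end Pmf

/-! ### Loop rules, evaluation and cost of commands, frame conditions. -/

theorem iter_det {body : ℕ → State → PMF State} {s : State} (I : ℕ → State → Prop) (h0 : I 0 s)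
    (K : ℕ) (hs : ∀ k < K, ∀ s, I k s → Det (body k s) (I (k + 1))) : Det (iter body K s) (I K) := by
  induction K with
  | zero => exact Det.pure h0
  | succ K ih =>
    exact (ih fun k hk => hs k (Nat.lt_succ_of_lt hk)).bind (hs K K.lt_succ_self)

/-- The relational loop rule: a Markov chain with kernel `f` and a machine loop stay coupled if each
pass preserves the invariant. -/
theorem iter_coupled {β : Type} {body : ℕ → State → PMF State} {s : State} {μ : ℕ → PMF β}
    {f : β → PMF β} (hμ : ∀ k, μ (k + 1) = (μ k).bind f) (I : ℕ → β → State → Prop)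
    (h0 : Coupled (μ 0) (PMF.pure s) (I 0)) (K : ℕ)
    (hs : ∀ k < K, ∀ b s, I k b s → Coupled (f b) (body k s) (I (k + 1))) :
    Coupled (μ K) (iter body K s) (I K) := by
  induction K with
  | zero => exact h0
  | succ K ih =>
    rw [hμ]
    exact (ih fun k hk => hs k (Nat.lt_succ_of_lt hk)).bind
      fun b _ s hbs => hs K K.lt_succ_self b s hbs

section Projections

variable (s : State) (v : NReg) (w : RReg) (t : Arr) (k i : ℕ) (a : ℝ)

@[simp] theorem State.nat_tick : (s.tick k).nat = s.nat := rfl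
@[simp] theorem State.real_tick : (s.tick k).real = s.real := rfl
@[simp] theorem State.mem_tick : (s.tick k).mem = s.mem := rfl
@[simp] theorem State.steps_tick : (s.tick k).steps = s.steps + k := rfl
@[simp] theorem State.nat_setN : (s.setN v k).nat = Function.update s.nat v k := rfl
@[simp] theorem State.real_setN : (s.setN v k).real = s.real := rfl
@[simp] theorem State.mem_setN : (s.setN v k).mem = s.mem := rfl
@[simp] theorem State.steps_setN : (s.setN v k).steps = s.steps := rfl
@[simp] theorem State.nat_setR : (s.setR w a).nat = s.nat := rfl
@[simp] theorem State.real_setR : (s.setR w a).real = Function.update s.real w a := rfl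
@[simp] theorem State.mem_setR : (s.setR w a).mem = s.mem := rfl
@[simp] theorem State.steps_setR : (s.setR w a).steps = s.steps := rfl
@[simp] theorem State.nat_store : (s.store t k a).nat = s.nat := rfl
@[simp] theorem State.real_store : (s.store t k a).real = s.real := rfl
@[simp] theorem State.mem_store : (s.store t k a).mem =
    Function.update s.mem t (Function.update (s.mem t) k a) := rfl
@[simp] theorem State.steps_store : (s.store t k a).steps = s.steps := rfl

end Projections

section Expressions

variable (s : State) (a b : NExpr) (v : NReg) (k : ℕ)

@[simp] theorem NExpr.eval_ofNat : NExpr.eval s (no_index (OfNat.ofNat k : NExpr)) = k := rfl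
@[simp] theorem NExpr.eval_reg : NExpr.eval s (.reg v) = s.nat v := rfl
@[simp] theorem NExpr.eval_add : NExpr.eval s (a + b) = a.eval s + b.eval s := rfl
@[simp] theorem NExpr.eval_sub : NExpr.eval s (a - b) = a.eval s - b.eval s := rfl
@[simp] theorem NExpr.eval_half : NExpr.eval s (.half a) = a.eval s / 2 := rfl
@[simp] theorem NExpr.cost_ofNat : NExpr.cost (no_index (OfNat.ofNat k : NExpr)) = 1 := rfl
@[simp] theorem NExpr.cost_reg : NExpr.cost (.reg v) = 1 := rfl
@[simp] theorem NExpr.cost_add : NExpr.cost (a + b) = a.cost + b.cost + 1 := rfl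
@[simp] theorem NExpr.cost_sub : NExpr.cost (a - b) = a.cost + b.cost + 1 := rfl
@[simp] theorem NExpr.cost_half : NExpr.cost (.half a) = a.cost + 1 := rfl

variable {m n : ℕ} (A : Matrix (Fin m) (Fin n) ℝ) (c d : RExpr) (w : RReg) (t : Arr)

@[simp] theorem RExpr.eval_lit : RExpr.eval A s (no_index (OfNat.ofNat k : RExpr)) = k := rfl
@[simp] theorem RExpr.eval_reg : RExpr.eval A s (.reg w) = s.real w := rfl
@[simp] theorem RExpr.eval_ofNat : RExpr.eval A s (.ofNat a) = (a.eval s : ℝ) := rfl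
@[simp] theorem RExpr.eval_read : RExpr.eval A s (.read t a) = s.mem t (a.eval s) := rfl
@[simp] theorem RExpr.eval_add : RExpr.eval A s (c + d) = c.eval A s + d.eval A s := rfl
@[simp] theorem RExpr.eval_sub : RExpr.eval A s (c - d) = c.eval A s - d.eval A s := rfl
@[simp] theorem RExpr.eval_mul : RExpr.eval A s (c * d) = c.eval A s * d.eval A s := rfl
@[simp] theorem RExpr.eval_div : RExpr.eval A s (c / d) = c.eval A s / d.eval A s := rfl
@[simp] theorem RExpr.eval_exp : RExpr.eval A s (.exp c) = Real.exp (c.eval A s) := rfl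
@[simp] theorem RExpr.eval_log : RExpr.eval A s (.log c) = Real.log (c.eval A s) := rfl
@[simp] theorem RExpr.cost_lit : RExpr.cost (no_index (OfNat.ofNat k : RExpr)) = 2 := rfl
@[simp] theorem RExpr.cost_reg : RExpr.cost (.reg w) = 1 := rfl
@[simp] theorem RExpr.cost_ofNat : RExpr.cost (.ofNat a) = a.cost + 1 := rfl
@[simp] theorem RExpr.cost_read : RExpr.cost (.read t a) = a.cost + 1 := rfl
@[simp] theorem RExpr.cost_entry : RExpr.cost (.entry a b) = a.cost + b.cost + 1 := rfl
@[simp] theorem RExpr.cost_rowNorm : RExpr.cost (.rowNorm a) = a.cost + 1 := rfl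
@[simp] theorem RExpr.cost_colNorm : RExpr.cost (.colNorm a) = a.cost + 1 := rfl
@[simp] theorem RExpr.cost_add : RExpr.cost (c + d) = c.cost + d.cost + 1 := rfl
@[simp] theorem RExpr.cost_sub : RExpr.cost (c - d) = c.cost + d.cost + 1 := rfl
@[simp] theorem RExpr.cost_mul : RExpr.cost (c * d) = c.cost + d.cost + 1 := rfl
@[simp] theorem RExpr.cost_div : RExpr.cost (c / d) = c.cost + d.cost + 1 := rfl
@[simp] theorem RExpr.cost_exp : RExpr.cost (.exp c) = c.cost + 1 := rfl
@[simp] theorem RExpr.cost_log : RExpr.cost (.log c) = c.cost + 1 := rfl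

@[simp] theorem BExpr.holds_ltN : BExpr.holds A s (.ltN a b) ↔ a.eval s < b.eval s := Iff.rfl
@[simp] theorem BExpr.holds_ltR :
    BExpr.holds A s (.ltR c d) ↔ c.eval A s < d.eval A s := Iff.rfl
@[simp] theorem BExpr.cost_ltN : BExpr.cost (.ltN a b) = a.cost + b.cost + 1 := rfl
@[simp] theorem BExpr.cost_ltR : BExpr.cost (.ltR c d) = c.cost + d.cost + 1 := rfl

theorem RExpr.eval_rowNorm (i : Fin m) (h : a.eval s = i) :
    RExpr.eval A s (.rowNorm a) = MatrixGame.rowNorm A i := by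
  simp [RExpr.eval, h]

theorem RExpr.eval_colNorm (j : Fin n) (h : a.eval s = j) :
    RExpr.eval A s (.colNorm a) = MatrixGame.colNorm A j := by
  simp [RExpr.eval, h]

theorem RExpr.eval_entry (i : Fin m) (j : Fin n) (h : a.eval s = i) (h' : b.eval s = j) :
    RExpr.eval A s (.entry a b) = A i j := by
  simp [RExpr.eval, h, h']

end Expressions

section Commands

variable {m n : ℕ} [NeZero m] [NeZero n] (A : Matrix (Fin m) (Fin n) ℝ) (s : State)

@[simp] theorem run_nil : (block []).run A s = PMF.pure s := rfl

@[simp] theorem run_cons (c : Cmd) (cs : List Cmd) :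
    (block (c :: cs)).run A s = (c.run A s).bind ((block cs).run A) := rfl

@[simp] theorem run_skip : Cmd.skip.run A s = PMF.pure s := rfl

@[simp] theorem run_setN (v : NReg) (a : NExpr) :
    (Cmd.setN v a).run A s = PMF.pure ((s.setN v (a.eval s)).tick (a.cost + 1)) := rfl

@[simp] theorem run_setR (v : RReg) (a : RExpr) :
    (Cmd.setR v a).run A s = PMF.pure ((s.setR v (a.eval A s)).tick (a.cost + 1)) := rfl

@[simp] theorem run_store (t : Arr) (a : NExpr) (c : RExpr) : (Cmd.store t a c).run A s =
    PMF.pure ((s.store t (a.eval s) (c.eval A s)).tick (a.cost + c.cost + 1)) := rfl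

theorem run_forN (v : NReg) (a : NExpr) (c : Cmd) : (Cmd.forN v a c).run A s =
    iter (fun k s' => c.run A ((s'.setN v k).tick 2)) (a.eval s) (s.tick (a.cost + 2)) := rfl

theorem run_forR (a : RExpr) (c : Cmd) : (Cmd.forR a c).run A s =
    iter (fun _ s' => c.run A (s'.tick 2)) ⌈a.eval A s⌉₊ (s.tick (a.cost + 2)) := rfl

theorem run_ite_pos (b : BExpr) (c d : Cmd) (h : b.holds A s) :
    (Cmd.ite b c d).run A s = c.run A (s.tick (b.cost + 1)) := if_pos h

theorem run_ite_neg (b : BExpr) (c d : Cmd) (h : ¬ b.holds A s) :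
    (Cmd.ite b c d).run A s = d.run A (s.tick (b.cost + 1)) := if_neg h

end Commands

/-- Outside of the listed registers and arrays the two states agree. -/
structure Frame (Vn : List NReg) (Vr : List RReg) (Vm : List Arr) (s s' : State) : Prop where
  nat : ∀ r, r ∉ Vn → s'.nat r = s.nat r
  real : ∀ r, r ∉ Vr → s'.real r = s.real r
  mem : ∀ t, t ∉ Vm → s'.mem t = s.mem t

namespace Frame

variable {Vn Wn : List NReg} {Vr Wr : List RReg} {Vm Wm : List Arr} {s s' s'' : State}

theorem refl : Frame Vn Vr Vm s s := ⟨fun _ _ => rfl, fun _ _ => rfl, fun _ _ => rfl⟩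

theorem trans (h : Frame Vn Vr Vm s s') (h' : Frame Vn Vr Vm s' s'') : Frame Vn Vr Vm s s'' :=
  ⟨fun r hr => (h'.nat r hr).trans (h.nat r hr), fun r hr => (h'.real r hr).trans (h.real r hr),
    fun r hr => (h'.mem r hr).trans (h.mem r hr)⟩

theorem mono (h : Frame Vn Vr Vm s s') (hn : Vn ⊆ Wn) (hr : Vr ⊆ Wr) (hm : Vm ⊆ Wm) :
    Frame Wn Wr Wm s s' :=
  ⟨fun r h' => h.nat r fun h => h' (hn h), fun r h' => h.real r fun h => h' (hr h),
    fun r h' => h.mem r fun h => h' (hm h)⟩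

theorem tick (h : Frame Vn Vr Vm s s') (k : ℕ) : Frame Vn Vr Vm s (s'.tick k) :=
  ⟨h.nat, h.real, h.mem⟩

theorem setN (h : Frame Vn Vr Vm s s') {v : NReg} (hv : v ∈ Vn) (k : ℕ) :
    Frame Vn Vr Vm s (s'.setN v k) :=
  ⟨fun r hr => by rw [← h.nat r hr]; exact Function.update_of_ne (by rintro rfl; exact hr hv) _ _,
    h.real, h.mem⟩

theorem setR (h : Frame Vn Vr Vm s s') {v : RReg} (hv : v ∈ Vr) (a : ℝ) :
    Frame Vn Vr Vm s (s'.setR v a) :=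
  ⟨h.nat, fun r hr => by
    rw [← h.real r hr]; exact Function.update_of_ne (by rintro rfl; exact hr hv) _ _, h.mem⟩

theorem store (h : Frame Vn Vr Vm s s') {t : Arr} (ht : t ∈ Vm) (k : ℕ) (a : ℝ) :
    Frame Vn Vr Vm s (s'.store t k a) :=
  ⟨h.nat, h.real, fun r hr => by
    rw [← h.mem r hr]; exact Function.update_of_ne (by rintro rfl; exact hr ht) _ _⟩

end Frame

/-! ### The representation invariant and the deterministic operations that preserve it. -/

/-- The instance of the data structure for block `b`, with a tree of depth `d`, represents the
iterate `x` and the running sum `S`. -/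
structure Rep {N : ℕ} (s : State) (b : Blk) (d : ℕ) (x S : Fin N → ℝ) : Prop where
  dim : s.nat (.dim b) = N
  cap : s.nat (.cap b) = 2 ^ d
  depth : s.nat (.depth b) = d
  le : N ≤ 2 ^ d
  xi : 0 < s.real (.xi b)
  entry : ∀ j : Fin N, s.real (.xi b) * s.mem (.u b) j = x j
  sum : ∀ j : Fin N, s.mem (.u' b) j + s.real (.sigma b) * s.mem (.u b) j = S j
  nu : s.real (.nu b) = ∑ j, x j
  leaf : ∀ j : Fin N, s.mem (.tree b) (2 ^ d + j) = s.mem (.u b) j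
  pad : ∀ j, N ≤ j → j < 2 ^ d → s.mem (.tree b) (2 ^ d + j) = 0
  node : ∀ k, 1 ≤ k → k < 2 ^ d →
    s.mem (.tree b) k = s.mem (.tree b) (k + k) + s.mem (.tree b) (k + k + 1)

/-- The invariant reads only three index registers, three real registers and three arrays, so it
survives code that writes elsewhere. -/
theorem Rep.frame {N : ℕ} {s s' : State} {b : Blk} {d : ℕ} {x S : Fin N → ℝ}
    (h : Rep s b d x S) {Vn : List NReg} {Vr : List RReg} {Vm : List Arr}
    (hF : Frame Vn Vr Vm s s')
    (hn : .dim b ∉ Vn ∧ .cap b ∉ Vn ∧ .depth b ∉ Vn)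
    (hr : .xi b ∉ Vr ∧ .sigma b ∉ Vr ∧ .nu b ∉ Vr)
    (hm : .u b ∉ Vm ∧ .u' b ∉ Vm ∧ .tree b ∉ Vm) : Rep s' b d x S := by
  obtain ⟨h1, h2, h3⟩ := hn
  obtain ⟨h4, h5, h6⟩ := hr
  obtain ⟨h7, h8, h9⟩ := hm
  constructor <;>
    try simp only [hF.nat _ h1, hF.nat _ h2, hF.nat _ h3, hF.real _ h4, hF.real _ h5,
      hF.real _ h6, hF.mem _ h7, hF.mem _ h8, hF.mem _ h9]
  exacts [h.dim, h.cap, h.depth, h.le, h.xi, h.entry, h.sum, h.nu, h.leaf, h.pad, h.node]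

section Maintainer

variable {m n : ℕ} [NeZero m] [NeZero n] (A : Matrix (Fin m) (Fin n) ℝ)
  {N : ℕ} {s : State} {b : Blk} {d : ℕ} {x S : Fin N → ℝ}

theorem scale_spec (h : Rep s b d x S) (c : RExpr) (hc : 0 < c.eval A s) :
    Det ((IM.scale b c).run A s) fun s' =>
      Rep s' b d (fun j => x j * c.eval A s) S ∧ Frame [] [.arg, .xi b, .nu b] [] s s' ∧
      s'.steps = s.steps + c.cost + 9 := by
  simp only [IM.scale, run_cons, run_setR, PMF.pure_bind, run_nil]
  refine Det.pure ⟨?_, ?_, ?_⟩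
  · constructor <;> try simp only [State.nat_tick, State.real_tick, State.mem_tick, State.nat_setR,
      State.real_setR, State.mem_setR, RExpr.eval_reg, RExpr.eval_mul, Function.update_self, ne_eq,
      reduceCtorEq, not_false_eq_true, Function.update_of_ne]
    · exact h.dim
    · exact h.cap
    · exact h.depth
    · exact h.le
    · exact mul_pos h.xi hc
    · intro j
      rw [← h.entry]
      ring
    · exact h.sum
    · rw [h.nu, Finset.sum_mul]
    · exact h.leaf
    · exact h.pad
    · exact h.node
  · exact (((Frame.refl.setR (by simp) _).tick _).setR (by simp) _).tick _ |>.setR (by simp) _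
      |>.tick _
  · simp
    ring

theorem updateSum_spec (h : Rep s b d x S) :
    Det ((IM.updateSum b).run A s) fun s' =>
      Rep s' b d x (S + x) ∧ Frame [] [.sigma b] [] s s' ∧ s'.steps = s.steps + 4 := by
  simp only [IM.updateSum, run_setR]
  refine Det.pure ⟨?_, (Frame.refl.setR (by simp) _).tick _, by simp⟩
  constructor <;> try simp only [State.nat_tick, State.real_tick, State.mem_tick, State.nat_setR,
      State.real_setR, State.mem_setR, RExpr.eval_reg, RExpr.eval_add, Function.update_self, ne_eq,
      reduceCtorEq, not_false_eq_true, Function.update_of_ne]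
  · exact h.dim
  · exact h.cap
  · exact h.depth
  · exact h.le
  · exact h.xi
  · exact h.entry
  · intro j
    rw [Pi.add_apply, ← h.entry, ← h.sum]
    ring
  · exact h.nu
  · exact h.leaf
  · exact h.pad
  · exact h.node

/-- Recomputing the partial sums on the path from the leaf `p` to the root restores the tree. -/
theorem repair_spec {p : ℕ} (hp : 2 ^ d ≤ p) (hp' : p < 2 ^ (d + 1)) (hd : s.nat (.depth b) = d)
    (hnode : s.nat .node = p)
    (hs : ∀ k, 1 ≤ k → k < 2 ^ d → k ≠ p / 2 →
      s.mem (.tree b) k = s.mem (.tree b) (k + k) + s.mem (.tree b) (k + k + 1)) :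
    Det ((Cmd.forN .l (NReg.depth b) (block [
      .setN .node (.half NReg.node),
      .store (.tree b) NReg.node (.read (.tree b) (NReg.node + NReg.node) +
        .read (.tree b) (NReg.node + NReg.node + 1))])).run A s) fun s' =>
      (∀ k, 1 ≤ k → k < 2 ^ d →
        s'.mem (.tree b) k = s'.mem (.tree b) (k + k) + s'.mem (.tree b) (k + k + 1)) ∧
      (∀ k, 2 ^ d ≤ k → s'.mem (.tree b) k = s.mem (.tree b) k) ∧
      Frame [.node, .l] [] [.tree b] s s' ∧ s'.steps = s.steps + 3 + 18 * d := by
  rw [run_forN, NExpr.eval_reg, hd]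
  -- After `k` passes only the ancestors `p / 2 ^ q` with `q > k` may disagree with their children.
  refine (iter_det (fun k s' => s'.nat .node = p / 2 ^ k ∧
      (∀ i, 1 ≤ i → i < 2 ^ d → (∀ q, k < q → i ≠ p / 2 ^ q) →
        s'.mem (.tree b) i = s'.mem (.tree b) (i + i) + s'.mem (.tree b) (i + i + 1)) ∧
      (∀ k, 2 ^ d ≤ k → s'.mem (.tree b) k = s.mem (.tree b) k) ∧
      Frame [.node, .l] [] [.tree b] s s' ∧ s'.steps = s.steps + 3 + 18 * k) ?_ d ?_).mono ?_
  · refine ⟨by simp [hnode], ?_, by simp, Frame.refl.tick _, by simp⟩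
    intro i h1 h2 h3
    exact hs i h1 h2 (by simpa using h3 1 one_pos)
  · rintro k hk s' ⟨h1, h2, h3, h4, h5⟩
    simp only [run_cons, run_setN, run_store, PMF.pure_bind, run_nil]
    have hq : p / 2 ^ (k + 1) = p / 2 ^ k / 2 := by rw [pow_succ, Nat.div_div_eq_div_mul]
    have hlt : p / 2 ^ (k + 1) < 2 ^ d := by
      rw [Nat.div_lt_iff_lt_mul (by positivity), ← pow_add]
      exact hp'.trans_le (Nat.pow_le_pow_right two_pos (by omega))
    have hpos : 1 ≤ p / 2 ^ (k + 1) := by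
      rw [Nat.one_le_div_iff (by positivity)]
      exact (Nat.pow_le_pow_right two_pos hk).trans hp
    refine Det.pure ⟨?_, ?_, ?_, ?_, ?_⟩
    · simp [h1, hq]
    · intro i hi1 hi2 hi3
      simp only [State.mem_tick, State.mem_store, Function.update_self, State.mem_setN,
        State.nat_tick, State.nat_setN, NExpr.eval_reg, NExpr.eval_half, RExpr.eval_add,
        RExpr.eval_read, NExpr.eval_add, NExpr.eval_ofNat, h1, ne_eq, reduceCtorEq,
        not_false_eq_true, Function.update_of_ne, ← hq]
      have hq2 : p / 2 ^ (k + 2) = p / 2 ^ (k + 1) / 2 := by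
        rw [pow_succ _ (k + 1), Nat.div_div_eq_div_mul]
      -- The rewritten node is a child of `p / 2 ^ (k + 2)` alone, which is still exempt, so no
      -- other equation is disturbed.
      have hne := hi3 (k + 2) (by omega)
      generalize hr : p / 2 ^ (k + 1) = r at *
      have e1 : i + i ≠ r := by omega
      have e2 : i + i + 1 ≠ r := by omega
      rw [Function.update_of_ne e1, Function.update_of_ne e2]
      by_cases e : i = r
      · subst e
        rw [Function.update_self]
      · rw [Function.update_of_ne e]
        refine h2 i hi1 hi2 fun q hkq => ?_
        rcases Nat.lt_or_ge (k + 1) q with h | h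
        · exact hi3 q h
        · obtain rfl : q = k + 1 := by omega
          omega
    · intro i hi
      simp only [State.mem_tick, State.mem_store, Function.update_self, State.mem_setN,
        State.nat_tick, State.nat_setN, NExpr.eval_reg, NExpr.eval_half, h1, ne_eq, reduceCtorEq,
        not_false_eq_true, Function.update_of_ne, ← hq]
      rw [Function.update_of_ne (by omega), h3 i hi]
    · exact (h4.setN (by simp) _).tick _ |>.setN (by simp) _ |>.tick _ |>.store (by simp) _ _
        |>.tick _
    · simp [h5]
      ring
  · rintro s' ⟨-, h2, h3, h4, h5⟩
    refine ⟨fun k hk1 hk2 => h2 k hk1 hk2 fun q hq => ?_, h3, h4, h5⟩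
    -- After `d` passes the exempt indices lie above the root: they are `0`, and no node is exempt
    -- any more.
    have : p / 2 ^ q = 0 :=
      Nat.div_eq_of_lt (hp'.trans_le (Nat.pow_le_pow_right two_pos hq))
    omega

end Maintainer

section Maintainer

variable {m n : ℕ} [NeZero m] [NeZero n] (A : Matrix (Fin m) (Fin n) ℝ)
  {N : ℕ} {s : State} {b : Blk} {d : ℕ} {x S : Fin N → ℝ}

/-- A change of `c / ξ` in `u` alters `σ u` by `c σ / ξ`, which `u'` compensates; thus the running
sum is untouched. The index register must differ from `node`, which is overwritten before the index
is read again. -/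
theorem addSparse_spec (h : Rep s b d x S) {r : NReg} {j : Fin N} (hj : s.nat r = j)
    (hr : r ≠ .node) (c : RExpr) :
    Det ((IM.addSparse b r c).run A s) fun s' =>
      Rep s' b d (x + Pi.single j (c.eval A s)) S ∧
      Frame [.node, .l] [.arg, .nu b] [.u b, .u' b, .tree b] s s' ∧
      s'.steps = s.steps + c.cost + 34 + 18 * d := by
  have hjN : (j : ℕ) < 2 ^ d := j.2.trans_le h.le
  simp only [IM.addSparse, run_cons, run_setR, run_store, run_setN, PMF.pure_bind]
  refine (repair_spec A (d := d) (p := 2 ^ d + j) (by omega) (by rw [pow_succ]; omega)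
    (by simp [h.depth]) (by simp [h.cap, hj]) ?_).bind ?_
  · intro k hk1 hk2 hk3
    simp [h.cap, hj]
    rw [Function.update_of_ne (by omega), Function.update_of_ne (by omega),
      Function.update_of_ne (by omega)]
    exact h.node k hk1 hk2
  · rintro s' ⟨h1, h2, h3, h4⟩
    rw [run_nil]
    have hxi := h.xi.ne'
    refine Det.pure ⟨?_, ?_, ?_⟩
    · constructor
      · rw [h3.nat _ (by simp)]
        simp [h.dim]
      · rw [h3.nat _ (by simp)]
        simp [h.cap]
      · rw [h3.nat _ (by simp)]
        simp [h.depth]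
      · exact h.le
      · rw [h3.real _ (by simp)]
        simp [h.xi]
      · intro i
        rw [h3.real _ (by simp), h3.mem _ (by simp)]
        simp only [State.nat_tick, State.real_tick, State.mem_tick, State.nat_setN, State.real_setN,
          State.mem_setN, State.nat_store, State.real_store, State.mem_store, State.nat_setR,
          State.real_setR, State.mem_setR, RExpr.eval_reg, RExpr.eval_add, RExpr.eval_div,
          RExpr.eval_read, NExpr.eval_reg, hj, ne_eq, reduceCtorEq, not_false_eq_true,
          Function.update_of_ne, Function.update_self, Pi.add_apply, ← h.entry]
        by_cases e : i = j
        · subst e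
          simp
          field_simp
        · rw [Function.update_of_ne (by simpa [Fin.ext_iff] using e), Pi.single_eq_of_ne e, add_zero]
      · intro i
        rw [h3.real _ (by simp), h3.mem _ (by simp), h3.mem _ (by simp)]
        simp only [State.nat_tick, State.real_tick, State.mem_tick, State.nat_setN, State.real_setN,
          State.mem_setN, State.nat_store, State.real_store, State.mem_store, State.nat_setR,
          State.real_setR, State.mem_setR, RExpr.eval_reg, RExpr.eval_add, RExpr.eval_div,
          RExpr.eval_sub, RExpr.eval_mul,
          RExpr.eval_read, NExpr.eval_reg, hj, ne_eq, reduceCtorEq, not_false_eq_true,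
          Function.update_of_ne, Function.update_self, ← h.sum]
        by_cases e : i = j
        · subst e
          simp
          field_simp
          ring
        · rw [Function.update_of_ne (by simpa [Fin.ext_iff] using e),
            Function.update_of_ne (by simpa [Fin.ext_iff] using e)]
      · rw [h3.real _ (by simp)]
        simp [h.nu, Finset.sum_add_distrib]
      · intro i
        rw [h2 _ (by omega), h3.mem _ (by simp)]
        by_cases e : i = j
        · subst e
          simp [h.cap, hj, Function.update_of_ne hr]
        · have e' : (i : ℕ) ≠ j := by simpa [Fin.ext_iff] using e
          simp [h.cap, hj, Function.update_of_ne, e', h.leaf]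
      · intro i hi1 hi2
        rw [h2 _ (by omega)]
        have e' : i ≠ j := by omega
        simp [h.cap, hj, Function.update_of_ne, e', h.pad i hi1 hi2]
      · exact h1
    · refine Frame.trans ?_ (h3.mono (by simp) (by simp) (by simp))
      exact Frame.refl.setR (by simp) _ |>.tick _ |>.store (by simp) _ _ |>.tick _
        |>.store (by simp) _ _ |>.tick _ |>.setR (by simp) _ |>.tick _ |>.setN (by simp) _ |>.tick _
        |>.store (by simp) _ _ |>.tick _
    · rw [h4]
      simp
      ring

theorem get_eval (h : Rep s b d x S) {r : NReg} {j : Fin N} (hj : s.nat r = j) :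
    (IM.get b r).eval A s = x j := by
  simp [IM.get, hj, h.entry]

theorem getSum_eval (h : Rep s b d x S) {r : NReg} {j : Fin N} (hj : s.nat r = j) :
    (IM.getSum b r).eval A s = S j := by
  simp [IM.getSum, hj, h.sum]

/-- One step of the multiplicative weights update with a loss `c` in the single coordinate `j`. -/
noncomputable def reweight {ι : Type} [Fintype ι] (x δ : ι → ℝ) : ι → ℝ :=
  fun k => x k * Real.exp (-δ k) / ∑ l, x l * Real.exp (-δ l)

/-- Turns the multiplicative update into the sparse addition that the data structure supports. -/
theorem mul_exp_single {ι : Type} [DecidableEq ι] (x : ι → ℝ) (j : ι) (c : ℝ) (k : ι) :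
    x k * Real.exp (-(Pi.single j c : ι → ℝ) k) =
      x k + (Pi.single j ((Real.exp (-c) - 1) * x j) : ι → ℝ) k := by
  by_cases e : k = j
  · subst e
    simp
    ring
  · simp [Pi.single_eq_of_ne e]

theorem mirrorStep_spec (h : Rep s b d x S) (hx : ∀ k, 0 < x k) {r : NReg} {j : Fin N}
    (hj : s.nat r = j) (hr : r ≠ .node) :
    Det ((mirrorStep b r).run A s) fun s' =>
      Rep s' b d (reweight x (Pi.single j (s.real (.step b))))
        (S + reweight x (Pi.single j (s.real (.step b)))) ∧
      Frame [.node, .l] [.val, .arg, .xi b, .sigma b, .nu b] [.u b, .u' b, .tree b] s s' ∧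
      s'.steps = s.steps + 66 + 18 * d := by
  set c := s.real (.step b) with hc
  simp only [mirrorStep, run_cons, run_setR, PMF.pure_bind]
  have hF0 : Frame [.node, .l] [.val, .arg, .xi b, .sigma b, .nu b] [.u b, .u' b, .tree b] s
    ((s.setR .val ((IM.get b r).eval A s)).tick ((IM.get b r).cost + 1)) :=
    (Frame.refl.setR (by simp) _).tick _
  have h0 : Rep ((s.setR .val ((IM.get b r).eval A s)).tick ((IM.get b r).cost + 1)) b d x S :=
    h.frame (Vn := []) (Vr := [.val]) (Vm := []) ((Frame.refl.setR (by simp) _).tick _)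
      (by simp) (by simp) (by simp)
  refine (addSparse_spec A h0 (r := r) (j := j) (by simpa using hj) hr _).bind ?_
  rintro s1 ⟨h1, hF1, hs1⟩
  have hval : RExpr.eval A ((s.setR .val ((IM.get b r).eval A s)).tick ((IM.get b r).cost + 1))
      ((RExpr.exp (0 - RReg.step b) - 1) * RReg.val) = (Real.exp (-c) - 1) * x j := by
    simp [get_eval A h hj, hc]
  rw [hval] at h1
  have hx1 : (x + Pi.single j ((Real.exp (-c) - 1) * x j)) =
      fun k => x k * Real.exp (-(Pi.single j c : Fin N → ℝ) k) :=
    funext fun k => (mul_exp_single x j c k).symm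
  rw [hx1] at h1
  have hν : 0 < s1.real (.nu b) := by
    rw [h1.nu]
    exact Finset.sum_pos (fun k _ => mul_pos (hx k) (Real.exp_pos _)) ⟨j, Finset.mem_univ _⟩
  refine (scale_spec A h1 (1 / IM.getNorm b) (by simpa [IM.getNorm] using hν)).bind ?_
  rintro s2 ⟨h2, hF2, hs2⟩
  have hx2 : (fun k => x k * Real.exp (-(Pi.single j c : Fin N → ℝ) k) *
      RExpr.eval A s1 (1 / IM.getNorm b)) = reweight x (Pi.single j c) := by
    funext k
    simp [IM.getNorm, reweight, h1.nu, div_eq_mul_inv]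
  rw [hx2] at h2
  refine (updateSum_spec A h2).bind ?_
  rintro s3 ⟨h3, hF3, hs3⟩
  rw [run_nil]
  refine Det.pure ⟨h3, ?_, ?_⟩
  · refine hF0.trans ((hF1.mono ?_ ?_ ?_).trans ((hF2.mono ?_ ?_ ?_).trans (hF3.mono ?_ ?_ ?_))) <;>
      simp
  · rw [hs3, hs2, hs1]
    simp [IM.get, IM.getNorm]
    ring

end Maintainer

/-! ### Sampling by a walk down the tree of partial sums. -/

section Walk

/-- A walk down a binary tree in heap order: `h` steps from the node `k`, where the right child of
the node `i` is chosen with probability `t (2 i + 1) / (t (2 i) + t (2 i + 1))`. -/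
noncomputable def walk (t : ℕ → ℝ) (k : ℕ) : ℕ → PMF ℕ
  | 0 => PMF.pure k
  | h + 1 => (walk t k h).bind fun i =>
      (drawFrom fun b : Bool => if b then t (i + i + 1) / (t (i + i) + t (i + i + 1))
        else 1 - t (i + i + 1) / (t (i + i) + t (i + i + 1))).map fun b =>
          i + i + if b then 1 else 0

theorem drawFrom_bool_apply {a b : ℝ} (ha : 0 ≤ a) (hb : 0 ≤ b) (hab : 0 < a + b) (c : Bool) :
    drawFrom (fun c : Bool => if c then b / (a + b) else 1 - b / (a + b)) c =
      ENNReal.ofReal (if c then b / (a + b) else a / (a + b)) := by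
  have e : 1 - b / (a + b) = a / (a + b) := by
    field_simp
    ring
  rw [e]
  rw [drawFrom_apply]
  · intro c
    cases c <;> simp <;> positivity
  · simp
    field_simp
    ring

/-- The branching probabilities along a path are ratios of a node's weight to its parent's, so their
product telescopes. The condition `a / 2 ^ h = 1` says that `a` lies on level `h`. -/
theorem walk_apply {t : ℕ → ℝ} {d : ℕ} (ht : ∀ k, 0 ≤ t k) (h1 : 0 < t 1)
    (hs : ∀ k, 1 ≤ k → k < 2 ^ d → t k = t (k + k) + t (k + k + 1)) {h : ℕ} (hd : h ≤ d) (a : ℕ) :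
    walk t 1 h a = if a / 2 ^ h = 1 then ENNReal.ofReal (t a / t 1) else 0 := by
  induction h generalizing a with
  | zero =>
    by_cases e : a = 1
    · subst e
      simp [walk, h1.ne']
    · simp [walk, PMF.pure_apply, e]
  | succ h ih =>
    have hdiv : a / 2 ^ (h + 1) = a / 2 / 2 ^ h := by
      rw [pow_succ', Nat.div_div_eq_div_mul]
    rw [walk, PMF.bind_apply, tsum_eq_single (a / 2), ih (by omega), hdiv]
    · split_ifs with hc
      · have hlow : 2 ^ h ≤ a / 2 := by
          by_contra hlt
          rw [Nat.div_eq_of_lt (by omega)] at hc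
          omega
        have hup : a / 2 < 2 ^ (h + 1) := by
          rw [pow_succ']
          exact (Nat.div_lt_iff_lt_mul (by positivity)).1 (by omega)
        have hsum := hs (a / 2) (Nat.one_le_two_pow.trans hlow)
          (hup.trans_le (Nat.pow_le_pow_right two_pos hd))
        -- Below a parent of weight zero the branching ratio is `0 / 0`; this is harmless, as the
        -- parent is reached with probability zero and the child has weight zero.
        rcases (ht (a / 2)).eq_or_lt with h0 | h0
        · have : t a = 0 := by
            rcases Nat.even_or_odd' a with ⟨q, rfl | rfl⟩
            · have e1 : 2 * q / 2 = q := by omega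
              rw [e1] at hsum h0
              have := ht (q + q)
              have := ht (q + q + 1)
              rw [two_mul]
              linarith
            · have e1 : (2 * q + 1) / 2 = q := by omega
              rw [e1] at hsum h0
              have := ht (q + q)
              have := ht (q + q + 1)
              rw [two_mul]
              linarith
          simp [← h0, this]
        -- Only the bit equal to the parity of `a` leads from `a / 2` to `a`.
        · rw [PMF.map_apply, tsum_eq_single (decide (a % 2 = 1)),
            drawFrom_bool_apply (ht _) (ht _) (hsum ▸ h0), if_pos, ← hsum,
            ← ENNReal.ofReal_mul (by positivity)]
          · congr 1
            rcases Nat.even_or_odd' a with ⟨q, rfl | rfl⟩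
            · have e1 : 2 * q / 2 = q := by omega
              have e2 : ¬ (2 * q % 2 = 1) := by omega
              rw [e1] at h0 ⊢
              simp only [e2, decide_false, Bool.false_eq_true, if_false]
              rw [two_mul]
              field_simp
            · have e1 : (2 * q + 1) / 2 = q := by omega
              have e2 : (2 * q + 1) % 2 = 1 := by omega
              rw [e1] at h0 ⊢
              simp only [e2, decide_true, if_true]
              rw [two_mul]
              field_simp
          · by_cases e : a % 2 = 1
            · simp [e]
              omega
            · simp [e]
              omega
          · intro b hb
            rw [if_neg]
            intro hab
            apply hb
            cases b <;> simp at hab ⊢ <;> omega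
      · simp
    · intro i hi
      have : ((drawFrom fun b : Bool => if b then t (i + i + 1) / (t (i + i) + t (i + i + 1))
        else 1 - t (i + i + 1) / (t (i + i) + t (i + i + 1))).map fun b =>
          i + i + if b then 1 else 0) a = 0 := by
        rw [PMF.map_apply]
        refine ENNReal.tsum_eq_zero.2 fun b => ?_
        rw [if_neg]
        cases b <;> simp <;> omega
      rw [this, mul_zero]

end Walk

section Walk

theorem sum_range_two_mul (f : ℕ → ℝ) (N : ℕ) :
    ∑ i ∈ Finset.range (2 * N), f i = ∑ i ∈ Finset.range N, (f (i + i) + f (i + i + 1)) := by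
  induction N with
  | zero => simp
  | succ N ih =>
    rw [Finset.sum_range_succ, ← ih, show 2 * (N + 1) = 2 * N + 1 + 1 by ring,
      Finset.sum_range_succ, Finset.sum_range_succ, two_mul]
    ring

/-- Passing from one level to the next splits each weight into two, so every level, in particular
the leaves, has the total of the root. -/
theorem sum_level {t : ℕ → ℝ} {d : ℕ}
    (hs : ∀ k, 1 ≤ k → k < 2 ^ d → t k = t (k + k) + t (k + k + 1)) {h : ℕ} (hd : h ≤ d) :
    ∑ i ∈ Finset.range (2 ^ h), t (2 ^ h + i) = t 1 := by
  induction h with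
  | zero => simp
  | succ h ih =>
    rw [← ih (by omega), pow_succ', sum_range_two_mul fun i => t (2 * 2 ^ h + i)]
    refine Finset.sum_congr rfl fun i hi => ?_
    rw [Finset.mem_range] at hi
    rw [hs (2 ^ h + i) (Nat.one_le_two_pow.trans (Nat.le_add_right _ _))]
    · congr 2 <;> ring
    · calc 2 ^ h + i < 2 ^ (h + 1) := by rw [pow_succ]; omega
        _ ≤ 2 ^ d := Nat.pow_le_pow_right two_pos hd

theorem tree_nonneg {t : ℕ → ℝ} {d : ℕ}
    (hs : ∀ k, 1 ≤ k → k < 2 ^ d → t k = t (k + k) + t (k + k + 1))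
    (hl : ∀ j, j < 2 ^ d → 0 ≤ t (2 ^ d + j)) {k : ℕ} (h1 : 1 ≤ k) (h2 : k < 2 ^ (d + 1)) :
    0 ≤ t k := by
  rcases Nat.lt_or_ge k (2 ^ d) with h | h
  · have h3 : 2 ^ (d + 1) = 2 * 2 ^ d := pow_succ' _ _
    rw [hs k h1 h]
    exact add_nonneg (tree_nonneg hs hl (by omega) (by omega))
      (tree_nonneg hs hl (by omega) (by omega))
  · obtain ⟨j, rfl⟩ := Nat.exists_eq_add_of_le h
    rw [pow_succ] at h2
    exact hl j (by omega)
termination_by 2 ^ (d + 1) - k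

end Walk

section Sample

variable {m n : ℕ} [NeZero m] [NeZero n] (A : Matrix (Fin m) (Fin n) ℝ)
  {N : ℕ} {s : State} {b : Blk} {d : ℕ} {x S : Fin N → ℝ}

/-- At level `d` the walk is at a leaf with probability proportional to its weight `x j / ξ`, and
the root carries `1 / ξ`. The absolute values change nothing at tree nodes; they make the weight
nonnegative at the memory cells outside the tree, as `walk_apply` asks for all indices. -/
theorem Rep.walk_eq [NeZero N] (h : Rep s b d x S) (hx : ∀ j, 0 < x j) (hx1 : ∑ j, x j = 1) :
    walk (fun k => |s.mem (.tree b) k|) 1 d =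
      (drawFrom x).map fun j : Fin N => 2 ^ d + (j : ℕ) := by
  set t := s.mem (.tree b) with ht
  have hxi := h.xi
  have hleaf : ∀ j : Fin N, t (2 ^ d + j) = s.mem (.u b) j := h.leaf
  have hpad : ∀ j, N ≤ j → j < 2 ^ d → t (2 ^ d + j) = 0 := h.pad
  have hnode : ∀ k, 1 ≤ k → k < 2 ^ d → t k = t (k + k) + t (k + k + 1) := h.node
  have hu : ∀ j : Fin N, t (2 ^ d + j) = x j / s.real (.xi b) := by
    intro j
    rw [hleaf, ← h.entry]
    field_simp
  have hl : ∀ j, j < 2 ^ d → 0 ≤ t (2 ^ d + j) := by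
    intro j hj
    rcases Nat.lt_or_ge j N with hN | hN
    · rw [hu ⟨j, hN⟩]
      exact (div_pos (hx _) hxi).le
    · rw [hpad j hN hj]
  have hnn : ∀ k, 1 ≤ k → k < 2 ^ (d + 1) → |t k| = t k := fun k h1 h2 =>
    abs_of_nonneg (tree_nonneg hnode hl h1 h2)
  have ht1 : t 1 = 1 / s.real (.xi b) := by
    rw [← sum_level hnode le_rfl, ← hx1, Finset.sum_div, Finset.sum_congr rfl fun j _ => (hu j).symm,
      Fin.sum_univ_eq_sum_range fun j => t (2 ^ d + j)]
    refine (Finset.sum_subset (by simpa using h.le) fun j hj1 hj2 => ?_).symm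
    rw [Finset.mem_range] at hj1 hj2
    exact hpad j (by omega) hj1
  have e1 : |t 1| = t 1 := hnn 1 le_rfl (Nat.one_lt_two_pow (by omega))
  ext a
  rw [walk_apply (t := fun k => |t k|) (d := d) (fun k => abs_nonneg _)
    (by rw [e1, ht1]; positivity) ?_ le_rfl, PMF.map_apply]
  · split_ifs with ha
    · have hlow : 2 ^ d ≤ a := by
        by_contra hlt
        rw [Nat.div_eq_of_lt (by omega)] at ha
        omega
      have hup : a < 2 ^ (d + 1) := by
        rw [pow_succ']
        exact (Nat.div_lt_iff_lt_mul (by positivity)).1 (by omega)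
      obtain ⟨j, rfl⟩ := Nat.exists_eq_add_of_le hlow
      rw [hnn _ (Nat.one_le_two_pow.trans hlow) hup, e1, ht1]
      rcases Nat.lt_or_ge j N with hN | hN
      · rw [tsum_eq_single ⟨j, hN⟩, if_pos rfl, drawFrom_apply (fun j => (hx j).le) hx1,
          hu ⟨j, hN⟩]
        · congr 1
          field_simp
        · intro j' hj'
          rw [if_neg]
          intro e
          exact hj' (Fin.ext (by simpa using e.symm))
      -- A padding leaf has weight zero and is the image of no coordinate.
      · rw [hpad j hN (by rw [pow_succ] at hup; omega)]
        symm
        simp only [zero_div, ENNReal.ofReal_zero]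
        refine ENNReal.tsum_eq_zero.2 fun j' => if_neg ?_
        have := j'.2
        omega
    · symm
      refine ENNReal.tsum_eq_zero.2 fun j' => if_neg ?_
      rintro rfl
      apply ha
      have := j'.2.trans_le h.le
      rw [Nat.add_div_left _ (by positivity), Nat.div_eq_of_lt this]
  · intro k hk1 hk2
    have : 2 ^ (d + 1) = 2 * 2 ^ d := pow_succ' _ _
    rw [hnn _ hk1 (by omega), hnn _ (by omega) (by omega), hnn _ (by omega) (by omega)]
    exact hnode k hk1 hk2

theorem sample_spec [NeZero N] (h : Rep s b d x S) (hx : ∀ j, 0 < x j) (hx1 : ∑ j, x j = 1)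
    {v : NReg} (hv : .cap b ≠ v) :
    Coupled (drawFrom x) ((IM.sample b v).run A s) fun j s' =>
      s'.nat v = j ∧ Frame [.node, .l, .bit, v] [.w₁, .w₂] [] s s' ∧
      s'.steps = s.steps + 9 + 30 * d := by
  set t : ℕ → ℝ := fun k => |s.mem (.tree b) k| with ht
  have hxi := h.xi
  have hl : ∀ j, j < 2 ^ d → 0 ≤ s.mem (.tree b) (2 ^ d + j) := by
    intro j hj
    rcases Nat.lt_or_ge j N with hN | hN
    · have := h.entry ⟨j, hN⟩
      rw [h.leaf ⟨j, hN⟩]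
      exact (pos_of_mul_pos_right (this ▸ hx _) hxi.le).le
    · rw [h.pad j hN hj]
  have hnn : ∀ k, 1 ≤ k → k < 2 ^ (d + 1) → t k = s.mem (.tree b) k := fun k h1 h2 =>
    abs_of_nonneg (tree_nonneg h.node hl h1 h2)
  simp only [IM.sample, run_cons, run_setN, PMF.pure_bind, run_forN]
  have key : Coupled (walk t 1 d) (iter (fun k s' => (block [
        Cmd.setR .w₁ (RReg.xi b * .read (.tree b) (NReg.node + NReg.node)),
        Cmd.setR .w₂ (RReg.xi b * .read (.tree b) (NReg.node + NReg.node + 1)),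
        Cmd.flip .bit (RReg.w₂ / (RReg.w₁ + RReg.w₂)),
        Cmd.setN .node (NReg.node + NReg.node + NReg.bit)]).run A ((s'.setN .l k).tick 2)) d
        (((s.setN .node 1).tick 2).tick 3))
      fun a s' => s'.nat .node = a ∧ 2 ^ d ≤ a ∧ a < 2 ^ (d + 1) ∧
        Frame [.node, .l, .bit, v] [.w₁, .w₂] [] s s' ∧ s'.steps = s.steps + 5 + 30 * d := by
    refine iter_coupled (fun k => rfl) (fun k a s' => s'.nat .node = a ∧ 2 ^ k ≤ a ∧ a < 2 ^ (k + 1) ∧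
        Frame [.node, .l, .bit, v] [.w₁, .w₂] [] s s' ∧ s'.steps = s.steps + 5 + 30 * k) ?_ d ?_
    · refine Coupled.pure (a := 1) ?_
      exact ⟨by simp, by simp, by simp,
        ((Frame.refl.setN (by simp) _).tick _).tick _, by simp⟩
    · rintro k hk a s' ⟨h1, h2, h3, h4, h5⟩
      have hm : s'.mem (.tree b) = s.mem (.tree b) := h4.mem _ (by simp)
      have hξ : s'.real (.xi b) = s.real (.xi b) := h4.real _ (by simp)
      have hk1 : 2 ^ (k + 1) ≤ 2 ^ d := Nat.pow_le_pow_right two_pos hk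
      have hk2 : 2 ^ (k + 1) = 2 * 2 ^ k := pow_succ' _ _
      have hk3 : 2 ^ (d + 1) = 2 * 2 ^ d := pow_succ' _ _
      have hk4 : 2 ^ (k + 1 + 1) = 2 * 2 ^ (k + 1) := pow_succ' _ _
      have hk5 : 1 ≤ 2 ^ k := Nat.one_le_two_pow
      simp only [run_cons, PMF.pure_bind, Cmd.run, PMF.bind_map]
      refine Coupled.bind (R := fun x y => x = y) ?_ ?_
      · convert Coupled.refl _ using 2
        funext c
        have e1 := hnn (a + a) (by omega) (by omega)
        have e2 := hnn (a + a + 1) (by omega) (by omega)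
        -- The machine flips with ratios of `ξ` times the stored sums; the common factor cancels.
        simp [h1, hm, hξ, e1, e2, ← mul_add, mul_div_mul_left _ _ hxi.ne']
      · rintro c - _ rfl
        simp only [Function.comp_apply, run_cons, run_setN, PMF.pure_bind, run_nil]
        refine Coupled.pure (a := a + a + if c then 1 else 0) ?_
        refine ⟨?_, ?_, ?_, ?_, ?_⟩
        · simp [h1]
        · omega
        · split_ifs <;> omega
        · exact h4.setN (by simp) _ |>.tick _ |>.setR (by simp) _ |>.tick _ |>.setR (by simp) _
            |>.tick _ |>.setN (by simp) _ |>.tick _ |>.setN (by simp) _ |>.tick _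
        · simp [h5]
          ring
  -- The walk is the image of a draw from `x` under `j ↦ 2 ^ d + j`; injectivity turns the coupling
  -- into one with the draw itself.
  rw [h.walk_eq hx hx1] at key
  have key2 := Coupled.of_map_left (f := fun j : Fin N => 2 ^ d + (j : ℕ))
    (fun i j hij => Fin.ext (by simpa using hij)) key
  have e : NExpr.eval ((s.setN .node (NExpr.eval s 1)).tick (NExpr.cost 1 + 1))
      (NExpr.reg (.depth b)) = d := by simp [h.depth]
  rw [e]
  refine key2.bind_det ?_
  rintro j - s' ⟨h1, h2, h3, h4, h5⟩
  simp only [run_cons, run_setN, PMF.pure_bind, run_nil]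
  refine Det.pure ?_
  refine ⟨?_, (h4.setN (by simp) _).tick _, ?_⟩
  · simp [h1, h4.nat (.cap b) (by simp [hv]), h.cap]
  · simp [h5]
    ring

end Sample

/-! ### Sampling and clipping of the gradient estimates by the program. -/

/-- Clipping of a real number to `[-1, 1]`. -/
noncomputable def clipReal (r : ℝ) : ℝ := Real.sign r * min 1 |r|

theorem clipReal_of_one_lt {r : ℝ} (h : 1 < r) : clipReal r = 1 := by
  rw [clipReal, Real.sign_of_pos (by linarith), abs_of_pos (by linarith), min_eq_left h.le, one_mul]

theorem clipReal_of_lt_neg_one {r : ℝ} (h : r < -1) : clipReal r = -1 := by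
  rw [clipReal, Real.sign_of_neg (by linarith), abs_of_neg (by linarith), min_eq_left (by linarith),
    mul_one]

theorem clipReal_of_abs_le {r : ℝ} (h : |r| ≤ 1) : clipReal r = r := by
  rw [clipReal, min_eq_right h]
  rcases lt_trichotomy r 0 with h0 | h0 | h0
  · rw [Real.sign_of_neg h0, abs_of_neg h0]
    ring
  · simp [h0]
  · rw [Real.sign_of_pos h0, abs_of_pos h0, one_mul]

section Matrices

variable {m n : ℕ} {A : Matrix (Fin m) (Fin n) ℝ}

theorem rowNorm_sq (A : Matrix (Fin m) (Fin n) ℝ) (i : Fin m) :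
    rowNorm A i ^ 2 = ∑ j, A i j ^ 2 :=
  Real.sq_sqrt (Finset.sum_nonneg fun _ _ => sq_nonneg _)

theorem colNorm_sq (A : Matrix (Fin m) (Fin n) ℝ) (j : Fin n) :
    colNorm A j ^ 2 = ∑ i, A i j ^ 2 :=
  Real.sq_sqrt (Finset.sum_nonneg fun _ _ => sq_nonneg _)

theorem rowNorm_sq_pos (hA : ∀ i, ∃ j, A i j ≠ 0) (i : Fin m) : 0 < rowNorm A i ^ 2 := by
  obtain ⟨j, hj⟩ := hA i
  rw [rowNorm_sq]
  exact Finset.sum_pos' (fun _ _ => sq_nonneg _) ⟨j, Finset.mem_univ _, by positivity⟩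

theorem colNorm_sq_pos (hA : ∀ j, ∃ i, A i j ≠ 0) (j : Fin n) : 0 < colNorm A j ^ 2 := by
  obtain ⟨i, hi⟩ := hA j
  rw [colNorm_sq]
  exact Finset.sum_pos' (fun _ _ => sq_nonneg _) ⟨i, Finset.mem_univ _, by positivity⟩

theorem rowProb_nonneg (A : Matrix (Fin m) (Fin n) ℝ) (i : Fin m) (j : Fin n) :
    0 ≤ A i j ^ 2 / rowNorm A i ^ 2 := by positivity

theorem colProb_nonneg (A : Matrix (Fin m) (Fin n) ℝ) (j : Fin n) (i : Fin m) :
    0 ≤ A i j ^ 2 / colNorm A j ^ 2 := by positivity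

theorem sum_rowProb (hA : ∀ i, ∃ j, A i j ≠ 0) (i : Fin m) :
    ∑ j, A i j ^ 2 / rowNorm A i ^ 2 = 1 := by
  rw [← Finset.sum_div, ← rowNorm_sq, div_self (rowNorm_sq_pos hA i).ne']

theorem sum_colProb (hA : ∀ j, ∃ i, A i j ≠ 0) (j : Fin n) :
    ∑ i, A i j ^ 2 / colNorm A j ^ 2 = 1 := by
  rw [← Finset.sum_div, ← colNorm_sq, div_self (colNorm_sq_pos hA j).ne']

end Matrices

section Gradients

variable {m n : ℕ} [NeZero m] [NeZero n] {A : Matrix (Fin m) (Fin n) ℝ} {s : State} {d : ℕ}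

/-- The joint law factors in the order in which the program samples: a row from the iterate, then a
column from the matrix oracle. For `probY` the roles are exchanged. -/
theorem probX_eq_bind (hA : ∀ i, ∃ j, A i j ≠ 0) {z : Pt m n} (h0 : ∀ i, 0 < z.2 i)
    (h1 : ∑ i, z.2 i = 1) : drawFrom (probX A z) = (drawFrom z.2).bind fun i =>
      (drawFrom fun j => A i j ^ 2 / rowNorm A i ^ 2).map fun j => (i, j) :=
  drawFrom_eq_bind (fun i => (h0 i).le) h1 (rowProb_nonneg A) (sum_rowProb hA) (Equiv.refl _)

theorem probY_eq_bind (hA : ∀ j, ∃ i, A i j ≠ 0) {z : Pt m n} (h0 : ∀ j, 0 < z.1 j)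
    (h1 : ∑ j, z.1 j = 1) : drawFrom (probY A z) = (drawFrom z.1).bind fun j =>
      (drawFrom fun i => A i j ^ 2 / colNorm A j ^ 2).map fun i => (i, j) :=
  drawFrom_eq_bind (fun j => (h0 j).le) h1 (colProb_nonneg A) (sum_colProb hA) (Equiv.prodComm _ _)

variable (A) in
theorem setR_spec (v : RReg) (a : RExpr) : Det ((Cmd.setR v a).run A s) fun s' =>
    s'.real v = a.eval A s ∧ Frame [] [v] [] s s' ∧ s'.steps = s.steps + a.cost + 1 :=
  Det.pure ⟨by simp, (Frame.refl.setR (by simp) _).tick _, by simp [add_assoc]⟩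

variable (A) in
theorem clipReg_spec (v : RReg) :
    Det ((clipReg v).run A s) fun s' => s'.real v = clipReal (s.real v) ∧ Frame [] [v] [] s s' ∧
      s'.steps ≤ s.steps + 25 := by
  simp only [clipReg, run_cons]
  by_cases h1 : 1 < s.real v
  · rw [run_ite_pos _ _ _ _ _ (by simpa using h1)]
    simp only [run_cons, run_setR, PMF.pure_bind]
    rw [run_ite_neg _ _ _ _ _ (by simp)]
    simp only [run_nil, run_skip, PMF.pure_bind]
    refine Det.pure ⟨?_, ?_, ?_⟩
    · simp [clipReal_of_one_lt h1]
    · exact Frame.refl.tick _ |>.setR (by simp) _ |>.tick _ |>.tick _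
    · simp
  · rw [run_ite_neg _ _ _ _ _ (by simpa using h1)]
    simp only [run_cons, run_skip, PMF.pure_bind]
    by_cases h2 : s.real v < -1
    · rw [run_ite_pos _ _ _ _ _ (by simpa using h2)]
      simp only [run_nil, run_setR, PMF.pure_bind]
      refine Det.pure ⟨?_, ?_, ?_⟩
      · simp [clipReal_of_lt_neg_one h2]
      · exact Frame.refl.tick _ |>.tick _ |>.setR (by simp) _ |>.tick _
      · simp
    · rw [run_ite_neg _ _ _ _ _ (by simpa using h2)]
      simp only [run_nil, run_skip, PMF.pure_bind]
      refine Det.pure ⟨?_, ?_, ?_⟩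
      · simp [clipReal_of_abs_le (abs_le.2 ⟨not_lt.1 h2, not_lt.1 h1⟩)]
      · exact Frame.refl.tick _ |>.tick _
      · simp

theorem gradX_spec (hA : ∀ i, ∃ j, A i j ≠ 0) {z : Pt m n} {S : Fin m → ℝ}
    (h : Rep s .y d z.2 S) (h0 : ∀ i, 0 < z.2 i) (h1 : ∑ i, z.2 i = 1) :
    Coupled (drawFrom (probX A z)) (gradX.run A s) fun ij s' =>
      s'.nat (.col .x) = ij.2 ∧
      s'.real (.step .x) =
        clipReal (s.real .eta * (A ij.1 ij.2 * z.2 ij.1 / probX A z ij)) ∧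
      Frame [.node, .l, .bit, .row .x, .col .x] [.w₁, .w₂, .prob, .step .x] [] s s' ∧
      s'.steps ≤ s.steps + 100 + 30 * d := by
  rw [probX_eq_bind hA h0 h1]
  simp only [gradX, run_cons]
  refine (sample_spec A h h0 h1 (v := .row .x) (by simp)).bind ?_
  rintro i - s1 ⟨hi, hF1, hs1⟩
  have hc : Coupled (drawFrom fun j => A i j ^ 2 / rowNorm A i ^ 2)
      ((Cmd.drawCol (.col .x) (NReg.row .x)).run A s1)
      fun j s2 => s2 = (s1.setN (.col .x) j).tick 2 := by
    rw [Cmd.run, dif_pos (by simp [hi])]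
    have e : (⟨NExpr.eval s1 (NReg.row .x), hi.trans_lt i.2⟩ : Fin m) = i := Fin.ext hi
    simp only [e]
    have hval : Coupled (drawFrom fun j => A i j ^ 2 / rowNorm A i ^ 2)
        ((drawFrom fun j => A i j ^ 2 / rowNorm A i ^ 2).map Fin.val) fun j k => k = (j : ℕ) :=
      (Coupled.refl _).map_right fun j _ k e => congrArg _ e.symm
    exact hval.map_right fun j _ k e => congrArg (fun k => (s1.setN (.col .x) k).tick 2) e
  refine Coupled.bind hc ?_
  rintro j - _ rfl
  set s2 := (s1.setN (.col .x) j).tick 2 with hs2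
  have hF2 : Frame [.node, .l, .bit, .row .x, .col .x] [.w₁, .w₂, .prob, .step .x] [] s s2 :=
    ((hF1.mono (by simp) (by simp) (by simp)).setN (by simp) _).tick _
  have hi2 : s2.nat (.row .x) = i := by simp [hs2, hi]
  have hj2 : s2.nat (.col .x) = j := by simp [hs2]
  have hR2 : Rep s2 .y d z.2 S := h.frame hF2 (by simp) (by simp) (by simp)
  simp only [run_cons]
  refine (setR_spec A _ _).coupled_bind ?_
  rintro s3 ⟨hp, hG3, hs3⟩
  have hF3 := hF2.trans (hG3.mono (by simp) (by simp) (by simp))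
  have hi3 : s3.nat (.row .x) = i := (hG3.nat _ (by simp)).trans hi2
  have hj3 : s3.nat (.col .x) = j := (hG3.nat _ (by simp)).trans hj2
  have hR3 : Rep s3 .y d z.2 S := h.frame hF3 (by simp) (by simp) (by simp)
  have hη : s3.real .eta = s.real .eta := hF3.real _ (by simp)
  simp only [RExpr.eval_mul, RExpr.eval_div, get_eval A hR2 hi2,
    RExpr.eval_entry s2 (NReg.row .x) (NReg.col .x) A i j hi2 hj2,
    RExpr.eval_rowNorm s2 (NReg.row .x) A i hi2, ← sq] at hp
  refine (setR_spec A _ _).coupled_bind ?_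
  rintro s4 ⟨hg, hG4, hs4⟩
  simp only [RExpr.eval_mul, RExpr.eval_div, get_eval A hR3 hi3, RExpr.eval_reg, hη, hp,
    RExpr.eval_entry s3 (NReg.row .x) (NReg.col .x) A i j hi3 hj3] at hg
  have hF4 := hF3.trans (hG4.mono (by simp) (by simp) (by simp))
  refine (clipReg_spec A _).coupled_bind ?_
  rintro s5 ⟨hv, hG5, hs5⟩
  rw [hg] at hv
  have hF5 := hF4.trans (hG5.mono (by simp) (by simp) (by simp))
  refine Coupled.pure (a := (i, j)) ⟨?_, hv, hF5, ?_⟩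
  · exact (hG5.nat _ (by simp)).trans ((hG4.nat _ (by simp)).trans hj3)
  · simp [IM.get] at hs3 hs4
    simp [hs2] at hs3
    omega

theorem gradY_spec (hA : ∀ j, ∃ i, A i j ≠ 0) {z : Pt m n} {S : Fin n → ℝ}
    (h : Rep s .x d z.1 S) (h0 : ∀ j, 0 < z.1 j) (h1 : ∑ j, z.1 j = 1) :
    Coupled (drawFrom (probY A z)) (gradY.run A s) fun ij s' =>
      s'.nat (.row .y) = ij.1 ∧
      s'.real (.step .y) =
        clipReal (s.real .eta * (-A ij.1 ij.2 * z.1 ij.2 / probY A z ij)) ∧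
      Frame [.node, .l, .bit, .col .y, .row .y] [.w₁, .w₂, .prob, .step .y] [] s s' ∧
      s'.steps ≤ s.steps + 100 + 30 * d := by
  rw [probY_eq_bind hA h0 h1]
  simp only [gradY, run_cons]
  refine (sample_spec A h h0 h1 (v := .col .y) (by simp)).bind ?_
  rintro j - s1 ⟨hi, hF1, hs1⟩
  have hc : Coupled (drawFrom fun i => A i j ^ 2 / colNorm A j ^ 2)
      ((Cmd.drawRow (.row .y) (NReg.col .y)).run A s1)
      fun i s2 => s2 = (s1.setN (.row .y) i).tick 2 := by
    rw [Cmd.run, dif_pos (by simp [hi])]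
    have e : (⟨NExpr.eval s1 (NReg.col .y), hi.trans_lt j.2⟩ : Fin n) = j := Fin.ext hi
    simp only [e]
    have hval : Coupled (drawFrom fun i => A i j ^ 2 / colNorm A j ^ 2)
        ((drawFrom fun i => A i j ^ 2 / colNorm A j ^ 2).map Fin.val) fun i k => k = (i : ℕ) :=
      (Coupled.refl _).map_right fun i _ k e => congrArg _ e.symm
    exact hval.map_right fun i _ k e => congrArg (fun k => (s1.setN (.row .y) k).tick 2) e
  refine Coupled.bind hc ?_
  rintro i - _ rfl
  set s2 := (s1.setN (.row .y) i).tick 2 with hs2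
  have hF2 : Frame [.node, .l, .bit, .col .y, .row .y] [.w₁, .w₂, .prob, .step .y] [] s s2 :=
    ((hF1.mono (by simp) (by simp) (by simp)).setN (by simp) _).tick _
  have hi2 : s2.nat (.col .y) = j := by simp [hs2, hi]
  have hj2 : s2.nat (.row .y) = i := by simp [hs2]
  have hR2 : Rep s2 .x d z.1 S := h.frame hF2 (by simp) (by simp) (by simp)
  simp only [run_cons]
  refine (setR_spec A _ _).coupled_bind ?_
  rintro s3 ⟨hp, hG3, hs3⟩
  have hF3 := hF2.trans (hG3.mono (by simp) (by simp) (by simp))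
  have hi3 : s3.nat (.col .y) = j := (hG3.nat _ (by simp)).trans hi2
  have hj3 : s3.nat (.row .y) = i := (hG3.nat _ (by simp)).trans hj2
  have hR3 : Rep s3 .x d z.1 S := h.frame hF3 (by simp) (by simp) (by simp)
  have hη : s3.real .eta = s.real .eta := hF3.real _ (by simp)
  simp only [RExpr.eval_mul, RExpr.eval_div, get_eval A hR2 hi2,
    RExpr.eval_entry s2 (NReg.row .y) (NReg.col .y) A i j hj2 hi2,
    RExpr.eval_colNorm s2 (NReg.col .y) A j hi2, ← sq] at hp
  refine (setR_spec A _ _).coupled_bind ?_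
  rintro s4 ⟨hg, hG4, hs4⟩
  simp only [RExpr.eval_mul, RExpr.eval_div, get_eval A hR3 hi3, RExpr.eval_reg, hη, hp, RExpr.eval_sub,
    RExpr.eval_lit, Nat.cast_zero, zero_sub,
    RExpr.eval_entry s3 (NReg.row .y) (NReg.col .y) A i j hj3 hi3] at hg
  have hF4 := hF3.trans (hG4.mono (by simp) (by simp) (by simp))
  refine (clipReg_spec A _).coupled_bind ?_
  rintro s5 ⟨hv, hG5, hs5⟩
  rw [hg] at hv
  have hF5 := hF4.trans (hG5.mono (by simp) (by simp) (by simp))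
  refine Coupled.pure (a := (i, j)) ⟨?_, hv, hF5, ?_⟩
  · exact (hG5.nat _ (by simp)).trans ((hG4.nat _ (by simp)).trans hj3)
  · simp [IM.get] at hs3 hs4
    simp [hs2] at hs3
    omega

end Gradients

/-! ### Initialization of the data structure and computation of the parameters. -/

section Init

variable {m n : ℕ} [NeZero m] [NeZero n] (A : Matrix (Fin m) (Fin n) ℝ)
  {N : ℕ} {s : State} {b : Blk}

theorem forN_det {v : NReg} {a : NExpr} {c : Cmd} {K : ℕ} (hK : a.eval s = K)
    (I : ℕ → State → Prop) (h0 : I 0 (s.tick (a.cost + 2)))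
    (hs : ∀ k < K, ∀ s', I k s' → Det (c.run A ((s'.setN v k).tick 2)) (I (k + 1))) :
    Det ((Cmd.forN v a c).run A s) (I K) := by
  rw [run_forN, hK]
  exact iter_det I h0 K hs

theorem capLoop_spec (hN : 1 ≤ N) (hdim : s.nat (.dim b) = N) (hcap : s.nat (.cap b) = 1)
    (hdepth : s.nat (.depth b) = 0) :
    Det ((Cmd.forN .k (NReg.dim b) (.ite (.ltN (NReg.cap b) (NReg.dim b))
      (block [.setN (.cap b) (NReg.cap b + NReg.cap b), .setN (.depth b) (NReg.depth b + 1)])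
      .skip)).run A s) fun s' => ∃ d, s'.nat (.cap b) = 2 ^ d ∧ s'.nat (.depth b) = d ∧
        N ≤ 2 ^ d ∧ 2 ^ d < 2 * N ∧ Frame [.cap b, .depth b, .k] [] [] s s' ∧
        s'.steps ≤ s.steps + 3 + 20 * N := by
  -- Until the capacity reaches `N` it doubles in every pass and so exceeds the pass count `k`;
  -- hence `N` passes suffice. Doubling happens only below `N`, which keeps the capacity under `2 *
  -- N`.
  refine (forN_det A (K := N) (by simpa using hdim) (fun k s' => ∃ d, s'.nat (.cap b) = 2 ^ d ∧
    s'.nat (.depth b) = d ∧ (N ≤ 2 ^ d ∨ k < 2 ^ d) ∧ 2 ^ d < 2 * N ∧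
    Frame [.cap b, .depth b, .k] [] [] s s' ∧ s'.steps ≤ s.steps + 3 + 20 * k) ?_ ?_).mono ?_
  · exact ⟨0, by simpa using hcap, by simpa using hdepth, by simp, by omega, Frame.refl.tick _,
      by simp⟩
  · rintro k - s' ⟨d, h1, h2, h3, h4, h5, h6⟩
    have hdim' : s'.nat (.dim b) = N := (h5.nat _ (by simp)).trans hdim
    by_cases h : 2 ^ d < N
    · rw [run_ite_pos _ _ _ _ _ (by simpa [h1, hdim'] using h)]
      simp only [run_cons, run_setN, PMF.pure_bind, run_nil]
      refine Det.pure ⟨d + 1, ?_, ?_, ?_, ?_, ?_, ?_⟩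
      · simp [h1, pow_succ]
        ring
      · simp [h2]
      · have : 2 ^ (d + 1) = 2 * 2 ^ d := pow_succ' _ _
        omega
      · have : 2 ^ (d + 1) = 2 * 2 ^ d := pow_succ' _ _
        omega
      · exact h5.setN (by simp) _ |>.tick _ |>.tick _ |>.setN (by simp) _ |>.tick _
          |>.setN (by simp) _ |>.tick _
      · simp
        omega
    · rw [run_ite_neg _ _ _ _ _ (by simpa [h1, hdim'] using h)]
      simp only [run_skip]
      refine Det.pure ⟨d, ?_, ?_, Or.inl (not_lt.1 h), h4, ?_, ?_⟩
      · simp [h1]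
      · simp [h2]
      · exact h5.setN (by simp) _ |>.tick _ |>.tick _
      · simp
        omega
  · rintro s' ⟨d, h1, h2, h3, h4, h5, h6⟩
    exact ⟨d, h1, h2, by omega, h4, h5, h6⟩

theorem fillLoop_spec (hdim : s.nat (.dim b) = N) (hnu : s.real (.nu b) = 0) :
    Det ((Cmd.forN .k (NReg.dim b) (block [
      .store (.u b) NReg.k (1 / .ofNat (NReg.dim b)),
      .store (.u' b) NReg.k 0,
      .setR (.nu b) (RReg.nu b + .read (.u b) NReg.k)])).run A s) fun s' =>
        (∀ j < N, s'.mem (.u b) j = 1 / N) ∧ (∀ j < N, s'.mem (.u' b) j = 0) ∧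
        s'.real (.nu b) = N * (1 / N : ℝ) ∧
        Frame [.k] [.nu b] [.u b, .u' b] s s' ∧ s'.steps ≤ s.steps + 3 + 20 * N := by
  refine forN_det A (K := N) (by simpa using hdim) (fun k s' =>
        (∀ j < k, s'.mem (.u b) j = 1 / N) ∧ (∀ j < k, s'.mem (.u' b) j = 0) ∧
        s'.real (.nu b) = k * (1 / N : ℝ) ∧
        Frame [.k] [.nu b] [.u b, .u' b] s s' ∧ s'.steps ≤ s.steps + 3 + 20 * k) ?_ ?_
  · exact ⟨by simp, by simp, by simp [hnu], Frame.refl.tick _, by simp⟩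
  · rintro k - s' ⟨h1, h2, h3, h4, h5⟩
    have hdim' : s'.nat (.dim b) = N := (h4.nat _ (by simp)).trans hdim
    simp only [run_cons, run_setR, run_store, PMF.pure_bind, run_nil]
    refine Det.pure ⟨?_, ?_, ?_, ?_, ?_⟩
    · intro j hj
      by_cases e : j = k
      · simp [e, hdim']
      · simp [Function.update_of_ne e, h1 j (by omega)]
    · intro j hj
      by_cases e : j = k
      · simp [e]
      · simp [Function.update_of_ne e, h2 j (by omega)]
    · simp [hdim', h3]
      ring
    · exact h4.setN (by simp) _ |>.tick _ |>.store (by simp) _ _ |>.tick _ |>.store (by simp) _ _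
        |>.tick _ |>.setR (by simp) _ |>.tick _
    · simp
      omega

theorem zeroLoop_spec {C : ℕ} (hcap : s.nat (.cap b) = C) :
    Det ((Cmd.forN .k (NReg.cap b) (.store (.tree b) (NReg.cap b + NReg.k) 0)).run A s) fun s' =>
        (∀ j < C, s'.mem (.tree b) (C + j) = 0) ∧
        Frame [.k] [] [.tree b] s s' ∧ s'.steps ≤ s.steps + 3 + 20 * C := by
  refine forN_det A (K := C) (by simpa using hcap) (fun k s' =>
        (∀ j < k, s'.mem (.tree b) (C + j) = 0) ∧
        Frame [.k] [] [.tree b] s s' ∧ s'.steps ≤ s.steps + 3 + 20 * k) ?_ ?_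
  · exact ⟨by simp, Frame.refl.tick _, by simp⟩
  · rintro k - s' ⟨h1, h4, h5⟩
    have hcap' : s'.nat (.cap b) = C := (h4.nat _ (by simp)).trans hcap
    simp only [run_store]
    refine Det.pure ⟨?_, ?_, ?_⟩
    · intro j hj
      by_cases e : j = k
      · simp [e, hcap']
      · have e' : C + j ≠ C + k := by omega
        simp [hcap', Function.update_of_ne e', h1 j (by omega)]
    · exact h4.setN (by simp) _ |>.tick _ |>.store (by simp) _ _ |>.tick _
    · simp
      omega

theorem leafLoop_spec {C : ℕ} (hcap : s.nat (.cap b) = C) (hdim : s.nat (.dim b) = N) :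
    Det ((Cmd.forN .k (NReg.dim b)
      (.store (.tree b) (NReg.cap b + NReg.k) (.read (.u b) NReg.k))).run A s) fun s' =>
        (∀ j < N, s'.mem (.tree b) (C + j) = s.mem (.u b) j) ∧
        (∀ j, N ≤ j → s'.mem (.tree b) (C + j) = s.mem (.tree b) (C + j)) ∧
        Frame [.k] [] [.tree b] s s' ∧ s'.steps ≤ s.steps + 3 + 20 * N := by
  refine forN_det A (K := N) (by simpa using hdim) (fun k s' =>
        (∀ j < k, s'.mem (.tree b) (C + j) = s.mem (.u b) j) ∧
        (∀ j, k ≤ j → s'.mem (.tree b) (C + j) = s.mem (.tree b) (C + j)) ∧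
        Frame [.k] [] [.tree b] s s' ∧ s'.steps ≤ s.steps + 3 + 20 * k) ?_ ?_
  · exact ⟨by simp, by simp, Frame.refl.tick _, by simp⟩
  · rintro k - s' ⟨h1, h2, h4, h5⟩
    have hcap' : s'.nat (.cap b) = C := (h4.nat _ (by simp)).trans hcap
    have hu : s'.mem (.u b) = s.mem (.u b) := h4.mem _ (by simp)
    simp only [run_store]
    refine Det.pure ⟨?_, ?_, ?_, ?_⟩
    · intro j hj
      by_cases e : j = k
      · simp [e, hcap', hu]
      · have e' : C + j ≠ C + k := by omega
        simp [hcap', Function.update_of_ne e', h1 j (by omega)]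
    · intro j hj
      have e' : C + j ≠ C + k := by omega
      simp [hcap', Function.update_of_ne e', h2 j (by omega)]
    · exact h4.setN (by simp) _ |>.tick _ |>.store (by simp) _ _ |>.tick _
    · simp
      omega

/-- Nodes are filled in decreasing order of index; the children of a node have larger indices and
are therefore final when they are read. -/
theorem buildLoop_spec {C : ℕ} (hcap : s.nat (.cap b) = C) :
    Det ((Cmd.forN .k (NReg.cap b - 1) (block [
      .setN .node (NReg.cap b - 1 - NReg.k),
      .store (.tree b) NReg.node (.read (.tree b) (NReg.node + NReg.node) +
        .read (.tree b) (NReg.node + NReg.node + 1))])).run A s) fun s' =>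
        (∀ i, 1 ≤ i → i < C →
          s'.mem (.tree b) i = s'.mem (.tree b) (i + i) + s'.mem (.tree b) (i + i + 1)) ∧
        (∀ i, C ≤ i → s'.mem (.tree b) i = s.mem (.tree b) i) ∧
        Frame [.k, .node] [] [.tree b] s s' ∧ s'.steps ≤ s.steps + 5 + 30 * C := by
  refine (forN_det A (K := C - 1) (by simp [hcap]) (fun k s' =>
        (∀ i, C - k ≤ i → 1 ≤ i → i < C →
          s'.mem (.tree b) i = s'.mem (.tree b) (i + i) + s'.mem (.tree b) (i + i + 1)) ∧
        (∀ i, C ≤ i → s'.mem (.tree b) i = s.mem (.tree b) i) ∧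
        Frame [.k, .node] [] [.tree b] s s' ∧ s'.steps ≤ s.steps + 5 + 30 * k) ?_ ?_).mono ?_
  · exact ⟨fun i h1 h2 h3 => by omega, by simp, Frame.refl.tick _, by simp⟩
  · rintro k hk s' ⟨h1, h2, h4, h5⟩
    have hcap' : s'.nat (.cap b) = C := (h4.nat _ (by simp)).trans hcap
    simp only [run_cons, run_setN, run_store, PMF.pure_bind, run_nil]
    obtain ⟨r, hr⟩ : ∃ r, C - 1 - k = r := ⟨_, rfl⟩
    refine Det.pure ⟨?_, ?_, ?_, ?_⟩
    · intro i hi1 hi2 hi3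
      have e1 : i + i ≠ r := by omega
      have e2 : i + i + 1 ≠ r := by omega
      by_cases e : i = r
      · subst e
        simp [hcap', hr, Function.update_of_ne e1, Function.update_of_ne e2]
      · simp [hcap', hr, Function.update_of_ne e, Function.update_of_ne e1,
          Function.update_of_ne e2]
        exact h1 i (by omega) hi2 hi3
    · intro i hi
      have e : i ≠ r := by omega
      simp [hcap', hr, Function.update_of_ne e, h2 i hi]
    · exact h4.setN (by simp) _ |>.tick _ |>.setN (by simp) _ |>.tick _ |>.store (by simp) _ _
        |>.tick _
    · simp
      omega
  · rintro s' ⟨h1, h2, h4, h5⟩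
    exact ⟨fun i hi1 hi2 => h1 i (by omega) hi1 hi2, h2, h4, by omega⟩

theorem init_spec [NeZero N] (hdim : s.nat (.dim b) = N) :
    Det ((IM.init b (1 / .ofNat (NReg.dim b))).run A s) fun s' =>
      (∃ d, Rep s' b d (fun _ : Fin N => 1 / (N : ℝ)) 0 ∧ 2 ^ d < 2 * N) ∧
      Frame [.cap b, .depth b, .k, .node] [.xi b, .sigma b, .nu b] [.u b, .u' b, .tree b] s s' ∧
      s'.steps ≤ s.steps + 50 + 200 * N := by
  have hN : 1 ≤ N := NeZero.one_le
  simp only [IM.init, run_cons, run_setN, PMF.pure_bind]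
  refine (capLoop_spec A hN (by simpa using hdim) (by simp) (by simp)).bind ?_
  rintro s1 ⟨d, hc1, hd1, hle, hlt, hF1, hs1⟩
  simp only [run_cons, run_setR, PMF.pure_bind]
  have hdim1 : s1.nat (.dim b) = N := (hF1.nat _ (by simp)).trans (by simpa using hdim)
  refine (fillLoop_spec A (N := N) (by simpa using hdim1) (by simp)).bind ?_
  rintro s2 ⟨hu2, hu2', hnu2, hF2, hs2⟩
  have hdim2 : s2.nat (.dim b) = N := (hF2.nat _ (by simp)).trans (by simpa using hdim1)
  have hc2 : s2.nat (.cap b) = 2 ^ d := (hF2.nat _ (by simp)).trans (by simpa using hc1)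
  have hd2 : s2.nat (.depth b) = d := (hF2.nat _ (by simp)).trans (by simpa using hd1)
  have hx2 : s2.real (.xi b) = 1 := (hF2.real _ (by simp)).trans (by simp)
  have hσ2 : s2.real (.sigma b) = 0 := (hF2.real _ (by simp)).trans (by simp)
  refine (zeroLoop_spec A hc2).bind ?_
  rintro s3 ⟨ht3, hF3, hs3⟩
  refine (leafLoop_spec A (N := N) ((hF3.nat _ (by simp)).trans hc2)
    ((hF3.nat _ (by simp)).trans hdim2)).bind ?_
  rintro s4 ⟨hl4, ht4, hF4, hs4⟩
  replace hF4 := hF3.trans hF4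
  refine (buildLoop_spec A ((hF4.nat _ (by simp)).trans hc2)).bind ?_
  rintro s5 ⟨hn5, ht5, hF5, hs5⟩
  have hG : Frame [.k, .node] [] [.tree b] s2 s5 :=
    (hF4.mono (by simp) (by simp) (by simp)).trans hF5
  refine Det.pure ⟨⟨d, ?_, hlt⟩, ?_, ?_⟩
  · constructor
    · rw [hG.nat _ (by simp), hdim2]
    · rw [hG.nat _ (by simp), hc2]
    · rw [hG.nat _ (by simp), hd2]
    · exact hle
    · rw [hG.real _ (by simp), hx2]
      exact one_pos
    · intro j
      rw [hG.real _ (by simp), hx2, hG.mem _ (by simp), hu2 j j.2, one_mul]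
    · intro j
      rw [hG.real _ (by simp), hσ2, hG.mem _ (by simp), hu2' j j.2]
      simp
    · rw [hG.real _ (by simp), hnu2]
      simp
    · intro j
      rw [ht5 _ (by omega), hl4 j j.2, hG.mem _ (by simp), hF3.mem _ (by simp)]
    · intro j hj1 hj2
      rw [ht5 _ (by omega), ht4 j hj1, ht3 j hj2]
    · exact hn5
  · refine Frame.trans ?_ (hG.mono (by simp) (by simp) (by simp))
    refine Frame.trans ?_ (hF2.mono (by simp) (by simp) (by simp))
    refine (Frame.trans ?_ (hF1.mono (by simp) (by simp) (by simp))).setR (by simp) _ |>.tick _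
      |>.setR (by simp) _ |>.tick _ |>.setR (by simp) _ |>.tick _
    exact (Frame.refl.setN (by simp) _).tick _ |>.setN (by simp) _ |>.tick _
  · simp at hs1 hs2
    omega

end Init

section Parameters

variable {m n : ℕ} {A : Matrix (Fin m) (Fin n) ℝ}

theorem rowNorm_nonneg (i : Fin m) : 0 ≤ rowNorm A i := Real.sqrt_nonneg _

theorem colNorm_nonneg (j : Fin n) : 0 ≤ colNorm A j := Real.sqrt_nonneg _

theorem rowNorm_le_Lco (i : Fin m) : rowNorm A i ≤ Lco A :=
  (le_ciSup (Set.finite_range _).bddAbove i).trans (le_max_left _ _)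

theorem colNorm_le_Lco (j : Fin n) : colNorm A j ≤ Lco A :=
  (le_ciSup (Set.finite_range _).bddAbove j).trans (le_max_right _ _)

theorem Lco_le [NeZero m] [NeZero n] {c : ℝ} (hr : ∀ i, rowNorm A i ≤ c)
    (hc : ∀ j, colNorm A j ≤ c) : Lco A ≤ c :=
  max_le (ciSup_le hr) (ciSup_le hc)

theorem Lco_nonneg [NeZero m] : 0 ≤ Lco A := (rowNorm_nonneg 0).trans (rowNorm_le_Lco 0)

theorem Lco_pos [NeZero m] (hA : ∀ i, ∃ j, A i j ≠ 0) : 0 < Lco A := by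
  refine lt_of_lt_of_le ?_ (rowNorm_le_Lco (0 : Fin m))
  exact lt_of_le_of_ne (rowNorm_nonneg _) fun h => by simpa [← h] using rowNorm_sq_pos hA 0

variable [NeZero m] [NeZero n] {s : State}

/-- A loop that computes the maximum of a register and finitely many values. -/
theorem maxLoop_spec {N : ℕ} {a : NExpr} (e : RExpr) (f : Fin N → ℝ)
    (hN : a.eval s = N)
    (he : ∀ s' (i : Fin N), s'.nat .k = (i : ℕ) → e.eval A s' = f i) {c : ℝ} (h0 : s.real .lco ≤ c)
    (hf : ∀ i, f i ≤ c) :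
    Det ((Cmd.forN .k a (.ite (.ltR RReg.lco e) (.setR .lco e) .skip)).run A s) fun s' =>
      s.real .lco ≤ s'.real .lco ∧ (∀ i, f i ≤ s'.real .lco) ∧ s'.real .lco ≤ c ∧
      Frame [.k] [.lco] [] s s' ∧ s'.steps ≤ s.steps + a.cost + 2 + (10 + 2 * e.cost) * N := by
  refine (forN_det A (K := N) hN (fun k s' =>
      s.real .lco ≤ s'.real .lco ∧ (∀ i : Fin N, (i : ℕ) < k → f i ≤ s'.real .lco) ∧
      s'.real .lco ≤ c ∧ Frame [.k] [.lco] [] s s' ∧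
      s'.steps ≤ s.steps + a.cost + 2 + (10 + 2 * e.cost) * k) ?_ ?_).mono ?_
  · exact ⟨by simp, by simp, by simpa using h0, Frame.refl.tick _, by simp [add_assoc]⟩
  · rintro k hk s' ⟨h1, h2, h3, h4, h5⟩
    have hv : ∀ q, e.eval A (((s'.setN .k k).tick 2).tick q) = f ⟨k, hk⟩ :=
      fun q => he _ ⟨k, hk⟩ (by simp)
    have hv0 : e.eval A ((s'.setN .k k).tick 2) = f ⟨k, hk⟩ := he _ ⟨k, hk⟩ (by simp)
    by_cases h : s'.real .lco < f ⟨k, hk⟩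
    · rw [run_ite_pos _ _ _ _ _ (by simpa [hv0] using h), run_setR, hv]
      refine Det.pure ⟨?_, ?_, ?_, ?_, ?_⟩
      · simpa using h1.trans h.le
      · intro i hi
        rcases Nat.lt_succ_iff_lt_or_eq.1 hi with hi | hi
        · simpa using (h2 i hi).trans h.le
        · obtain rfl : i = ⟨k, hk⟩ := Fin.ext hi
          simp
      · simpa using hf _
      · exact h4.setN (by simp) _ |>.tick _ |>.tick _ |>.setR (by simp) _ |>.tick _
      · simp
        linarith
    · rw [run_ite_neg _ _ _ _ _ (by simpa [hv0] using h), run_skip]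
      refine Det.pure ⟨?_, ?_, ?_, ?_, ?_⟩
      · simpa using h1
      · intro i hi
        rcases Nat.lt_succ_iff_lt_or_eq.1 hi with hi | hi
        · simpa using h2 i hi
        · obtain rfl : i = ⟨k, hk⟩ := Fin.ext hi
          simpa using h
      · simpa using h3
      · exact h4.setN (by simp) _ |>.tick _ |>.tick _
      · simp
        linarith
  · rintro s' ⟨h1, h2, h3, h4, h5⟩
    exact ⟨h1, fun i => h2 i i.2, h3, h4, h5⟩

theorem setParams_spec (hm : s.nat (.dim .y) = m) (hn : s.nat (.dim .x) = n) :
    Det (setParams.run A s) fun s' => s'.real .eta = s.real .eps / (18 * Lco A ^ 2) ∧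
      Frame [.k] [.lco, .eta] [] s s' ∧ s'.steps ≤ s.steps + 50 + 20 * m + 20 * n := by
  simp only [setParams, run_cons, run_setR, PMF.pure_bind]
  refine (maxLoop_spec _ (rowNorm A) (by simpa using hm)
    (fun s' i h => RExpr.eval_rowNorm s' NReg.k A i h) (by simpa using Lco_nonneg)
    rowNorm_le_Lco).bind ?_
  rintro s1 ⟨h1, hr1, hc1, hF1, hs1⟩
  refine (maxLoop_spec _ (colNorm A)
    (by simpa [hF1.nat (.dim .x) (by simp)] using hn)
    (fun s' i h => RExpr.eval_colNorm s' NReg.k A i h) hc1 colNorm_le_Lco).bind ?_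
  rintro s2 ⟨h2, hr2, hc2, hF2, hs2⟩
  -- The register dominates all norms but never exceeds `Lco A`, the upper bound `c` carried through
  -- both loops.
  have hL : s2.real .lco = Lco A :=
    le_antisymm hc2 (Lco_le (fun i => (hr1 i).trans h2) hr2)
  simp only [run_cons, run_setR, PMF.pure_bind, run_nil]
  have hε : s2.real .eps = s.real .eps := by
    rw [hF2.real _ (by simp), hF1.real _ (by simp)]
    simp
  refine Det.pure ⟨?_, ?_, ?_⟩
  · simp [hL, hε, sq]
  · refine Frame.tick (Frame.setR ?_ (by simp) _) _
    refine Frame.trans ?_ (hF2.mono (by simp) (by simp) (by simp))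
    exact Frame.trans ((Frame.refl.setR (by simp) _).tick _)
      (hF1.mono (by simp) (by simp) (by simp))
  · simp at hs1 hs2 ⊢
    omega

end Parameters

/-! ### Relative entropy and the closed form of the mirror step. -/

section Gibbs

variable {ι : Type} [Fintype ι]

/-- This is `log t < t - 1` at `t = b / a ≠ 1`, multiplied by `a`. Strictness is what makes
minimizers unique. -/
theorem sub_lt_mul_log_sub {a b : ℝ} (ha : 0 ≤ a) (hb : 0 < b) (hab : a ≠ b) :
    a - b < a * Real.log a - a * Real.log b := by
  rcases ha.eq_or_lt with rfl | ha
  · simpa using hb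
  · have h := Real.log_lt_sub_one_of_pos (div_pos hb ha) fun h => hab ((div_eq_one_iff_eq ha.ne').1 h).symm
    rw [Real.log_div hb.ne' ha.ne'] at h
    have := mul_lt_mul_of_pos_left h ha
    have e : a * (b / a - 1) = b - a := by
      field_simp
    linarith

/-- The Kullback-Leibler divergence of `u` from `v`. -/
noncomputable def relEntropy (u v : ι → ℝ) : ℝ :=
  ∑ j, (u j * Real.log (u j) - u j * Real.log (v j))

theorem relEntropy_pos {u v : ι → ℝ} (hu : u ∈ stdSimplex ℝ ι) (hv : ∀ j, 0 < v j)
    (hv1 : ∑ j, v j = 1) (huv : u ≠ v) : 0 < relEntropy u v := by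
  obtain ⟨j, hj⟩ := Function.ne_iff.1 huv
  have h : ∑ j, (u j - v j) < relEntropy u v := by
    refine Finset.sum_lt_sum (fun k _ => ?_) ⟨j, Finset.mem_univ _,
      sub_lt_mul_log_sub (hu.1 j) (hv j) hj⟩
    by_cases hk : u k = v k
    · simp [hk]
    · exact (sub_lt_mul_log_sub (hu.1 k) (hv k) hk).le
  rwa [Finset.sum_sub_distrib, hu.2, hv1, sub_self] at h

theorem relEntropy_nonneg {u v : ι → ℝ} (hu : u ∈ stdSimplex ℝ ι) (hv : ∀ j, 0 < v j)
    (hv1 : ∑ j, v j = 1) : 0 ≤ relEntropy u v := by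
  by_cases h : u = v
  · simp [h, relEntropy]
  · exact (relEntropy_pos hu hv hv1 h).le

theorem reweight_pos [Nonempty ι] {x : ι → ℝ} (hx : ∀ j, 0 < x j) (δ : ι → ℝ) (k : ι) :
    0 < reweight x δ k :=
  div_pos (mul_pos (hx k) (Real.exp_pos _))
    (Finset.sum_pos (fun l _ => mul_pos (hx l) (Real.exp_pos _)) Finset.univ_nonempty)

theorem sum_reweight [Nonempty ι] {x : ι → ℝ} (hx : ∀ j, 0 < x j) (δ : ι → ℝ) :
    ∑ k, reweight x δ k = 1 := by
  unfold reweight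
  rw [← Finset.sum_div, div_self]
  exact (Finset.sum_pos (fun l _ => mul_pos (hx l) (Real.exp_pos _)) Finset.univ_nonempty).ne'

/-- Identifies the mirror step objective with a relative entropy: the log-partition term does not
depend on `u`. -/
theorem relEntropy_reweight [Nonempty ι] {u x : ι → ℝ} (hu : ∑ j, u j = 1) (hx : ∀ j, 0 < x j)
    (δ : ι → ℝ) : relEntropy u (reweight x δ) =
      relEntropy u x + ∑ j, δ j * u j + Real.log (∑ l, x l * Real.exp (-δ l)) := by
  have hZ : 0 < ∑ l, x l * Real.exp (-δ l) :=
    Finset.sum_pos (fun l _ => mul_pos (hx l) (Real.exp_pos _)) Finset.univ_nonempty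
  have h : ∀ j, Real.log (reweight x δ j) =
      Real.log (x j) - δ j - Real.log (∑ l, x l * Real.exp (-δ l)) := by
    intro j
    rw [reweight, Real.log_div (mul_pos (hx j) (Real.exp_pos _)).ne' hZ.ne',
      Real.log_mul (hx j).ne' (Real.exp_pos _).ne', Real.log_exp]
    ring
  simp only [relEntropy, h]
  conv_rhs => rw [← one_mul (Real.log _), ← hu, Finset.sum_mul, ← Finset.sum_add_distrib,
    ← Finset.sum_add_distrib]
  exact Finset.sum_congr rfl fun j _ => by ring

end Gibbs

section Mirror

variable {m n : ℕ}

/-- The relative interior of the domain. -/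
structure PosDom (z : Pt m n) : Prop where
  pos₁ : ∀ j, 0 < z.1 j
  pos₂ : ∀ i, 0 < z.2 i
  sum₁ : ∑ j, z.1 j = 1
  sum₂ : ∑ i, z.2 i = 1

theorem PosDom.mem_dom {z : Pt m n} (h : PosDom z) : z ∈ dom m n :=
  ⟨⟨fun j => (h.pos₁ j).le, h.sum₁⟩, ⟨fun i => (h.pos₂ i).le, h.sum₂⟩⟩

/-- `argminDom` is an arbitrary choice among minimizers, so uniqueness is needed. A relative entropy
is nonnegative and vanishes only at `v`, in each block separately. -/
theorem argminDom_eq {F : Pt m n → ℝ} {v : Pt m n} (hv : PosDom v) {c : ℝ}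
    (hF : ∀ u ∈ dom m n, F u = relEntropy u.1 v.1 + relEntropy u.2 v.2 + c) : argminDom F = v := by
  have hFv : F v = c := by
    rw [hF v hv.mem_dom]
    simp [relEntropy]
  have hex : ∃ z, z ∈ dom m n ∧ ∀ u ∈ dom m n, F z ≤ F u := by
    refine ⟨v, hv.mem_dom, fun u hu => ?_⟩
    rw [hFv, hF u hu]
    have h1 := relEntropy_nonneg hu.1 hv.pos₁ hv.sum₁
    have h2 := relEntropy_nonneg hu.2 hv.pos₂ hv.sum₂
    linarith
  obtain ⟨h1, h2⟩ := Classical.epsilon_spec hex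
  change argminDom F ∈ dom m n at h1
  replace h2 : F (argminDom F) ≤ F v := h2 v hv.mem_dom
  rw [hFv, hF _ h1] at h2
  have k1 := relEntropy_nonneg h1.1 hv.pos₁ hv.sum₁
  have k2 := relEntropy_nonneg h1.2 hv.pos₂ hv.sum₂
  refine Prod.ext ?_ ?_
  · by_contra hne
    have := relEntropy_pos h1.1 hv.pos₁ hv.sum₁ hne
    linarith
  · by_contra hne
    have := relEntropy_pos h1.2 hv.pos₂ hv.sum₂ hne
    linarith

/-- The center of the domain. -/
noncomputable def center (m n : ℕ) : Pt m n := (fun _ => 1 / (n : ℝ), fun _ => 1 / (m : ℝ))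

theorem posDom_center [NeZero m] [NeZero n] : PosDom (center m n) := by
  have hm : (0 : ℝ) < m := Nat.cast_pos.2 (NeZero.pos m)
  have hn : (0 : ℝ) < n := Nat.cast_pos.2 (NeZero.pos n)
  constructor
  · exact fun _ => one_div_pos.2 hn
  · exact fun _ => one_div_pos.2 hm
  · simp [center, hn.ne']
  · simp [center, hm.ne']

theorem argminDom_negEntropy [NeZero m] [NeZero n] :
    argminDom (negEntropy : Pt m n → ℝ) = center m n := by
  refine argminDom_eq posDom_center (c := -Real.log n - Real.log m) fun u hu => ?_
  simp only [relEntropy, center, negEntropy, Finset.sum_sub_distrib, ← Finset.sum_mul, hu.1.2,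
    hu.2.2, one_div, Real.log_inv]
  ring

theorem fderiv_negEntropy {z : Pt m n} (h₁ : ∀ j, 0 < z.1 j) (h₂ : ∀ i, 0 < z.2 i) (v : Pt m n) :
    fderiv ℝ negEntropy z v =
      ∑ j, (Real.log (z.1 j) + 1) * v.1 j + ∑ i, (Real.log (z.2 i) + 1) * v.2 i := by
  have hx : ∀ j, HasFDerivAt (fun z : Pt m n => z.1 j * Real.log (z.1 j))
      ((Real.log (z.1 j) + 1) •
        ((ContinuousLinearMap.proj j).comp (ContinuousLinearMap.fst ℝ (Fin n → ℝ) (Fin m → ℝ)))) z :=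
    fun j => by
      have h := ((ContinuousLinearMap.proj j).comp
        (ContinuousLinearMap.fst ℝ (Fin n → ℝ) (Fin m → ℝ))).hasFDerivAt (x := z)
      exact (Real.hasDerivAt_mul_log (h₁ j).ne').comp_hasFDerivAt z h
  have hy : ∀ i, HasFDerivAt (fun z : Pt m n => z.2 i * Real.log (z.2 i))
      ((Real.log (z.2 i) + 1) •
        ((ContinuousLinearMap.proj i).comp (ContinuousLinearMap.snd ℝ (Fin n → ℝ) (Fin m → ℝ)))) z :=
    fun i => by
      have h := ((ContinuousLinearMap.proj i).comp
        (ContinuousLinearMap.snd ℝ (Fin n → ℝ) (Fin m → ℝ))).hasFDerivAt (x := z)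
      exact (Real.hasDerivAt_mul_log (h₂ i).ne').comp_hasFDerivAt z h
  have h := (HasFDerivAt.fun_sum (u := Finset.univ) fun j _ => hx j).add
    (HasFDerivAt.fun_sum (u := Finset.univ) fun i _ => hy i)
  have e : HasFDerivAt (negEntropy : Pt m n → ℝ) _ z := h
  rw [e.fderiv]
  simp [sum_apply]

/-- The constant `1` in the derivative of `t log t` drops out because `z` and `u` have equal block
sums. Positivity of `z` provides the derivative. -/
theorem bregman_eq {z u : Pt m n} (hz : PosDom z) (hu : u ∈ dom m n) :
    bregman z u = relEntropy u.1 z.1 + relEntropy u.2 z.2 := by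
  rw [bregman, fderiv_negEntropy hz.pos₁ hz.pos₂]
  simp only [relEntropy, negEntropy, Prod.fst_sub, Prod.snd_sub, Pi.sub_apply, mul_sub, add_mul,
    one_mul, Finset.sum_sub_distrib, Finset.sum_add_distrib, hz.sum₁, hz.sum₂, hu.1.2, hu.2.2]
  simp only [mul_comm (Real.log _)]
  ring

/-- The mirror descent step in closed form. -/
noncomputable def mirror (z γ : Pt m n) : Pt m n := (reweight z.1 γ.1, reweight z.2 γ.2)

theorem posDom_mirror [NeZero m] [NeZero n] {z : Pt m n} (hz : PosDom z) (γ : Pt m n) :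
    PosDom (mirror z γ) :=
  ⟨reweight_pos hz.pos₁ _, reweight_pos hz.pos₂ _, sum_reweight hz.pos₁ _, sum_reweight hz.pos₂ _⟩

theorem argminDom_step [NeZero m] [NeZero n] {z : Pt m n} (hz : PosDom z) (γ : Pt m n) :
    argminDom (fun u => pairing γ u + bregman z u) = mirror z γ := by
  refine argminDom_eq (posDom_mirror hz γ) (c := -Real.log (∑ l, z.1 l * Real.exp (-γ.1 l)) -
    Real.log (∑ l, z.2 l * Real.exp (-γ.2 l))) fun u hu => ?_
  rw [bregman_eq hz hu, mirror, relEntropy_reweight hu.1.2 hz.pos₁,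
    relEntropy_reweight hu.2.2 hz.pos₂]
  simp only [pairing, dotProduct]
  ring

/-- Clipping fixes `0`, so it keeps the estimate supported on one coordinate per block. -/
theorem clip_smul_single [NeZero m] [NeZero n] (η a b : ℝ) (j : Fin n) (i : Fin m) :
    clip (η • ((Pi.single j a, Pi.single i b) : Pt m n)) =
      (Pi.single j (clipReal (η * a)), Pi.single i (clipReal (η * b))) := by
  refine Prod.ext ?_ ?_
  · funext k
    by_cases h : k = j
    · subst h
      simp [clip, clipReal]
    · simp [clip, h]
  · funext k
    by_cases h : k = i
    · subst h
      simp [clip, clipReal]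
    · simp [clip, h]

/-- The clipped scaled gradient estimate, as a function of the sampled indices. -/
noncomputable def clipGrad (A : Matrix (Fin m) (Fin n) ℝ) (η : ℝ) (z : Pt m n)
    (p q : Fin m × Fin n) : Pt m n :=
  (Pi.single p.2 (clipReal (η * (A p.1 p.2 * z.2 p.1 / probX A z p))),
    Pi.single q.1 (clipReal (η * (-A q.1 q.2 * z.1 q.2 / probY A z q))))

/-- One step of stochastic mirror descent. -/
noncomputable def smdStep [NeZero m] [NeZero n] (A : Matrix (Fin m) (Fin n) ℝ) (η : ℝ)
    (zs : Pt m n × Pt m n) : PMF (Pt m n × Pt m n) :=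
  (gradEst A zs.1).bind fun g =>
    let z' := argminDom fun z => pairing (clip (η • g)) z + bregman zs.1 z
    PMF.pure (z', zs.2 + z')

theorem smd_succ [NeZero m] [NeZero n] (A : Matrix (Fin m) (Fin n) ℝ) (η : ℝ) (t : ℕ) :
    smd A η (t + 1) = (smd A η t).bind (smdStep A η) := rfl

theorem smdStep_eq [NeZero m] [NeZero n] (A : Matrix (Fin m) (Fin n) ℝ) (η : ℝ)
    {zs : Pt m n × Pt m n} (hz : PosDom zs.1) :
    smdStep A η zs = (drawFrom (probX A zs.1)).bind fun p => (drawFrom (probY A zs.1)).bind fun q =>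
      PMF.pure (mirror zs.1 (clipGrad A η zs.1 p q),
        zs.2 + mirror zs.1 (clipGrad A η zs.1 p q)) := by
  simp only [smdStep, gradEst, PMF.bind_bind, PMF.pure_bind, argminDom_step hz, clip_smul_single]
  rfl

end Mirror

section ScaledDom

variable {m n : ℕ}

/-- The sum of `c` points of the domain. -/
structure ScaledDom (c : ℝ) (S : Pt m n) : Prop where
  nonneg₁ : ∀ j, 0 ≤ S.1 j
  nonneg₂ : ∀ i, 0 ≤ S.2 i
  sum₁ : ∑ j, S.1 j = c
  sum₂ : ∑ i, S.2 i = c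

theorem ScaledDom.inv_smul_mem {c : ℝ} {S : Pt m n} (h : ScaledDom c S) (hc : 0 < c) :
    c⁻¹ • S ∈ dom m n := by
  refine ⟨⟨fun j => mul_nonneg (inv_nonneg.2 hc.le) (h.nonneg₁ j), ?_⟩,
    ⟨fun i => mul_nonneg (inv_nonneg.2 hc.le) (h.nonneg₂ i), ?_⟩⟩
  · simp only [Prod.smul_fst, Pi.smul_apply, smul_eq_mul, ← Finset.mul_sum]
    rw [h.sum₁, inv_mul_cancel₀ hc.ne']
  · simp only [Prod.smul_snd, Pi.smul_apply, smul_eq_mul, ← Finset.mul_sum]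
    rw [h.sum₂, inv_mul_cancel₀ hc.ne']

theorem ScaledDom.add {c : ℝ} {S z : Pt m n} (h : ScaledDom c S) (hz : PosDom z) :
    ScaledDom (c + 1) (S + z) := by
  refine ⟨fun j => add_nonneg (h.nonneg₁ j) (hz.pos₁ j).le,
    fun i => add_nonneg (h.nonneg₂ i) (hz.pos₂ i).le, ?_, ?_⟩
  · simp only [Prod.fst_add, Pi.add_apply, Finset.sum_add_distrib, hz.sum₁, h.sum₁]
  · simp only [Prod.snd_add, Pi.add_apply, Finset.sum_add_distrib, hz.sum₂, h.sum₂]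

end ScaledDom

/-! ### Coupling of the whole program with stochastic mirror descent. -/

section Execution

variable {m n : ℕ} [NeZero m] [NeZero n] {A : Matrix (Fin m) (Fin n) ℝ}

/-- The invariant of the main loop after `t` passes: the machine represents the iterate and the sum
of the iterates, and each pass took a bounded number of steps. -/
structure LoopInv (η : ℝ) (dx dy K : ℕ) (t : ℕ) (zs : Pt m n × Pt m n) (s : State) : Prop where
  pos : PosDom zs.1
  scaled : ScaledDom ((t : ℝ) + 1) zs.2
  repX : Rep s .x dx zs.1.1 zs.2.1
  repY : Rep s .y dy zs.1.2 zs.2.2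
  eta : s.real .eta = η
  count : s.real .count = t + 1
  steps : s.steps ≤ K + t * (400 + 48 * (dx + dy))

/-- The body of the main loop. -/
def loopBody : Cmd := block [
  gradX,
  gradY,
  mirrorStep .x (.col .x),
  mirrorStep .y (.row .y),
  .setR .count (RReg.count + 1)]

theorem loopBody_spec (hr : ∀ i, ∃ j, A i j ≠ 0) (hc : ∀ j, ∃ i, A i j ≠ 0) {η : ℝ} {dx dy K t : ℕ}
    {zs : Pt m n × Pt m n} {s : State} (h : LoopInv η dx dy K t zs s) :
    Coupled (smdStep A η zs) (loopBody.run A (s.tick 2)) (LoopInv η dx dy K (t + 1)) := by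
  obtain ⟨z, S⟩ := zs
  have hz := h.pos
  simp only at hz
  rw [smdStep_eq A η hz]
  simp only [loopBody, run_cons]
  have hT : Frame [] [] [] s (s.tick 2) := Frame.refl.tick _
  refine (gradX_spec hr (h.repY.frame hT (by simp) (by simp) (by simp)) hz.pos₂ hz.sum₂).bind ?_
  rintro p - s1 ⟨hp1, hst1, hF1, hs1⟩
  have hX1 : Rep s1 .x dx z.1 S.1 :=
    h.repX.frame ((hT.mono (by simp) (by simp) (by simp)).trans hF1) (by simp) (by simp) (by simp)
  refine (gradY_spec hc hX1 hz.pos₁ hz.sum₁).bind ?_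
  rintro q - s2 ⟨hq2, hst2, hF2, hs2⟩
  have hX2 : Rep s2 .x dx z.1 S.1 := hX1.frame hF2 (by simp) (by simp) (by simp)
  have hp2 : s2.nat (.col .x) = p.2 := (hF2.nat _ (by simp)).trans hp1
  have hη1 : s1.real .eta = η := (hF1.real _ (by simp)).trans h.eta
  have hstx : s2.real (.step .x) = clipReal (η * (A p.1 p.2 * z.2 p.1 / probX A z p)) := by
    rw [hF2.real _ (by simp), hst1]
    exact congrArg (fun x => clipReal (x * _)) h.eta
  rw [hη1] at hst2
  -- Both estimates have been drawn at the old iterate before either block is updated.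
  refine (mirrorStep_spec A hX2 hz.pos₁ hp2 (by simp)).coupled_bind ?_
  rintro s3 ⟨hX3, hF3, hs3⟩
  rw [hstx] at hX3
  have hY3 : Rep s3 .y dy z.2 S.2 :=
    (((h.repY.frame hT (by simp) (by simp) (by simp)).frame hF1 (by simp) (by simp) (by simp)).frame
      hF2 (by simp) (by simp) (by simp)).frame hF3 (by simp) (by simp) (by simp)
  have hst3 : s3.real (.step .y) = clipReal (η * (-A q.1 q.2 * z.1 q.2 / probY A z q)) :=
    (hF3.real _ (by simp)).trans hst2
  refine (mirrorStep_spec A hY3 hz.pos₂ ((hF3.nat _ (by simp)).trans hq2) (by simp)).coupled_bind ?_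
  rintro s4 ⟨hY4, hF4, hs4⟩
  rw [hst3] at hY4
  refine (setR_spec A _ _).coupled_bind ?_
  rintro s5 ⟨hc5, hF5, hs5⟩
  have hz' := posDom_mirror hz (clipGrad A η z p q)
  refine Coupled.pure ⟨hz', ?_, ?_, ?_, ?_, ?_, ?_⟩
  · push_cast
    exact h.scaled.add hz'
  · exact (hX3.frame hF4 (by simp) (by simp) (by simp)).frame hF5 (by simp) (by simp) (by simp)
  · exact hY4.frame hF5 (by simp) (by simp) (by simp)
  · rw [hF5.real _ (by simp), hF4.real _ (by simp), hF3.real _ (by simp), hF2.real _ (by simp), hη1]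
  · rw [hc5, RExpr.eval_add, RExpr.eval_reg, hF4.real _ (by simp), hF3.real _ (by simp),
      hF2.real _ (by simp), hF1.real _ (by simp), State.real_tick, h.count]
    simp
  · have := h.steps
    simp at hs1 hs5
    rw [add_mul]
    omega

theorem outLoop_spec {N : ℕ} {s : State} {b : Blk} {d : ℕ} {x S : Fin N → ℝ} (h : Rep s b d x S) :
    Det ((Cmd.forN .k (NReg.dim b)
      (.store (.out b) NReg.k (IM.getSum b .k / RReg.count))).run A s) fun s' =>
        (∀ j : Fin N, s'.mem (.out b) j = S j / s.real .count) ∧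
        Frame [.k] [] [.out b] s s' ∧ s'.steps ≤ s.steps + 3 + 20 * N := by
  refine (forN_det A (K := N) (by simpa using h.dim) (fun k s' =>
        (∀ j : Fin N, (j : ℕ) < k → s'.mem (.out b) j = S j / s.real .count) ∧
        Frame [.k] [] [.out b] s s' ∧ s'.steps ≤ s.steps + 3 + 20 * k) ?_ ?_).mono ?_
  · exact ⟨by simp, Frame.refl.tick _, by simp⟩
  · rintro k hk s' ⟨h1, h4, h5⟩
    have hR : Rep ((s'.setN .k k).tick 2) b d x S :=
      h.frame ((h4.setN (by simp) k).tick 2) (by simp) (by simp) (by simp)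
    have hS : (IM.getSum b .k).eval A ((s'.setN .k k).tick 2) = S ⟨k, hk⟩ :=
      getSum_eval A hR (by simp)
    simp only [run_store]
    refine Det.pure ⟨?_, ?_, ?_⟩
    · intro j hj
      by_cases e : (j : ℕ) = k
      · obtain rfl : j = ⟨k, hk⟩ := Fin.ext e
        simp [hS, h4.real .count (by simp)]
      · simp [Function.update_of_ne e, h1 j (by omega)]
    · exact h4.setN (by simp) _ |>.tick _ |>.store (by simp) _ _ |>.tick _
    · simp [IM.getSum]
      omega
  · rintro s' ⟨h1, h4, h5⟩
    exact ⟨fun j => h1 j j.2, h4, h5⟩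

/-- The step bound is part of the coupling relation, so it holds on every run; the two depths enter
through the tree walks of each pass. -/
theorem execute_spec (hr : ∀ i, ∃ j, A i j ≠ 0) (hc : ∀ j, ∃ i, A i j ≠ 0) (ε : ℝ) {η : ℝ} {T : ℕ}
    (hη : η = ε / (18 * Lco A ^ 2)) (hT : T = ⌈6 * Real.log (m * n) / (η * ε)⌉₊) :
    Coupled (smd A η T) (execute A ε) fun zs s =>
      output m n s = ((T : ℝ) + 1)⁻¹ • zs.2 ∧ output m n s ∈ dom m n ∧
      ∃ dx dy : ℕ, 2 ^ dx < 2 * n ∧ 2 ^ dy < 2 * m ∧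
        s.steps ≤ 300 + 300 * m + 300 * n + T * (400 + 48 * (dx + dy)) := by
  simp only [execute, program, run_cons]
  refine (setParams_spec (m := m) (n := n) (A := A) rfl rfl).coupled_bind ?_
  rintro s1 ⟨hη1, hF1, hs1⟩
  replace hη1 : s1.real .eta = η := by rw [hη1, hη]; rfl
  have hε1 : s1.real .eps = ε := (hF1.real _ (by simp)).trans rfl
  have hn1 : s1.nat (.dim .x) = n := (hF1.nat _ (by simp)).trans rfl
  have hm1 : s1.nat (.dim .y) = m := (hF1.nat _ (by simp)).trans rfl
  refine (init_spec A hn1).coupled_bind ?_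
  rintro s2 ⟨⟨dx, hX2, hdx⟩, hF2, hs2⟩
  refine (init_spec A ((hF2.nat _ (by simp)).trans hm1)).coupled_bind ?_
  rintro s3 ⟨⟨dy, hY3, hdy⟩, hF3, hs3⟩
  have hX3 := hX2.frame hF3 (by simp) (by simp) (by simp)
  refine (updateSum_spec A hX3).coupled_bind ?_
  rintro s4 ⟨hX4, hF4, hs4⟩
  have hY4 := hY3.frame hF4 (by simp) (by simp) (by simp)
  refine (updateSum_spec A hY4).coupled_bind ?_
  rintro s5 ⟨hY5, hF5, hs5⟩
  have hX5 := hX4.frame hF5 (by simp) (by simp) (by simp)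
  refine (setR_spec A _ _).coupled_bind ?_
  rintro s6 ⟨hc6, hF6, hs6⟩
  have hX6 := hX5.frame hF6 (by simp) (by simp) (by simp)
  have hY6 := hY5.frame hF6 (by simp) (by simp) (by simp)
  have hη6 : s6.real .eta = η := by
    rw [hF6.real _ (by simp), hF5.real _ (by simp), hF4.real _ (by simp), hF3.real _ (by simp),
      hF2.real _ (by simp), hη1]
  have hε6 : s6.real .eps = ε := by
    rw [hF6.real _ (by simp), hF5.real _ (by simp), hF4.real _ (by simp), hF3.real _ (by simp),
      hF2.real _ (by simp), hε1]
  have hK : ⌈(6 * .log (.ofNat (NReg.dim .y) * .ofNat (NReg.dim .x)) / (RReg.eta * RReg.eps) :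
      RExpr).eval A s6⌉₊ = T := by
    rw [hT]
    simp [hη6, hε6, hX6.dim, hY6.dim]
  have hloop : Coupled (smd A η T) ((Cmd.forR (6 * .log (.ofNat (NReg.dim .y) * .ofNat (NReg.dim .x)) /
      (RReg.eta * RReg.eps)) loopBody).run A s6) (LoopInv η dx dy (250 + 250 * m + 250 * n) T) := by
    rw [run_forR, hK]
    refine iter_coupled (smd_succ A η) (LoopInv η dx dy (250 + 250 * m + 250 * n)) ?_ T
      fun k _ zs s h => loopBody_spec hr hc h
    have hc0 := posDom_center (m := m) (n := n)
    rw [smd, argminDom_negEntropy]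
    have hFt : ∀ k, Frame [] [] [] s6 (s6.tick k) := fun k => Frame.refl.tick k
    refine Coupled.pure ⟨hc0, ⟨fun j => (hc0.pos₁ j).le, fun i => (hc0.pos₂ i).le, ?_, ?_⟩, ?_, ?_,
      hη6, ?_, ?_⟩
    · rw [hc0.sum₁]
      simp
    · rw [hc0.sum₂]
      simp
    -- The update of the sums before the loop adds `z_0`, so the invariant at `t = 0` has one
    -- summand and `count = 1`.
    · rw [zero_add] at hX6
      exact hX6.frame (hFt _) (by simp) (by simp) (by simp)
    · rw [zero_add] at hY6
      exact hY6.frame (hFt _) (by simp) (by simp) (by simp)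
    · rw [State.real_tick, hc6]
      simp
    · simp [start] at *
      omega
  refine Coupled.bind_det hloop ?_
  rintro ⟨z, S⟩ - s7 h7
  refine (outLoop_spec h7.repX).bind ?_
  rintro s8 ⟨ho8, hF8, hs8⟩
  refine (outLoop_spec (h7.repY.frame hF8 (by simp) (by simp) (by simp))).bind ?_
  rintro s9 ⟨ho9, hF9, hs9⟩
  rw [hF8.real _ (by simp), h7.count] at ho9
  rw [h7.count] at ho8
  have hout : output m n s9 = ((T : ℝ) + 1)⁻¹ • S := by
    refine Prod.ext ?_ ?_
    · funext j
      simp [output, hF9.mem (.out .x) (by simp), ho8, div_eq_inv_mul]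
    · funext i
      simp [output, ho9, div_eq_inv_mul]
  refine Det.pure ⟨hout, ?_, dx, dy, hdx, hdy, ?_⟩
  · rw [hout]
    exact h7.scaled.inv_smul_mem (by positivity)
  · have := h7.steps
    have := NeZero.pos m
    omega

end Execution

/-! ### Scalar inequalities and the potential of one block. -/

section Scalars

/-- The range `10 / 9` is the sum of the clipping level `1` and the bound `1 / 9` on exact scaled
gradients. As the Taylor remainder bound is used only within `[-1, 1]`, it is applied at `y = -x /
2` and the result is squared; `0.624` exceeds `1 / 2 + (2 / 9) * (5 / 9)`. -/
theorem exp_neg_le {x : ℝ} (h : |x| ≤ 10 / 9) : Real.exp (-x) ≤ 1 - x + x ^ 2 := by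
  obtain ⟨h1, h2⟩ := abs_le.1 h
  set y := -x / 2 with hy
  have hx : x = -2 * y := by rw [hy]; ring
  have hy1 : |y| ≤ 5 / 9 := by rw [hy, abs_div, abs_neg, abs_two]; linarith
  obtain ⟨h3, h4⟩ := abs_le.1 hy1
  have hb := Real.exp_bound (x := y) (by linarith) (n := 3) (by norm_num)
  norm_num [Finset.sum_range_succ, Nat.factorial] at hb
  have hb' : Real.exp y ≤ 1 + y + y ^ 2 / 2 + |y| ^ 3 * (2 / 9) := by
    have := (abs_le.1 hb).2
    linarith
  have hc : |y| ^ 3 ≤ 5 / 9 * y ^ 2 := by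
    rw [pow_succ, sq_abs, mul_comm]
    exact mul_le_mul_of_nonneg_right hy1 (sq_nonneg y)
  have he : Real.exp (-x) = Real.exp y ^ 2 := by
    rw [hx, ← Real.exp_nat_mul]
    congr 1
    push_cast
    ring
  have hu : Real.exp y ≤ 1 + y + 0.624 * y ^ 2 := by
    norm_num
    nlinarith [sq_nonneg y]
  have hsq : Real.exp y ^ 2 ≤ (1 + y + 0.624 * y ^ 2) ^ 2 :=
    pow_le_pow_left₀ (Real.exp_pos y).le hu 2
  rw [he, hx]
  refine hsq.trans ?_
  have hq : 0 ≤ y ^ 2 * (1 - y) := mul_nonneg (sq_nonneg _) (by linarith)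
  have hq2 : 0 ≤ y ^ 2 * ((5 / 9 - y) * (y + 5 / 9)) :=
    mul_nonneg (sq_nonneg _) (mul_nonneg (by linarith) (by linarith))
  have hq3 : 0 ≤ y ^ 2 * (5 / 9 - y) := mul_nonneg (sq_nonneg _) (by linarith)
  norm_num
  nlinarith

theorem abs_clipReal_le (r : ℝ) : |clipReal r| ≤ 1 := by
  rcases lt_or_ge 1 r with h | h
  · simp [clipReal_of_one_lt h]
  rcases lt_or_ge r (-1) with h' | h'
  · simp [clipReal_of_lt_neg_one h']
  · have := abs_le.2 ⟨h', h⟩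
    rwa [clipReal_of_abs_le this]

theorem clipReal_sq_le (r : ℝ) : clipReal r ^ 2 ≤ r ^ 2 := by
  rcases lt_or_ge 1 r with h | h
  · rw [clipReal_of_one_lt h]
    nlinarith
  rcases lt_or_ge r (-1) with h' | h'
  · rw [clipReal_of_lt_neg_one h']
    nlinarith
  · rw [clipReal_of_abs_le (abs_le.2 ⟨h', h⟩)]

/-- Beyond the threshold this is `(|r| - 2)² ≥ 0`. The bias caused by clipping is thus controlled by
the second moment alone. -/
theorem abs_sub_clipReal_le (r : ℝ) : |r - clipReal r| ≤ r ^ 2 / 4 := by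
  rw [abs_le]
  rcases lt_or_ge 1 r with h | h
  · rw [clipReal_of_one_lt h]
    constructor <;> nlinarith [sq_nonneg (r - 2)]
  rcases lt_or_ge r (-1) with h' | h'
  · rw [clipReal_of_lt_neg_one h']
    constructor <;> nlinarith [sq_nonneg (r + 2)]
  · rw [clipReal_of_abs_le (abs_le.2 ⟨h', h⟩), sub_self]
    constructor <;> nlinarith [sq_nonneg r]

theorem clipReal_zero : clipReal 0 = 0 := by simp [clipReal]

/-- The increment of the potential along a coordinate is at most quadratic. -/
theorem increment_le {z w a X : ℝ} (hz : 0 ≤ z) (hw : 0 ≤ w) (ha : |a| ≤ 1 / 9) :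
    z * (Real.exp (-clipReal X) - 1) + w * (Real.exp (-(a - clipReal X)) - 1) ≤
      (w - z) * X - w * a + (5 / 4 * z + 9 / 4 * w) * X ^ 2 + 2 * w * a ^ 2 := by
  have h1 := abs_clipReal_le X
  obtain ⟨h2, h3⟩ := abs_le.1 (abs_sub_clipReal_le X)
  have h4 := clipReal_sq_le X
  have h5 := exp_neg_le (x := clipReal X) (by linarith)
  have h6 := exp_neg_le (x := a - clipReal X) ((abs_sub _ _).trans (by linarith))
  have k1 : Real.exp (-clipReal X) - 1 ≤ -X + 5 / 4 * X ^ 2 := by linarith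
  have k2 : Real.exp (-(a - clipReal X)) - 1 ≤ X - a + 9 / 4 * X ^ 2 + 2 * a ^ 2 := by
    -- Here `(a - c)² ≤ 2 a² + 2 c²` for the clipped value `c`, so `2 + 1 / 4` is the coefficient of
    -- `X²`.
    nlinarith [sq_nonneg (a + clipReal X)]
  have := mul_le_mul_of_nonneg_left k1 hz
  have := mul_le_mul_of_nonneg_left k2 hw
  linarith

end Scalars

section Potential

variable {ι : Type} [Fintype ι]

/-- The logarithm of the partition function of the losses `g`, relative to the inverse of `x`. -/
noncomputable def blockPot (x g : ι → ℝ) : ℝ := Real.log (∑ j, Real.exp (-g j) / x j)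

/-- The Gibbs distribution that belongs to `blockPot`. -/
noncomputable def gibbs (x g : ι → ℝ) : ι → ℝ :=
  fun k => Real.exp (-g k) / x k / ∑ j, Real.exp (-g j) / x j

variable {x g : ι → ℝ}

theorem partition_pos [Nonempty ι] (hx : ∀ j, 0 < x j) : 0 < ∑ j, Real.exp (-g j) / x j :=
  Finset.sum_pos (fun j _ => div_pos (Real.exp_pos _) (hx j)) Finset.univ_nonempty

theorem gibbs_nonneg (hx : ∀ j, 0 < x j) (k : ι) : 0 ≤ gibbs x g k :=
  div_nonneg (div_nonneg (Real.exp_pos _).le (hx k).le)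
    (Finset.sum_nonneg fun j _ => div_nonneg (Real.exp_pos _).le (hx j).le)

theorem sum_gibbs [Nonempty ι] (hx : ∀ j, 0 < x j) : ∑ k, gibbs x g k = 1 := by
  unfold gibbs
  rw [← Finset.sum_div, div_self (partition_pos hx).ne']

/-- A single summand of the partition function is already at least `exp (-g k)`, since `x k ≤ 1`. -/
theorem neg_le_blockPot (hx : ∀ j, 0 < x j) (hx1 : ∑ j, x j = 1) (k : ι) : -g k ≤ blockPot x g := by
  have hk : x k ≤ 1 := hx1 ▸ Finset.single_le_sum (fun j _ => (hx j).le) (Finset.mem_univ k)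
  rw [blockPot, ← Real.log_exp (-g k)]
  refine Real.log_le_log (Real.exp_pos _) ?_
  calc Real.exp (-g k) ≤ Real.exp (-g k) / x k := by
        rw [le_div_iff₀ (hx k)]
        exact mul_le_of_le_one_right (Real.exp_pos _).le hk
    _ ≤ _ := Finset.single_le_sum (f := fun j => Real.exp (-g j) / x j)
        (fun j _ => div_nonneg (Real.exp_pos _).le (hx j).le) (Finset.mem_univ k)

/-- The new partition function is a product of three factors: the normalizer of the reweighting, the
old partition function, and the Gibbs average of `exp (-(a - δ))`. The bound is `log t ≤ t - 1` for
the first and the third. -/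
theorem blockPot_reweight_le [Nonempty ι] (hx : ∀ j, 0 < x j) (hx1 : ∑ j, x j = 1) (a δ : ι → ℝ) :
    blockPot (reweight x δ) (g + a) ≤ blockPot x g +
      ∑ k, (x k * (Real.exp (-δ k) - 1) + gibbs x g k * (Real.exp (-(a k - δ k)) - 1)) := by
  have hZ : 0 < ∑ l, x l * Real.exp (-δ l) :=
    Finset.sum_pos (fun l _ => mul_pos (hx l) (Real.exp_pos _)) Finset.univ_nonempty
  have hW := partition_pos (g := g) hx
  have hV : 0 < ∑ k, gibbs x g k * Real.exp (-(a k - δ k)) :=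
    Finset.sum_pos (fun k _ => mul_pos (div_pos (div_pos (Real.exp_pos _) (hx k)) hW)
      (Real.exp_pos _)) Finset.univ_nonempty
  have hprod : ∑ j, Real.exp (-(g + a) j) / reweight x δ j =
      (∑ l, x l * Real.exp (-δ l)) * (∑ j, Real.exp (-g j) / x j) *
        ∑ k, gibbs x g k * Real.exp (-(a k - δ k)) := by
    rw [Finset.mul_sum]
    refine Finset.sum_congr rfl fun k _ => ?_
    have hxk := (hx k).ne'
    have e1 : Real.exp (-(g + a) k) =
        Real.exp (-g k) * Real.exp (-(a k - δ k)) * Real.exp (-δ k) := by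
      rw [← Real.exp_add, ← Real.exp_add]
      congr 1
      simp only [Pi.add_apply]
      ring
    rw [e1, reweight, gibbs]
    have := (Real.exp_pos (-δ k)).ne'
    field_simp
  rw [blockPot, hprod, Real.log_mul (mul_pos hZ hW).ne' hV.ne', Real.log_mul hZ.ne' hW.ne']
  have l1 := Real.log_le_sub_one_of_pos hZ
  have l2 := Real.log_le_sub_one_of_pos hV
  simp only [mul_sub, mul_one, Finset.sum_add_distrib, Finset.sum_sub_distrib, hx1,
    sum_gibbs (g := g) hx, blockPot]
  linarith

theorem sum_mul_add_sum {Ω : Type} [Fintype Ω] {p : Ω → ℝ} (hp1 : ∑ ω, p ω = 1) (c : ℝ)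
    (F : Ω → ι → ℝ) : ∑ ω, p ω * (c + ∑ k, F ω k) = c + ∑ k, ∑ ω, p ω * F ω k := by
  simp_rw [mul_add, Finset.sum_add_distrib, ← Finset.sum_mul, hp1, one_mul, Finset.mul_sum]
  rw [Finset.sum_comm]

/-- The expected increment of the potential of one block. -/
theorem expected_increment_le [Nonempty ι] {Ω : Type} [Fintype Ω] {p : Ω → ℝ} (hp0 : ∀ ω, 0 ≤ p ω)
    (hp1 : ∑ ω, p ω = 1) {G : Ω → ι → ℝ} {h : ι → ℝ} {η M : ℝ}
    (hG : ∀ k, ∑ ω, p ω * G ω k = h k) (hG2 : ∀ k, ∑ ω, p ω * G ω k ^ 2 ≤ M ^ 2)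
    (hη : 0 ≤ η) (hM : ∀ k, |h k| ≤ M) (hηM : η * M ≤ 1 / 9) (hx : ∀ j, 0 < x j)
    (hx1 : ∑ j, x j = 1) :
    ∑ ω, p ω * blockPot (reweight x fun k => clipReal (η * G ω k)) (g + fun k => η * h k) ≤
      blockPot x g - η * ∑ k, x k * h k + 11 / 2 * η ^ 2 * M ^ 2 := by
  set w := gibbs x g with hw
  have hw0 : ∀ k, 0 ≤ w k := gibbs_nonneg hx
  have hw1 : ∑ k, w k = 1 := sum_gibbs hx
  calc ∑ ω, p ω * blockPot (reweight x fun k => clipReal (η * G ω k)) (g + fun k => η * h k)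
      ≤ ∑ ω, p ω * (blockPot x g + ∑ k, ((w k - x k) * (η * G ω k) - w k * (η * h k) +
          (5 / 4 * x k + 9 / 4 * w k) * (η * G ω k) ^ 2 + 2 * w k * (η * h k) ^ 2)) := by
        refine Finset.sum_le_sum fun ω _ => mul_le_mul_of_nonneg_left ?_ (hp0 ω)
        refine (blockPot_reweight_le hx hx1 _ _).trans (add_le_add_right ?_ _)
        refine Finset.sum_le_sum fun k _ => increment_le (hx k).le (hw0 k) ?_
        rw [abs_mul, abs_of_nonneg hη]
        exact (mul_le_mul_of_nonneg_left (hM k) hη).trans hηM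
    -- The weights `w` and `x` are fixed before the draw, so the expectation passes to the powers of
    -- `G`.
    _ = blockPot x g + ∑ k, ((w k - x k) * η * ∑ ω, p ω * G ω k - w k * (η * h k) +
          (5 / 4 * x k + 9 / 4 * w k) * η ^ 2 * (∑ ω, p ω * G ω k ^ 2) +
            2 * w k * (η * h k) ^ 2) := by
        rw [sum_mul_add_sum hp1]
        congr 1
        refine Finset.sum_congr rfl fun k _ => ?_
        have e1 : w k * (η * h k) = ∑ ω, p ω * (w k * (η * h k)) := by
          rw [← Finset.sum_mul, hp1, one_mul]
        have e2 : 2 * w k * (η * h k) ^ 2 = ∑ ω, p ω * (2 * w k * (η * h k) ^ 2) := by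
          rw [← Finset.sum_mul, hp1, one_mul]
        conv_rhs => rw [Finset.mul_sum, Finset.mul_sum, e1, e2, ← Finset.sum_sub_distrib,
          ← Finset.sum_add_distrib, ← Finset.sum_add_distrib]
        exact Finset.sum_congr rfl fun ω _ => by ring
    -- By unbiasedness the terms `w h` cancel. The coefficient `17 / 4` is `9 / 4 + 2`, and `5 / 4 +
    -- 17 / 4 = 11 / 2`.
    _ ≤ blockPot x g + ∑ k, (-η * (x k * h k) +
          (5 / 4 * η ^ 2 * M ^ 2) * x k + (17 / 4 * η ^ 2 * M ^ 2) * w k) := by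
        refine add_le_add_right (Finset.sum_le_sum fun k _ => ?_) _
        rw [hG]
        have h1 := mul_le_mul_of_nonneg_left (hG2 k)
          (show 0 ≤ (5 / 4 * x k + 9 / 4 * w k) * η ^ 2 from
            mul_nonneg (by have := hx k; have := hw0 k; positivity) (sq_nonneg _))
        have h2 := mul_le_mul_of_nonneg_left (sq_le_sq' (abs_le.1 (hM k)).1 (abs_le.1 (hM k)).2)
          (show 0 ≤ 2 * w k * η ^ 2 from mul_nonneg (by have := hw0 k; positivity) (sq_nonneg _))
        linarith
    _ = _ := by
        simp only [Finset.sum_add_distrib, ← Finset.mul_sum, hx1, hw1]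
        ring

end Potential

/-! ### The gradient operator of the game, and the potential as a bound for the gap. -/

section Game

variable {m n : ℕ} {A : Matrix (Fin m) (Fin n) ℝ}

/-- The gradient operator `(Aᵀ y, -A x)` of the game. -/
def gradOp (A : Matrix (Fin m) (Fin n) ℝ) (z : Pt m n) : Pt m n :=
  (fun j => ∑ i, A i j * z.2 i, fun i => -∑ j, A i j * z.1 j)

theorem obj_eq_sum_snd (z : Pt m n) (y : Fin m → ℝ) :
    obj A z.1 y = -∑ i, y i * (gradOp A z).2 i := by
  simp [obj, dotProduct, Matrix.mulVec, gradOp]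

theorem obj_eq_sum_fst (x : Fin n → ℝ) (z : Pt m n) :
    obj A x z.2 = ∑ j, x j * (gradOp A z).1 j := by
  simp only [obj, dotProduct, Matrix.mulVec, gradOp, Finset.mul_sum]
  rw [Finset.sum_comm]
  exact Finset.sum_congr rfl fun j _ => Finset.sum_congr rfl fun i _ => by ring

theorem gradOp_add (z w : Pt m n) : gradOp A (z + w) = gradOp A z + gradOp A w := by
  refine Prod.ext ?_ ?_
  · funext j
    simp [gradOp, mul_add, Finset.sum_add_distrib]
  · funext i
    simp [gradOp, mul_add, Finset.sum_add_distrib]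
    ring

theorem gap_le [NeZero m] [NeZero n] {z : Pt m n} {c : ℝ}
    (h : ∀ x ∈ stdSimplex ℝ (Fin n), ∀ y ∈ stdSimplex ℝ (Fin m), obj A z.1 y - obj A x z.2 ≤ c) :
    gap A z ≤ c := by
  rw [gap, sub_le_iff_le_add]
  refine ciSup_le fun y => ?_
  rw [← sub_le_iff_le_add']
  exact le_ciInf fun x => by linarith [h x x.2 y y.2]

theorem abs_entry_le_rowNorm (i : Fin m) (j : Fin n) : |A i j| ≤ rowNorm A i := by
  refine abs_le_of_sq_le_sq ?_ (rowNorm_nonneg i)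
  rw [rowNorm_sq]
  exact Finset.single_le_sum (f := fun j => A i j ^ 2) (fun _ _ => sq_nonneg _) (Finset.mem_univ j)

theorem abs_entry_le_Lco (i : Fin m) (j : Fin n) : |A i j| ≤ Lco A :=
  (abs_entry_le_rowNorm i j).trans (rowNorm_le_Lco i)

theorem abs_sum_mul_le {ι : Type} [Fintype ι] {w a : ι → ℝ} (hw : w ∈ stdSimplex ℝ ι) {c : ℝ}
    (ha : ∀ k, |a k| ≤ c) : |∑ k, a k * w k| ≤ c := by
  refine (Finset.abs_sum_le_sum_abs _ _).trans ?_
  calc ∑ k, |a k * w k| ≤ ∑ k, c * w k := Finset.sum_le_sum fun k _ => by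
        rw [abs_mul, abs_of_nonneg (hw.1 k)]
        exact mul_le_mul_of_nonneg_right (ha k) (hw.1 k)
    _ = c := by rw [← Finset.mul_sum, hw.2, mul_one]

theorem abs_gradOp_fst_le {z : Pt m n} (hz : z ∈ dom m n) (j : Fin n) :
    |(gradOp A z).1 j| ≤ Lco A :=
  abs_sum_mul_le hz.2 fun i => abs_entry_le_Lco i j

theorem abs_gradOp_snd_le {z : Pt m n} (hz : z ∈ dom m n) (i : Fin m) :
    |(gradOp A z).2 i| ≤ Lco A := by
  rw [gradOp, abs_neg]
  exact abs_sum_mul_le hz.1 fun j => abs_entry_le_Lco i j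

/-- Settles the case `2 L ≤ ε`, in which `η L ≤ 1 / 9` is not guaranteed. -/
theorem gap_le_two_mul_Lco [NeZero m] [NeZero n] {z : Pt m n} (hz : z ∈ dom m n) :
    gap A z ≤ 2 * Lco A := by
  refine gap_le fun x hx y hy => ?_
  have h1 := abs_sum_mul_le hy fun i => abs_gradOp_snd_le (A := A) hz i
  have h2 := abs_sum_mul_le hx fun j => abs_gradOp_fst_le (A := A) hz j
  rw [obj_eq_sum_snd, obj_eq_sum_fst]
  simp only [mul_comm (y _), mul_comm (x _)]
  linarith [(abs_le.1 h1).1, (abs_le.1 h2).1]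

/-- The potential of the iterate `z` and the sum `S` of the previous iterates. -/
noncomputable def pot (A : Matrix (Fin m) (Fin n) ℝ) (η : ℝ) (z S : Pt m n) : ℝ :=
  blockPot z.1 (fun j => η * (gradOp A S).1 j) + blockPot z.2 (fun i => η * (gradOp A S).2 i)

theorem average_le_blockPot {ι : Type} [Fintype ι] {x g w : ι → ℝ} (hx : ∀ j, 0 < x j)
    (hx1 : ∑ j, x j = 1) (hw : w ∈ stdSimplex ℝ ι) : -∑ k, w k * g k ≤ blockPot x g := by
  rw [← one_mul (blockPot x g), ← hw.2, Finset.sum_mul, ← Finset.sum_neg_distrib]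
  exact Finset.sum_le_sum fun k _ => by
    rw [← mul_neg]
    exact mul_le_mul_of_nonneg_left (neg_le_blockPot hx hx1 k) (hw.1 k)

/-- The comparators are arbitrary while the right side does not mention them, so the bound survives
maximization for each outcome. -/
theorem le_pot {η : ℝ} {z S : Pt m n} (hz : PosDom z) {x : Fin n → ℝ} {y : Fin m → ℝ}
    (hx : x ∈ stdSimplex ℝ (Fin n)) (hy : y ∈ stdSimplex ℝ (Fin m)) :
    η * (obj A S.1 y - obj A x S.2) ≤ pot A η z S := by
  have h1 := average_le_blockPot (g := fun j => η * (gradOp A S).1 j) hz.pos₁ hz.sum₁ hx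
  have h2 := average_le_blockPot (g := fun i => η * (gradOp A S).2 i) hz.pos₂ hz.sum₂ hy
  rw [obj_eq_sum_snd, obj_eq_sum_fst, pot]
  simp only [mul_left_comm _ η, ← Finset.mul_sum] at h1 h2
  linarith

/-- Against its own average as comparator, `S` has regret zero. -/
theorem pot_nonneg {η c : ℝ} {z S : Pt m n} (hz : PosDom z) (hS : ScaledDom c S) (hc : 0 < c) :
    0 ≤ pot A η z S := by
  have h := hS.inv_smul_mem hc
  refine le_of_eq_of_le ?_ (le_pot (A := A) (η := η) (S := S) hz h.1 h.2)
  simp [obj, Matrix.mulVec_smul, smul_dotProduct, dotProduct_smul]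

theorem mul_gap_le_pot [NeZero m] [NeZero n] {η c : ℝ} {z S : Pt m n} (hz : PosDom z) (hη : 0 < η)
    (hc : 0 < c) : η * c * gap A (c⁻¹ • S) ≤ pot A η z S := by
  rw [← le_div_iff₀' (mul_pos hη hc)]
  refine gap_le fun x hx y hy => ?_
  rw [le_div_iff₀' (mul_pos hη hc)]
  refine le_of_eq_of_le ?_ (le_pot (A := A) (η := η) (S := S) hz hx hy)
  simp [obj, Matrix.mulVec_smul, smul_dotProduct, dotProduct_smul]
  field_simp

end Game

/-! ### Mean and second moments of the gradient estimator. -/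

section Estimator

variable {m n : ℕ} {A : Matrix (Fin m) (Fin n) ℝ} {z : Pt m n}

theorem clipReal_mul_single {ι : Type} [DecidableEq ι] (η a : ℝ) (j k : ι) :
    (Pi.single j (clipReal (η * a)) : ι → ℝ) k = clipReal (η * (Pi.single j a : ι → ℝ) k) := by
  by_cases h : k = j
  · subst h
    simp
  · simp [h, clipReal_zero]

theorem probX_nonneg (hz : PosDom z) (p : Fin m × Fin n) : 0 ≤ probX A z p :=
  mul_nonneg (hz.pos₂ _).le (rowProb_nonneg A _ _)

theorem probY_nonneg (hz : PosDom z) (p : Fin m × Fin n) : 0 ≤ probY A z p :=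
  mul_nonneg (hz.pos₁ _).le (colProb_nonneg A _ _)

theorem sum_probX (hA : ∀ i, ∃ j, A i j ≠ 0) (hz : PosDom z) : ∑ p, probX A z p = 1 := by
  simp [Fintype.sum_prod_type, probX, ← Finset.mul_sum, sum_rowProb hA, hz.sum₂]

theorem sum_probY (hA : ∀ j, ∃ i, A i j ≠ 0) (hz : PosDom z) : ∑ p, probY A z p = 1 := by
  simp [Fintype.sum_prod_type_right, probY, ← Finset.mul_sum, sum_colProb hA, hz.sum₁]

/-- Importance weighting with `a / 0 = 0`: no bias arises if zero probability forces a zero term. At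
interior points it does, by the next two lemmas. -/
theorem mul_div_self_of_imp {p a : ℝ} (h : p = 0 → a = 0) : p * (a / p) = a := by
  by_cases hp : p = 0
  · simp [hp, h hp]
  · field_simp

theorem entry_eq_zero_of_probX (hA : ∀ i, ∃ j, A i j ≠ 0) (hz : PosDom z) {p : Fin m × Fin n}
    (hp : probX A z p = 0) : A p.1 p.2 = 0 := by
  rw [probX, mul_eq_zero, div_eq_zero_iff] at hp
  rcases hp with h | h | h
  · exact absurd h (hz.pos₂ _).ne'
  · simpa using h
  · exact absurd h (rowNorm_sq_pos hA _).ne'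

theorem entry_eq_zero_of_probY (hA : ∀ j, ∃ i, A i j ≠ 0) (hz : PosDom z) {p : Fin m × Fin n}
    (hp : probY A z p = 0) : A p.1 p.2 = 0 := by
  rw [probY, mul_eq_zero, div_eq_zero_iff] at hp
  rcases hp with h | h | h
  · exact absurd h (hz.pos₁ _).ne'
  · simpa using h
  · exact absurd h (colNorm_sq_pos hA _).ne'

/-- The `x` block of the gradient estimator is unbiased. -/
theorem estX_mean (hA : ∀ i, ∃ j, A i j ≠ 0) (hz : PosDom z) (k : Fin n) :
    ∑ p, probX A z p * (Pi.single p.2 (A p.1 p.2 * z.2 p.1 / probX A z p) : Fin n → ℝ) k =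
      (gradOp A z).1 k := by
  rw [Fintype.sum_prod_type, gradOp]
  refine Finset.sum_congr rfl fun i _ => ?_
  rw [Finset.sum_eq_single k]
  · rw [Pi.single_eq_same]
    exact mul_div_self_of_imp fun h => by rw [entry_eq_zero_of_probX hA hz h, zero_mul]
  · intro j _ hj
    simp [Pi.single_eq_of_ne hj.symm]
  · simp

theorem estY_mean (hA : ∀ j, ∃ i, A i j ≠ 0) (hz : PosDom z) (k : Fin m) :
    ∑ p, probY A z p * (Pi.single p.1 (-A p.1 p.2 * z.1 p.2 / probY A z p) : Fin m → ℝ) k =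
      (gradOp A z).2 k := by
  rw [Fintype.sum_prod_type_right, gradOp]
  simp only [← Finset.sum_neg_distrib]
  refine Finset.sum_congr rfl fun j _ => ?_
  rw [Finset.sum_eq_single k]
  · rw [Pi.single_eq_same, ← neg_mul]
    exact mul_div_self_of_imp fun h => by
      have := entry_eq_zero_of_probY hA hz h
      simp only at this
      rw [this, neg_zero, zero_mul]
  · intro i _ hi
    simp [Pi.single_eq_of_ne hi.symm]
  · simp

/-- With these probabilities the quotient is `r ^ 2 / a`, and the term is exactly `y * r ^ 2` unless
`a = 0`. This is why sampling by squared entries leads to row and column norms. -/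
theorem second_moment_term_le {y a r L : ℝ} (hy : 0 < y) (hr : 0 < r ^ 2) (hL : r ^ 2 ≤ L ^ 2) :
    y * (a ^ 2 / r ^ 2) * (a * y / (y * (a ^ 2 / r ^ 2))) ^ 2 ≤ y * L ^ 2 := by
  by_cases ha : a = 0
  · simp [ha]
    positivity
  · refine le_trans (le_of_eq ?_) (mul_le_mul_of_nonneg_left hL hy.le)
    have : r ≠ 0 := by rintro rfl; simp at hr
    field_simp

/-- The second moment of the `x` block of the gradient estimator. -/
theorem estX_second_moment (hA : ∀ i, ∃ j, A i j ≠ 0) (hz : PosDom z) (k : Fin n) :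
    ∑ p, probX A z p * (Pi.single p.2 (A p.1 p.2 * z.2 p.1 / probX A z p) : Fin n → ℝ) k ^ 2 ≤
      Lco A ^ 2 := by
  rw [Fintype.sum_prod_type, ← one_mul (Lco A ^ 2), ← hz.sum₂, Finset.sum_mul]
  refine Finset.sum_le_sum fun i _ => ?_
  rw [Finset.sum_eq_single k]
  · rw [Pi.single_eq_same]
    exact second_moment_term_le (hz.pos₂ i) (rowNorm_sq_pos hA i)
      (pow_le_pow_left₀ (rowNorm_nonneg i) (rowNorm_le_Lco i) 2)
  · intro j _ hj
    simp [Pi.single_eq_of_ne hj.symm]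
  · simp

theorem estY_second_moment (hA : ∀ j, ∃ i, A i j ≠ 0) (hz : PosDom z) (k : Fin m) :
    ∑ p, probY A z p * (Pi.single p.1 (-A p.1 p.2 * z.1 p.2 / probY A z p) : Fin m → ℝ) k ^ 2 ≤
      Lco A ^ 2 := by
  rw [Fintype.sum_prod_type_right, ← one_mul (Lco A ^ 2), ← hz.sum₁, Finset.sum_mul]
  refine Finset.sum_le_sum fun j _ => ?_
  rw [Finset.sum_eq_single k]
  · rw [Pi.single_eq_same, neg_mul, neg_div, neg_sq]
    exact second_moment_term_le (hz.pos₁ j) (colNorm_sq_pos hA j)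
      (pow_le_pow_left₀ (colNorm_nonneg j) (colNorm_le_Lco j) 2)
  · intro i _ hi
    simp [Pi.single_eq_of_ne hi.symm]
  · simp

end Estimator

/-! ### Drift of the potential and the expected gap. -/

section Regret

variable {m n : ℕ} [NeZero m] [NeZero n] {A : Matrix (Fin m) (Fin n) ℝ} {η : ℝ}

theorem smd_support (t : ℕ)
    {zs : Pt m n × Pt m n} (h : zs ∈ (smd A η t).support) :
    PosDom zs.1 ∧ ScaledDom ((t : ℝ) + 1) zs.2 := by
  induction t generalizing zs with
  | zero =>
    rw [smd, argminDom_negEntropy, PMF.support_pure, Set.mem_singleton_iff] at h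
    subst h
    have h := posDom_center (m := m) (n := n)
    exact ⟨h, fun j => (h.pos₁ j).le, fun i => (h.pos₂ i).le, by simp [h.sum₁], by simp [h.sum₂]⟩
  | succ t ih =>
    rw [smd_succ, PMF.mem_support_bind_iff] at h
    obtain ⟨ws, hws, h⟩ := h
    obtain ⟨h1, h2⟩ := ih hws
    rw [smdStep_eq A η h1, PMF.mem_support_bind_iff] at h
    obtain ⟨p, -, h⟩ := h
    rw [PMF.mem_support_bind_iff] at h
    obtain ⟨q, -, h⟩ := h
    rw [PMF.support_pure, Set.mem_singleton_iff] at h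
    subst h
    have h' := posDom_mirror h1 (clipGrad A η ws.1 p q)
    refine ⟨h', ?_⟩
    push_cast
    exact h2.add h'

/-- Each block of the new potential depends on one of the two draws only, so the other draw sums out
and the one-block estimate applies twice. -/
theorem sum_expected_pot_le (hr : ∀ i, ∃ j, A i j ≠ 0) (hc : ∀ j, ∃ i, A i j ≠ 0) {z S : Pt m n}
    (hz : PosDom z) (hη : 0 ≤ η) (hηL : η * Lco A ≤ 1 / 9) :
    ∑ p, probX A z p * ∑ q, probY A z q * pot A η (mirror z (clipGrad A η z p q)) (S + z) ≤
      pot A η z S + 11 * η ^ 2 * Lco A ^ 2 := by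
  have hX := expected_increment_le (g := fun j => η * (gradOp A S).1 j) (probX_nonneg (A := A) hz)
    (sum_probX hr hz) (estX_mean hr hz) (estX_second_moment hr hz) hη
    (abs_gradOp_fst_le hz.mem_dom) hηL hz.pos₁ hz.sum₁
  have hY := expected_increment_le (g := fun i => η * (gradOp A S).2 i) (probY_nonneg (A := A) hz)
    (sum_probY hc hz) (estY_mean hc hz) (estY_second_moment hc hz) hη
    (abs_gradOp_snd_le hz.mem_dom) hηL hz.pos₂ hz.sum₂
  -- The operator is skew: the payoff enters once with each sign.
  have hzero : ∑ k, z.1 k * (gradOp A z).1 k + ∑ k, z.2 k * (gradOp A z).2 k = 0 := by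
    rw [← obj_eq_sum_fst, ← neg_eq_iff_eq_neg.2 (obj_eq_sum_snd z z.2)]
    ring
  have hsplit : ∀ p q, pot A η (mirror z (clipGrad A η z p q)) (S + z) =
      blockPot (reweight z.1 fun k => clipReal (η *
        (Pi.single p.2 (A p.1 p.2 * z.2 p.1 / probX A z p) : Fin n → ℝ) k))
          ((fun j => η * (gradOp A S).1 j) + fun k => η * (gradOp A z).1 k) +
      blockPot (reweight z.2 fun k => clipReal (η *
        (Pi.single q.1 (-A q.1 q.2 * z.1 q.2 / probY A z q) : Fin m → ℝ) k))
          ((fun i => η * (gradOp A S).2 i) + fun k => η * (gradOp A z).2 k) := by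
    intro p q
    simp only [pot, mirror, clipGrad, gradOp_add, Prod.fst_add, Prod.snd_add, Pi.add_apply, mul_add,
      ← clipReal_mul_single]
    rfl
  simp only [hsplit, mul_add, Finset.sum_add_distrib, ← Finset.sum_mul, sum_probY hc hz,
    sum_probX hr hz, one_mul]
  rw [pot]
  have e : η * (∑ k, z.1 k * (gradOp A z).1 k) + η * (∑ k, z.2 k * (gradOp A z).2 k) = 0 := by
    rw [← mul_add, hzero, mul_zero]
  linarith

theorem expect_smdStep_pot_le (hr : ∀ i, ∃ j, A i j ≠ 0) (hc : ∀ j, ∃ i, A i j ≠ 0)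
    {zs : Pt m n × Pt m n} (hz : PosDom zs.1) {c : ℝ} (hS : ScaledDom c zs.2) (hc0 : 0 < c)
    (hη : 0 ≤ η) (hηL : η * Lco A ≤ 1 / 9) :
    expect (smdStep A η zs) (fun ws => ENNReal.ofReal (pot A η ws.1 (ws.2 - ws.1))) ≤
      ENNReal.ofReal (pot A η zs.1 (zs.2 - zs.1)) + ENNReal.ofReal (11 * η ^ 2 * Lco A ^ 2) := by
  -- `ENNReal.ofReal` truncates negative values; nonnegativity makes the truncated expectation equal
  -- to the weighted sum.
  have hpos : ∀ p q, 0 ≤ pot A η (mirror zs.1 (clipGrad A η zs.1 p q)) zs.2 := fun p q =>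
    pot_nonneg (posDom_mirror hz _) hS hc0
  rw [smdStep_eq A η hz]
  simp only [expect_bind, expect_pure, add_sub_cancel_right]
  simp only [expect_drawFrom_ofReal (probY_nonneg hz) (sum_probY hc hz) fun q _ => hpos _ q]
  rw [expect_drawFrom_ofReal (probX_nonneg hz) (sum_probX hr hz) fun p _ =>
    Finset.sum_nonneg fun q _ => mul_nonneg (probY_nonneg hz q) (hpos p q)]
  have h := sum_expected_pot_le hr hc (S := zs.2 - zs.1) hz hη hηL
  rw [sub_add_cancel] at h
  exact (ENNReal.ofReal_le_ofReal h).trans ENNReal.ofReal_add_le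

/-- Without losses the blocks contribute `log (n²)` and `log (m²)`. -/
theorem pot_center_zero : pot A η (center m n) 0 = 2 * Real.log (m * n) := by
  have hm : (m : ℝ) ≠ 0 := Nat.cast_ne_zero.2 (NeZero.ne m)
  have hn : (n : ℝ) ≠ 0 := Nat.cast_ne_zero.2 (NeZero.ne n)
  rw [Real.log_mul hm hn]
  simp [pot, blockPot, gradOp, center, Real.log_mul hm hm, Real.log_mul hn hn]
  ring

theorem expect_pot_le (hr : ∀ i, ∃ j, A i j ≠ 0) (hc : ∀ j, ∃ i, A i j ≠ 0) (hη : 0 ≤ η)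
    (hηL : η * Lco A ≤ 1 / 9) (t : ℕ) :
    expect (smd A η t) (fun zs => ENNReal.ofReal (pot A η zs.1 (zs.2 - zs.1))) ≤
      ENNReal.ofReal (2 * Real.log (m * n) + t * (11 * η ^ 2 * Lco A ^ 2)) := by
  have hlog : 0 ≤ Real.log (m * n) := by
    rw [← Nat.cast_mul]
    exact Real.log_natCast_nonneg _
  induction t with
  | zero =>
    rw [smd, expect_pure, argminDom_negEntropy]
    simp [pot_center_zero]
  | succ t ih =>
    rw [smd_succ, expect_bind]
    calc _ ≤ expect (smd A η t) (fun zs => ENNReal.ofReal (pot A η zs.1 (zs.2 - zs.1)) +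
          ENNReal.ofReal (11 * η ^ 2 * Lco A ^ 2)) := expect_mono fun zs hzs => by
            obtain ⟨h1, h2⟩ := smd_support t hzs
            exact expect_smdStep_pot_le hr hc h1 h2 (by positivity) hη hηL
      _ ≤ _ := by
        rw [expect_add, expect_const]
        refine (add_le_add_left ih _).trans ?_
        rw [← ENNReal.ofReal_add (by positivity) (by positivity)]
        refine ENNReal.ofReal_le_ofReal (le_of_eq ?_)
        push_cast
        ring

theorem expect_gap_smdOutput_le (hr : ∀ i, ∃ j, A i j ≠ 0) (hc : ∀ j, ∃ i, A i j ≠ 0) {ε : ℝ}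
    (hε : 0 < ε) {T : ℕ} (hη : η = ε / (18 * Lco A ^ 2))
    (hT : T = ⌈6 * Real.log (m * n) / (η * ε)⌉₊) :
    expect (smdOutput A η T) (fun z => ENNReal.ofReal (gap A z)) ≤ ENNReal.ofReal ε := by
  have hL : 0 < Lco A := Lco_pos hr
  have hη0 : 0 < η := by
    rw [hη]
    positivity
  have hT0 : (0 : ℝ) < (T : ℝ) + 1 := by positivity
  rw [smdOutput, expect_map]
  rcases le_or_gt (2 * Lco A) ε with h | h
  · refine (expect_mono (g := fun _ => ENNReal.ofReal ε) fun zs hzs => ?_).trans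
      (expect_const _ _).le
    exact ENNReal.ofReal_le_ofReal
      ((gap_le_two_mul_Lco ((smd_support T hzs).2.inv_smul_mem hT0)).trans h)
  have hηL : η * Lco A ≤ 1 / 9 := by
    rw [hη]
    field_simp
    linarith
  -- One fictitious further step: the potential after it has `z_0 + ⋯ + z_T` as the sum of earlier
  -- iterates, and it bounds the gap for every draw in that step.
  have hstep : ∀ zs ∈ (smd A η T).support,
      ENNReal.ofReal (η * (T + 1)) * ENNReal.ofReal (gap A (((T : ℝ) + 1)⁻¹ • zs.2)) ≤
        expect (smdStep A η zs) fun ws => ENNReal.ofReal (pot A η ws.1 (ws.2 - ws.1)) := by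
    intro zs hzs
    obtain ⟨hz, hS⟩ := smd_support T hzs
    rw [← ENNReal.ofReal_mul (by positivity), smdStep_eq A η hz]
    simp only [expect_bind, expect_pure, add_sub_cancel_right]
    refine le_trans (le_of_eq (expect_const _ _).symm) (expect_mono fun p _ => ?_)
    refine le_trans (le_of_eq (expect_const _ _).symm) (expect_mono fun q _ => ?_)
    exact ENNReal.ofReal_le_ofReal (mul_gap_le_pot (posDom_mirror hz _) hη0 hT0)
  have htotal := (expect_mono hstep).trans
    ((le_of_eq (expect_bind _ _ _).symm).trans (expect_pot_le hr hc hη0.le hηL (T + 1)))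
  rw [expect_const_mul] at htotal
  have hc0 : ENNReal.ofReal (η * (T + 1)) ≠ 0 := by
    rw [Ne, ENNReal.ofReal_eq_zero, not_le]
    positivity
  rw [← ENNReal.mul_le_mul_iff_right hc0 ENNReal.ofReal_ne_top]
  refine htotal.trans ?_
  rw [← ENNReal.ofReal_mul (by positivity)]
  refine ENNReal.ofReal_le_ofReal ?_
  -- Hence `2 log(mn) ≤ T η ε / 3`; with the drift `11 / 18 η ε` in each of `T + 1` steps the total
  -- is below `(T + 1) η ε`, as `1 / 3 + 11 / 18 < 1`.
  have hTle : 6 * Real.log (m * n) ≤ T * (η * ε) := by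
    rw [← div_le_iff₀ (by positivity), hT]
    exact Nat.le_ceil _
  have hL2 : 18 * (η * Lco A ^ 2) = ε := by
    rw [hη]
    field_simp
  have key : 11 * η ^ 2 * Lco A ^ 2 = 11 / 18 * (η * ε) := by
    rw [← hL2]
    ring
  rw [key]
  have hηε : 0 < η * ε := by positivity
  have hTη : 0 ≤ (T : ℝ) * (η * ε) := by positivity
  push_cast
  linarith

end Regret

/-! ### The step count. -/

theorem depth_le {N d : ℕ} [NeZero N] (h : 2 ^ d < 2 * N) : (d : ℝ) ≤ 1 + 2 * Real.log N := by
  have hN : (0 : ℝ) < N := Nat.cast_pos.2 (NeZero.pos N)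
  have h1 : ((2 : ℝ) ^ d) ≤ 2 * N := by exact_mod_cast h.le
  have h2 := Real.log_le_log (by positivity) h1
  rw [Real.log_pow, Real.log_mul (by norm_num) hN.ne'] at h2
  -- Only `log 2 > 1 / 2` is needed; it gives the factor `2` in front of the natural logarithm.
  have h3 := Real.log_two_gt_d9
  have h4 : 0 ≤ Real.log N := Real.log_natCast_nonneg N
  by_contra! h5
  nlinarith

/-- The step count of the implementation is of the stated order. -/
theorem steps_le {m n : ℕ} [NeZero m] [NeZero n] {L ε η : ℝ} (hL : 0 < L) (hε : 0 < ε)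
    (hη : η = ε / (18 * L ^ 2)) {T dx dy k : ℕ} (hT : T = ⌈6 * Real.log (m * n) / (η * ε)⌉₊)
    (hdx : 2 ^ dx < 2 * n) (hdy : 2 ^ dy < 2 * m)
    (hk : k ≤ 300 + 300 * m + 300 * n + T * (400 + 48 * (dx + dy))) :
    (k : ℝ) ≤ 120000 * (L ^ 2 * Real.log (m * n) ^ 2 / ε ^ 2 + m + n) := by
  have hm : (1 : ℝ) ≤ m := Nat.one_le_cast.2 NeZero.one_le
  have hn : (1 : ℝ) ≤ n := Nat.one_le_cast.2 NeZero.one_le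
  have hk' : (k : ℝ) ≤ 300 + 300 * m + 300 * n + T * (400 + 48 * (dx + dy)) := by exact_mod_cast hk
  have hx := depth_le hdx
  have hy := depth_le hdy
  set ℓ := Real.log (m * n) with hℓ
  have hsplit : ℓ = Real.log m + Real.log n := Real.log_mul (by positivity) (by positivity)
  have hlm := Real.log_le_sub_one_of_pos (show (0 : ℝ) < m by positivity)
  have hln := Real.log_le_sub_one_of_pos (show (0 : ℝ) < n by positivity)
  have hq : 6 * ℓ / (η * ε) = 108 * (L ^ 2 * ℓ / ε ^ 2) := by
    rw [hη]
    field_simp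
    ring
  have hℓ0 : 0 ≤ ℓ := by
    rw [hℓ, ← Nat.cast_mul]
    exact Real.log_natCast_nonneg _
  have hQ : 0 ≤ L ^ 2 * ℓ / ε ^ 2 := by positivity
  have hTle : (T : ℝ) ≤ 108 * (L ^ 2 * ℓ / ε ^ 2) + 1 := by
    rw [hT, hq]
    exact (Nat.ceil_lt_add_one (by positivity)).le
  have hmain : (T : ℝ) * (400 + 48 * (dx + dy)) ≤
      118800 * (L ^ 2 * ℓ ^ 2 / ε ^ 2) + 1100 * (m + n) := by
    -- For `m = n = 1` the logarithm is zero and the loop never runs. Otherwise `ℓ ≥ log 2 > 1 / 2`,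
    -- and the constant cost of a pass is absorbed into a multiple of `ℓ`.
    rcases Nat.eq_zero_or_pos T with h0 | h0
    · rw [h0, Nat.cast_zero, zero_mul]
      positivity
    · have hmn : 2 ≤ m * n := by
        by_contra hlt
        have h1 : m * n = 1 := by
          have := Nat.mul_pos (NeZero.pos m) (NeZero.pos n)
          omega
        have h2 : ℓ = 0 := by
          rw [hℓ, ← Nat.cast_mul, h1]
          simp
        rw [hT, h2] at h0
        simp at h0
      have hhalf : 1 / 2 ≤ ℓ := by
        have h1 : Real.log 2 ≤ ℓ := Real.log_le_log (by norm_num) (by exact_mod_cast hmn)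
        have := Real.log_two_gt_d9
        linarith
      -- The left side is at most `496 + 96 ℓ`, hence at most `1088 ℓ`.
      have hper : (400 + 48 * (dx + dy) : ℝ) ≤ 1100 * ℓ := by linarith
      calc (T : ℝ) * (400 + 48 * (dx + dy)) ≤ (108 * (L ^ 2 * ℓ / ε ^ 2) + 1) * (1100 * ℓ) :=
            mul_le_mul hTle hper (by positivity) (by positivity)
        _ = 118800 * (L ^ 2 * ℓ ^ 2 / ε ^ 2) + 1100 * ℓ := by ring
        _ ≤ _ := by linarith
  have hQ2 : 0 ≤ L ^ 2 * ℓ ^ 2 / ε ^ 2 := by positivity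
  linarith

end MatrixGame

theorem mainTheorem4 :
    ∃ C : ℝ, ∀ (m n : ℕ) [NeZero m] [NeZero n] (A : Matrix (Fin m) (Fin n) ℝ) (ε : ℝ),
      (∀ i, ∃ j, A i j ≠ 0) → (∀ j, ∃ i, A i j ≠ 0) → 0 < ε →
      let η : ℝ := ε / (18 * MatrixGame.Lco A ^ 2)
      let T : ℕ := ⌈6 * Real.log (m * n) / (η * ε)⌉₊
      -- the implementation runs stochastic mirror descent
      (MatrixGame.execute A ε).map (MatrixGame.output m n) = MatrixGame.smdOutput A η T ∧
      -- the output is feasible and the runtime bound holds, whatever the random choices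
      (∀ s ∈ (MatrixGame.execute A ε).support,
        MatrixGame.output m n s ∈ MatrixGame.dom m n ∧
        (s.steps : ℝ) ≤
          C * (MatrixGame.Lco A ^ 2 * Real.log (m * n) ^ 2 / ε ^ 2 + m + n)) ∧
      -- the expected gap (nonnegative on the domain) is at most `ε`
      ∑' s, MatrixGame.execute A ε s *
          ENNReal.ofReal (MatrixGame.gap A (MatrixGame.output m n s)) ≤ ENNReal.ofReal ε := by
  refine ⟨120000, ?_⟩
  intro m n _ _ A ε hr hc hε η T
  have h := MatrixGame.execute_spec (A := A) (η := η) (T := T) hr hc ε rfl rfl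
  have hlaw : (MatrixGame.execute A ε).map (MatrixGame.output m n) = MatrixGame.smdOutput A η T :=
    (h.map_eq fun zs s hs => hs.1.symm).symm
  refine ⟨hlaw, ?_, ?_⟩
  · intro s hs
    -- Every final state of positive probability occurs in the coupling, so its relation holds for
    -- all random outcomes.
    obtain ⟨zs, -, -, hdom, dx, dy, hdx, hdy, hsteps⟩ := h.exists_left hs
    exact ⟨hdom, MatrixGame.steps_le (MatrixGame.Lco_pos hr) hε rfl rfl hdx hdy hsteps⟩
  · have hgap := MatrixGame.expect_gap_smdOutput_le (A := A) (η := η) (T := T) hr hc hε rfl rfl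
    rw [← hlaw, MatrixGame.expect_map] at hgap
    exact hgap
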